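/- **Setting.** A Markov decision process (MDP) $\mathcal M=(S,\mathit{Act},P,\mathit{init})$ has finite sets $S$ of states and $\mathit{Act}$ of actions, an initial state $\mathit{init}\in S$ and a function $P:S\times \mathit{Act}\times S\to[0,1]$ with $\sum_t P(s,\alpha,t)\in\{0,1\}$; $\alpha$ is enabled in $s$ if this sum is $1$, and a state is terminal if no action is enabled in it. A policy maps each finite path ending in a non-terminal state to a distribution over the actions enabled in its last state; $\mathrm{Pr}^{\mathfrak S}_{\mathcal M}$ is the induced probability measure on maximal paths from $\mathit{init}$, and $\mathrm{Pr}^{\min}_{\mathcal M,s}(\lozenge E)$, $\mathrm{Pr}^{\max}_{\mathcal M,s}(\lozenge E)$ are the extremal probabilities, over all policies, of reaching $E$ from $s$. A policy $\mathfrak S$ satisfies, for sets of states $C$ and $E$, * **(S)** if $\mathrm{Pr}^{\mathfrak S}(\lozenge E\mid(\neg C)\,\mathrm U\,c)>\mathrm{Pr}^{\mathfrak S}(\lozenge E)$ for all $c\in C$ with $\mathrm{Pr}^{\mathfrak S}((\neg C)\,\mathrm U\,c)>0$; * **(G)** if $\mathrm{Pr}^{\mathfrak S}(\lozenge E\mid\lozenge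 C)>\mathrm{Pr}^{\mathfrak S}(\lozenge E)$ (in particular $\mathrm{Pr}^{\mathfrak S}(\lozenge C)>0$). Let $E\subseteq S$ be a set of terminal states and $C\subseteq S\setminus E$. **Canonical MDP.** (i) Let $\mathcal M_1$ arise from $\mathcal M$ by deleting the outgoing transitions of each $c\in C$ and adding two actions $\alpha_{\min},\alpha_{\max}$ in $c$ that lead to a fresh terminal state $\mathit{TP}$ with probability $p_{c,\min}=\mathrm{Pr}^{\min}_{\mathcal M,c}(\lozenge E)$ resp. $p_{c,\max}=\mathrm{Pr}^{\max}_{\mathcal M,c}(\lozenge E)$, and to a fresh terminal state $\mathit{FP}$ with the remaining probability. (ii) Collapse each maximal end component (MEC) $\mathcal E$ of $\mathcal M_1$ into a single state $s_{\mathcal E}$, whose actions are the enabled state-action pairs $(s,\alpha)$ with $s$ in $\mathcal E$ that do not belong to $\mathcal E$. (iii) Collapse the states of $E$ into a fresh state $\mathit{FN}$ and all other terminal states of $\mathcal M_1$ except $\mathit{TP},\mathit{FP}$ into a fresh state $\mathit{TN}$, and add in each $s_{\mathcal E}$ an action $\tau$ leading to $\mathit{TN}$ with probability $1$. The result is the canonical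 MDP $[\mathcal M]_C$. Every $c\in C$ is again a state of it. **Corresponding policies.** Policies $\mathfrak S$ of $\mathcal M$ and $\mathfrak U$ of $[\mathcal M]_C$ correspond to each other if there is a policy $\mathfrak T$ of $\mathcal M_1$ such that * $\mathfrak T$ agrees with $\mathfrak S$ on the paths ending in a non-terminal state that have not visited $C$, and for every path $\pi$ of $\mathcal M$ whose last state $c$ is its first state in $C$, $\mathfrak T(\pi,\alpha_{\min})\,p_{c,\min}+\mathfrak T(\pi,\alpha_{\max})\,p_{c,\max}$ is the probability that $E$ is reached under $\mathfrak S$ after $\pi$; * for every finite path $\rho$ of $[\mathcal M]_C$ ending in a non-terminal state such that the collapsed run of $\mathfrak T$ (the run with the steps inside MECs left out) has prefix $\rho$ with positive probability, $\mathfrak U(\rho,(s,\alpha))$ is the conditional probability, given this, that the run next leaves the current collapsed state through $(s,\alpha)$, and $\mathfrak U(\rho,\tau)$ is the conditional probability that it stays in the current MEC forever. **Statement.** Every policy of $\mathcal M$ has a corresponding policy of $[\mathcal M]_C$, and every policy of $[\mathcal M]_C$ has a corresponding policy of $\mathcal M$. Whenever $\mathfrak S$ and $\mathfrak U$ correspond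 to each other, $$\begin{aligned}\mathrm{Pr}^{\mathfrak S}_{\mathcal M}(\lozenge C\wedge\lozenge E)&=\mathrm{Pr}^{\mathfrak U}_{[\mathcal M]_C}(\lozenge \mathit{TP}),&\mathrm{Pr}^{\mathfrak S}_{\mathcal M}(\lozenge C\wedge\neg\lozenge E)&=\mathrm{Pr}^{\mathfrak U}_{[\mathcal M]_C}(\lozenge \mathit{FP}),\\ \mathrm{Pr}^{\mathfrak S}_{\mathcal M}(\neg\lozenge C\wedge\lozenge E)&=\mathrm{Pr}^{\mathfrak U}_{[\mathcal M]_C}(\lozenge \mathit{FN}),&\mathrm{Pr}^{\mathfrak S}_{\mathcal M}(\neg\lozenge C\wedge\neg\lozenge E)&=\mathrm{Pr}^{\mathfrak U}_{[\mathcal M]_C}(\lozenge \mathit{TN}),\end{aligned}$$ and $\mathfrak S$ satisfies (S) (resp. (G)) for $C$ and $E$ in $\mathcal M$ if and only if $\mathfrak U$ satisfies (S) (resp. (G)) for $C$ and $\{\mathit{TP},\mathit{FN}\}$ in $[\mathcal M]_C$. -/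

import Mathlib

open MeasureTheory ProbabilityTheory

/-- A Markov decision process with states `S` and actions `A` (both finite). -/
structure MDP (S A : Type*) [Fintype S] [Fintype A] where
  /-- the probabilistic transition function -/
  P : S → A → S → ℝ
  P_nonneg : ∀ s a t, 0 ≤ P s a t
  P_sum : ∀ s a, ∑ t, P s a t = 0 ∨ ∑ t, P s a t = 1
  /-- the initial state -/
  init : S

/-- Finite nonempty alternating sequences `s₀ α₀ s₁ α₁ … sₙ` of states and actions. -/
inductive Hist (S A : Type*) where
  | start (s : S) : Hist S A
  | snoc (h : Hist S A) (a : A) (s : S) : Hist S A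

namespace Hist

variable {S A S' A' : Type*}

/-- The last state of a finite sequence. -/
def last : Hist S A → S
  | start s => s
  | snoc _ _ s => s

/-- Relabelling of states and actions. -/
def map (f : S → S') (g : A → A') : Hist S A → Hist S' A'
  | start s => start (f s)
  | snoc h a s => snoc (map f g h) (g a) (f s)

/-- No state of the sequence, except possibly the last one, lies in `C`. -/
def AvoidsBeforeLast (C : Set S) : Hist S A → Prop
  | start _ => True
  | snoc h _ _ => h.AvoidsBeforeLast C ∧ h.last ∉ C

/-- The sequence as a list (used for countability only). -/
def toList : Hist S A → List (Option A × S)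
  | start s => [(none, s)]
  | snoc h a s => (some a, s) :: h.toList

theorem toList_injective : Function.Injective (toList : Hist S A → List (Option A × S)) := by
  intro h
  induction h with
  | start s =>
    intro h' e
    cases h' with
    | start s' => simpa [toList] using e
    | snoc h' a' s' => simp [toList] at e
  | snoc h a s ih =>
    intro h' e
    cases h' with
    | start s' => simp [toList] at e
    | snoc h' a' s' =>
      simp only [toList, List.cons.injEq, Prod.mk.injEq, Option.some.injEq] at e
      obtain ⟨⟨rfl, rfl⟩, e⟩ := e
      rw [ih e]

instance [Countable S] [Countable A] : Countable (Hist S A) := toList_injective.countable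

instance : MeasurableSpace (Hist S A) := ⊤

instance : DiscreteMeasurableSpace (Hist S A) := ⟨fun _ => trivial⟩

end Hist

namespace MDP

/-- The fresh terminal states of the first step. -/
inductive Verdict where
  | TP
  | FP
  deriving DecidableEq

instance : Fintype Verdict := ⟨{.TP, .FP}, by rintro (_ | _) <;> decide⟩

/-- The fresh actions `α_min` and `α_max` of the first step. -/
inductive Extremal where
  | min
  | max
  deriving DecidableEq

instance : Fintype Extremal := ⟨{.min, .max}, by rintro (_ | _) <;> decide⟩

/-- The four terminal states of the canonical MDP. -/
inductive Outcome where
  | TP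
  | FP
  | FN
  | TN
  deriving DecidableEq

instance : Fintype Outcome :=
  ⟨{.TP, .FP, .FN, .TN}, by rintro (_ | _ | _ | _) <;> decide⟩

variable {S A : Type*} [Fintype S] [Fintype A]

/-- Action `a` is enabled in state `s`. -/
def Enabled (M : MDP S A) (s : S) (a : A) : Prop := ∑ t, M.P s a t = 1

/-- A state without enabled actions. -/
def IsTerminal (M : MDP S A) (s : S) : Prop := ∀ a, ¬ M.Enabled s a

/-- The finite sequences that are paths: every transition has positive probability. -/
def IsPath (M : MDP S A) : Hist S A → Prop
  | .start _ => True
  | .snoc h a t => M.IsPath h ∧ 0 < M.P h.last a t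

/-- A (randomized, history-dependent) policy: it chooses a distribution over the actions enabled
in the last state. For convenience it is given on all sequences; its values at sequences that are
not paths, or that end in a terminal state, play no role. -/
structure Policy (M : MDP S A) where
  /-- probability of choosing the action after the given history -/
  prob : Hist S A → A → ℝ
  nonneg : ∀ h, ¬ M.IsTerminal h.last → ∀ a, 0 ≤ prob h a
  sum_eq_one : ∀ h, ¬ M.IsTerminal h.last → ∑ a, prob h a = 1
  enabled : ∀ h, ¬ M.IsTerminal h.last → ∀ a, ¬ M.Enabled h.last a → prob h a = 0

section Chain

variable {M : MDP S A}

open scoped Classical in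
/-- One step of the Markov chain induced by a policy, whose states are the finite paths. Paths
that end in a terminal state are absorbing. -/
noncomputable def stepMeasure (σ : M.Policy) (h : Hist S A) : Measure (Hist S A) :=
  if M.IsTerminal h.last then Measure.dirac h
  else ∑ a, ∑ t, ENNReal.ofReal (σ.prob h a * M.P h.last a t) • Measure.dirac (h.snoc a t)

instance (σ : M.Policy) (h : Hist S A) : IsProbabilityMeasure (stepMeasure σ h) := by
  unfold stepMeasure
  split_ifs with ht
  · infer_instance
  · constructor
    simp only [Measure.coe_finsetSum, Finset.sum_apply, Measure.smul_apply, measure_univ,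
      smul_eq_mul, mul_one]
    have hn : ∀ a t, 0 ≤ σ.prob h a * M.P h.last a t := fun a t =>
      mul_nonneg (σ.nonneg h ht a) (M.P_nonneg _ _ _)
    have h1 : ∀ a, ∑ t, ENNReal.ofReal (σ.prob h a * M.P h.last a t)
        = ENNReal.ofReal (σ.prob h a) := by
      intro a
      rw [← ENNReal.ofReal_sum_of_nonneg fun t _ => hn a t, ← Finset.mul_sum]
      by_cases he : M.Enabled h.last a
      · rw [he, mul_one]
      · rw [σ.enabled h ht a he, zero_mul]
    simp only [h1]
    rw [← ENNReal.ofReal_sum_of_nonneg fun a _ => σ.nonneg h ht a, σ.sum_eq_one h ht,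
      ENNReal.ofReal_one]

/-- The transition kernel of the Markov chain induced by a policy. -/
noncomputable def stepKernel (σ : M.Policy) : Kernel (Hist S A) (Hist S A) where
  toFun := stepMeasure σ
  measurable' := Measurable.of_discrete

instance (σ : M.Policy) : IsMarkovKernel (stepKernel σ) :=
  ⟨fun h => inferInstanceAs (IsProbabilityMeasure (stepMeasure σ h))⟩

/-- The law of the Markov chain induced by `σ`, started in the finite path `h`. A maximal path is
represented by the sequence of its finite prefixes (from `h` on), eventually constant if the
maximal path is finite. For `h = start s` this is the standard measure on the maximal paths from
`s`; in general it is the one of the residual policy of `σ` after `h`, from the last state of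
`h`. -/
noncomputable def PrFrom (σ : M.Policy) (h : Hist S A) : Measure (ℕ → Hist S A) :=
  Kernel.traj (X := fun _ => Hist S A)
    (fun n => (stepKernel σ).comap
      (fun x : (i : Finset.Iic n) → Hist S A => x ⟨n, Finset.mem_Iic.2 le_rfl⟩)
      (measurable_pi_apply _)) 0 (fun _ => h)

instance (σ : M.Policy) (h : Hist S A) : IsProbabilityMeasure (PrFrom σ h) := by
  unfold PrFrom; infer_instance

/-- The law of the maximal paths from the initial state. -/
noncomputable def Pr (σ : M.Policy) : Measure (ℕ → Hist S A) := PrFrom σ (.start M.init)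

end Chain

/-- The event `X U T`. -/
def untilEv (X T : Set S) : Set (ℕ → Hist S A) :=
  {ω | ∃ j, (∀ i < j, (ω i).last ∈ X) ∧ (ω j).last ∈ T}

/-- The event `◇ T`. -/
def ev (T : Set S) : Set (ℕ → Hist S A) := untilEv Set.univ T

/-- Minimal probability of reaching `E` from `s`, over all policies. -/
noncomputable def prMin (M : MDP S A) (E : Set S) (s : S) : ℝ :=
  ⨅ σ : M.Policy, (PrFrom σ (.start s)).real (ev E)

/-- Maximal probability of reaching `E` from `s`, over all policies. -/
noncomputable def prMax (M : MDP S A) (E : Set S) (s : S) : ℝ :=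
  ⨆ σ : M.Policy, (PrFrom σ (.start s)).real (ev E)

/-- Condition (S) for `C` and `E`: for every `c ∈ C` that is reached with positive probability as
the first state of `C`, reaching `c` in this way raises the probability of reaching `E`. -/
def StrictPR (M : MDP S A) (C E : Set S) (σ : M.Policy) : Prop :=
  ∀ c ∈ C, 0 < Pr σ (untilEv Cᶜ {c}) →
    Pr σ (ev E) < (Pr σ)[ev E | untilEv Cᶜ {c}]

/-- Condition (G) for `C` and `E`: reaching `C` raises the probability of reaching `E`. (The
conditional probability is `0` if `C` is reached with probability `0`, so the condition then
fails.) -/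
def GlobalPR (M : MDP S A) (C E : Set S) (σ : M.Policy) : Prop :=
  Pr σ (ev E) < (Pr σ)[ev E | ev C]

/-! ### End components -/

/-- The states of a set of state-action pairs. -/
def pairStates (B : Set (S × A)) : Set S := Prod.fst '' B

/-- An end component, given by its state-action pairs: a strongly connected sub-MDP with at least
one state-action pair. -/
structure IsEndComponent (M : MDP S A) (B : Set (S × A)) : Prop where
  nonempty : B.Nonempty
  enabled : ∀ p ∈ B, M.Enabled p.1 p.2
  closed : ∀ p ∈ B, ∀ t, 0 < M.P p.1 p.2 t → t ∈ pairStates B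
  connected : ∀ s ∈ pairStates B, ∀ t ∈ pairStates B,
    Relation.ReflTransGen (fun u v => ∃ a, (u, a) ∈ B ∧ 0 < M.P u a v) s t

/-- A maximal end component. -/
def IsMEC (M : MDP S A) (B : Set (S × A)) : Prop := Maximal M.IsEndComponent B

/-- The state-action pair `(s, a)` belongs to a maximal end component. -/
def Internal (M : MDP S A) (s : S) (a : A) : Prop := ∃ B, M.IsMEC B ∧ (s, a) ∈ B

/-- The state `s` belongs to a maximal end component. -/
def InMEC (M : MDP S A) (s : S) : Prop := ∃ B, M.IsMEC B ∧ s ∈ pairStates B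

theorem IsEndComponent.union {M : MDP S A} {B B' : Set (S × A)} (hB : M.IsEndComponent B)
    (hB' : M.IsEndComponent B') {t : S} (ht : t ∈ pairStates B) (ht' : t ∈ pairStates B') :
    M.IsEndComponent (B ∪ B') := by
  have e : pairStates (B ∪ B') = pairStates B ∪ pairStates B' := Set.image_union _ _ _
  have mono : ∀ {D : Set (S × A)}, D ⊆ B ∪ B' → ∀ {u v : S},
      Relation.ReflTransGen (fun u v => ∃ a, (u, a) ∈ D ∧ 0 < M.P u a v) u v →
      Relation.ReflTransGen (fun u v => ∃ a, (u, a) ∈ B ∪ B' ∧ 0 < M.P u a v) u v :=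
    fun hD _ _ h => Relation.ReflTransGen.mono (fun _ _ ⟨a, ha, hp⟩ => ⟨a, hD ha, hp⟩) _ _ h
  refine ⟨hB.nonempty.inl, ?_, ?_, ?_⟩
  · rintro p (hp | hp)
    exacts [hB.enabled p hp, hB'.enabled p hp]
  · rintro p (hp | hp) u hu <;> rw [e]
    exacts [Or.inl (hB.closed p hp u hu), Or.inr (hB'.closed p hp u hu)]
  · rw [e]
    have to_t : ∀ u ∈ pairStates B ∪ pairStates B',
        Relation.ReflTransGen (fun u v => ∃ a, (u, a) ∈ B ∪ B' ∧ 0 < M.P u a v) u t := by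
      rintro u (hu | hu)
      exacts [mono Set.subset_union_left (hB.connected u hu t ht),
        mono Set.subset_union_right (hB'.connected u hu t ht')]
    have of_t : ∀ u ∈ pairStates B ∪ pairStates B',
        Relation.ReflTransGen (fun u v => ∃ a, (u, a) ∈ B ∪ B' ∧ 0 < M.P u a v) t u := by
      rintro u (hu | hu)
      exacts [mono Set.subset_union_left (hB.connected t ht u hu),
        mono Set.subset_union_right (hB'.connected t ht' u hu)]
    exact fun u hu v hv => (to_t u hu).trans (of_t v hv)

/-- Two states are identified iff they are equal or lie in a common maximal end component. -/
def mecSetoid (M : MDP S A) : Setoid S where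
  r s t := s = t ∨ ∃ B, M.IsMEC B ∧ s ∈ pairStates B ∧ t ∈ pairStates B
  iseqv := by
    refine ⟨fun _ => Or.inl rfl, ?_, ?_⟩
    · rintro s t (rfl | ⟨B, hB, hs, ht⟩)
      exacts [Or.inl rfl, Or.inr ⟨B, hB, ht, hs⟩]
    · rintro s t u (rfl | ⟨B, hB, hs, ht⟩) (rfl | ⟨B', hB', ht', hu⟩)
      · exact Or.inl rfl
      · exact Or.inr ⟨B', hB', ht', hu⟩
      · exact Or.inr ⟨B, hB, hs, ht⟩
      · have hU := hB.prop.union hB'.prop ht ht'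
        have h1 : B' ⊆ B := Set.subset_union_right.trans (hB.2 hU Set.subset_union_left)
        exact Or.inr ⟨B, hB, hs, Set.image_mono h1 hu⟩

/-! ### The canonical MDP -/

/-- `p_{c,min}` for `α_min` and `p_{c,max}` for `α_max`. -/
noncomputable def prExt (M : MDP S A) (E : Set S) : Extremal → S → ℝ
  | .min => M.prMin E
  | .max => M.prMax E

theorem prExt_mem (M : MDP S A) (E : Set S) (x : Extremal) (s : S) :
    0 ≤ M.prExt E x s ∧ M.prExt E x s ≤ 1 := by
  cases x with
  | min =>
    refine ⟨Real.iInf_nonneg fun _ => measureReal_nonneg, ?_⟩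
    rcases isEmpty_or_nonempty M.Policy with h | ⟨⟨σ⟩⟩
    · simp [prExt, prMin, Real.iInf_of_isEmpty]
    · exact (ciInf_le ⟨0, by rintro _ ⟨σ, rfl⟩; exact measureReal_nonneg⟩ σ).trans
        measureReal_le_one
  | max =>
    exact ⟨Real.iSup_nonneg fun _ => measureReal_nonneg,
      Real.iSup_le (fun _ => measureReal_le_one) zero_le_one⟩

open scoped Classical in
/-- Transition function after the first step. -/
noncomputable def minmaxP (M : MDP S A) (C E : Set S) :
    S ⊕ Verdict → A ⊕ Extremal → S ⊕ Verdict → ℝ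
  | .inl s, .inl a, .inl t => if s ∈ C then 0 else M.P s a t
  | .inl s, .inr x, .inr .TP => if s ∈ C then M.prExt E x s else 0
  | .inl s, .inr x, .inr .FP => if s ∈ C then 1 - M.prExt E x s else 0
  | _, _, _ => 0

/-- First step of the construction: the outgoing transitions of each `c ∈ C` are replaced by the
two actions `α_min`, `α_max`, which lead to `TP` with the minimal resp. maximal probability of
reaching `E` from `c`, and to `FP` otherwise. -/
noncomputable def minmax (M : MDP S A) (C E : Set S) : MDP (S ⊕ Verdict) (A ⊕ Extremal) where
  P := M.minmaxP C E
  P_nonneg := by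
    rintro (s | v) (a | x) (t | (_ | _)) <;> simp only [minmaxP, le_refl]
    · split_ifs
      exacts [le_rfl, M.P_nonneg _ _ _]
    · split_ifs
      exacts [(M.prExt_mem E x s).1, le_rfl]
    · split_ifs
      exacts [sub_nonneg.2 (M.prExt_mem E x s).2, le_rfl]
  P_sum := by
    have hv : ∀ f : Verdict → ℝ, ∑ v, f v = f .TP + f .FP := fun f => by
      rw [show (Finset.univ : Finset Verdict) = {.TP, .FP} from rfl,
        Finset.sum_pair (by decide)]
    rintro (s | v) (a | x) <;> simp only [Fintype.sum_sum_type, hv, minmaxP]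
    · by_cases hs : s ∈ C <;> simp [hs, M.P_sum]
    · by_cases hs : s ∈ C <;> simp [hs]
    · simp
    · simp
  init := .inl M.init

/-- The states of the canonical MDP: the four outcomes, and the nonterminal states of the MDP of
the first step, where the states of each maximal end component are collapsed into one. -/
abbrev CanState (M : MDP S A) (C E : Set S) : Type _ :=
  Outcome ⊕ Quotient ((M.minmax C E).mecSetoid.comap
    (Subtype.val : {s // ¬ (M.minmax C E).IsTerminal s} → S ⊕ Verdict))

noncomputable instance (M : MDP S A) (C E : Set S) : Fintype (M.CanState C E) :=
  Fintype.ofFinite _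

/-- The actions of the canonical MDP: the state-action pairs of the MDP of the first step (in a
collapsed state one has to say which of its states the action belongs to), and `τ`. -/
inductive CanAct (S A : Type*) where
  | ext (s : S ⊕ Verdict) (a : A ⊕ Extremal)
  | tau

/-- The actions other than `τ` are pairs (used for finiteness only). -/
def CanAct.equivOption : CanAct S A ≃ Option ((S ⊕ Verdict) × (A ⊕ Extremal)) where
  toFun
    | .ext s a => some (s, a)
    | .tau => none
  invFun
    | some (s, a) => .ext s a
    | none => .tau
  left_inv := by rintro (_ | _) <;> rfl
  right_inv := by rintro (_ | _) <;> rfl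

noncomputable instance : Fintype (CanAct S A) := Fintype.ofEquiv _ CanAct.equivOption.symm

open scoped Classical in
/-- The collapsing map from the MDP of the first step to the canonical MDP: nonterminal states go
to their classes, the states of `E` to `FN`, all other terminal states (except `TP`, `FP`) to
`TN`. -/
noncomputable def proj (M : MDP S A) (C E : Set S) : S ⊕ Verdict → M.CanState C E
  | .inl s =>
    if hs : ¬ (M.minmax C E).IsTerminal (.inl s) then .inr (Quotient.mk _ ⟨.inl s, hs⟩)
    else if s ∈ E then .inl .FN else .inl .TN
  | .inr .TP => .inl .TP
  | .inr .FP => .inl .FP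

open scoped Classical in
/-- Transition function of the canonical MDP. An action `(s, a)` is available in the class of `s`
unless it belongs to a maximal end component; `τ` leads from collapsed end components to `TN`. -/
noncomputable def canP (M : MDP S A) (C E : Set S) :
    M.CanState C E → CanAct S A → M.CanState C E → ℝ
  | q, .ext s a, u =>
    if M.proj C E s = q ∧ ¬ (M.minmax C E).Internal s a then
      ∑ t, if M.proj C E t = u then (M.minmax C E).P s a t else 0
    else 0
  | q, .tau, u =>
    if (∃ s, (M.minmax C E).InMEC s ∧ M.proj C E s = q) ∧ u = .inl .TN then 1 else 0

/-- The canonical MDP. -/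
noncomputable def canonical (M : MDP S A) (C E : Set S) :
    MDP (M.CanState C E) (CanAct S A) where
  P := M.canP C E
  P_nonneg := by
    rintro q (⟨s, a⟩ | _) u <;> simp only [canP] <;> split_ifs
    · refine Finset.sum_nonneg fun t _ => ?_
      split_ifs
      exacts [(M.minmax C E).P_nonneg _ _ _, le_rfl]
    · exact le_rfl
    · exact zero_le_one
    · exact le_rfl
  P_sum := by
    classical
    rintro q (⟨s, a⟩ | _) <;> simp only [canP]
    · by_cases h : M.proj C E s = q ∧ ¬ (M.minmax C E).Internal s a
      · simp only [if_pos h]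
        rw [Finset.sum_comm]
        simpa using (M.minmax C E).P_sum s a
      · simp only [if_neg h]
        simp
    · by_cases h : ∃ s, (M.minmax C E).InMEC s ∧ M.proj C E s = q
      · simp only [h, true_and]
        simp
      · simp only [h, false_and, if_false]
        simp
  init := M.proj C E (.inl M.init)

/-- The copy of `C` in the canonical MDP. -/
def canC (M : MDP S A) (C E : Set S) : Set (M.CanState C E) := (fun c => M.proj C E (.inl c)) '' C

/-- The set `{TP, FN}` in the canonical MDP. -/
def canE (M : MDP S A) (C E : Set S) : Set (M.CanState C E) := {.inl .TP, .inl .FN}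

/-! ### Corresponding policies -/

/-- Corresponding policies of `M` and of the MDP of the first step: they agree on paths that have
not visited `C`; on a path that has just reached `C` in its last state `c`, the actions
`α_min` and `α_max` are randomized such that `TP` is reached with the probability with which the
residual policy of `σ` reaches `E`. -/
def CorrMinmax (M : MDP S A) (C E : Set S) (σ : M.Policy) (θ : (M.minmax C E).Policy) : Prop :=
  ∀ h : Hist S A, M.IsPath h → h.AvoidsBeforeLast C →
    (h.last ∉ C → ¬ M.IsTerminal h.last →
      ∀ a, θ.prob (h.map .inl .inl) (.inl a) = σ.prob h a) ∧
    (h.last ∈ C →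
      θ.prob (h.map .inl .inl) (.inr .min) * M.prMin E h.last +
        θ.prob (h.map .inl .inl) (.inr .max) * M.prMax E h.last = (PrFrom σ h).real (ev E))

open scoped Classical in
/-- The image in the canonical MDP of a finite path of the MDP of the first step: steps inside
maximal end components are left out. -/
noncomputable def collapse (M : MDP S A) (C E : Set S) :
    Hist (S ⊕ Verdict) (A ⊕ Extremal) → Hist (M.CanState C E) (CanAct S A)
  | .start s => .start (M.proj C E s)
  | .snoc h a t =>
    if (M.minmax C E).Internal h.last a then collapse M C E h
    else .snoc (collapse M C E h) (.ext h.last a) (M.proj C E t)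

/-- Corresponding policies of the MDP of the first step and of the canonical MDP: after the
nonterminal path `ρ` of the canonical MDP, `υ` chooses the action `(s, a)` with the conditional
probability, given that the collapsed run of `θ` has `ρ` as a prefix, that this run continues with
`(s, a)`, and `τ` with the conditional probability that it stays in the end component forever. -/
def CorrQuotient (M : MDP S A) (C E : Set S) (θ : (M.minmax C E).Policy)
    (υ : (M.canonical C E).Policy) : Prop :=
  ∀ ρ : Hist (M.CanState C E) (CanAct S A), ¬ (M.canonical C E).IsTerminal ρ.last →
    (∀ s a, υ.prob ρ (.ext s a) * (Pr θ).real {ω | ∃ n, M.collapse C E (ω n) = ρ} =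
      (Pr θ).real {ω | ∃ n u, M.collapse C E (ω n) = ρ.snoc (.ext s a) u}) ∧
    υ.prob ρ .tau * (Pr θ).real {ω | ∃ n, M.collapse C E (ω n) = ρ} =
      (Pr θ).real {ω | ∃ k, ∀ n ≥ k, M.collapse C E (ω n) = ρ}

/-- A policy `σ` of `M` and a policy `υ` of the canonical MDP correspond to each other. -/
def Corresponds (M : MDP S A) (C E : Set S) (σ : M.Policy) (υ : (M.canonical C E).Policy) :
    Prop :=
  ∃ θ : (M.minmax C E).Policy, M.CorrMinmax C E σ θ ∧ M.CorrQuotient C E θ υ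

end MDP

/-! The proof passes through the intermediate MDP `minmax`, called M₁ here. `CorrMinmax` relates M
to M₁ and `CorrQuotient` relates M₁ to the canonical MDP; both halves are treated separately. In all
three MDPs probabilities are computed from weights of finite paths: if every run meets a set G of
histories at most once, the probability of meeting G is the sum of the weights of its members
(`PrFrom_visits`).

M and M₁. Up to the first visit to C both have the same paths with the same weights
(`CorrMinmax.wt_eq`). Once a state c of C is reached, only the probability of reaching E afterwards
matters. Optimal memoryless policies exist (discount, then let the discount factor tend to 1), so
this number lies between p_min and p_max and is a mixture of α_min and α_max. Conversely, each
mixture of the two optimal policies is realised by one policy (`exists_policy_mix`).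

M₁ and the canonical MDP. Given θ, the policy υ consists of conditional probabilities: the events of
leaving by some (s, α) and of staying forever partition the event that ρ is a prefix of the
collapsed run (`prob_prefixEv`), and the target of the leaving step depends on (s, α) only
(`prob_prefixEv_snoc`). Given υ, let θ walk uniformly inside the current end component. This walk
meets every state of the component almost surely (`walkPolicy_hits`). At the first visit to s the
exits from s are offered, with the probabilities prescribed by υ conditioned on not having left yet.
Each exit is then used with exactly the prescribed probability, and the mass of τ is what walks on
forever (`IsWalkExit.corrQuotient`).

Transfer. The weight of a τ-free path ρ under υ is the probability that the collapsed run of θ has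
prefix ρ (`CorrQuotient.wt_eq`). This yields TP, by splitting at the first state in C, and FN. Since
states of C lead only to TP and FP, FP is the rest of reaching C. TN is the rest of avoiding C,
which requires that canonical runs terminate almost surely (`CorrQuotient.prob_terminal`); this
rests on the fact that a run of M₁ almost surely ends or eventually stays in an end component
(`ae_terminal_or_internal`). Conditions (S) and (G) compare quotients of transferred probabilities.
-/

namespace Hist

/-! ### The prefix order on histories -/

variable {S A S' A' : Type*}

/-- The number of transitions of a finite sequence. -/
def len : Hist S A → ℕ
  | start _ => 0
  | snoc h _ _ => h.len + 1

/-- `g.Pre h`: the sequence `g` is a prefix of `h`. -/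
def Pre (g : Hist S A) : Hist S A → Prop
  | start s => g = start s
  | snoc h a s => g = snoc h a s ∨ Pre g h

@[simp] theorem last_start (s : S) : (start s : Hist S A).last = s := rfl

@[simp] theorem last_snoc (h : Hist S A) (a : A) (s : S) : (h.snoc a s).last = s := rfl

theorem Pre.refl (g : Hist S A) : g.Pre g := by
  cases g <;> simp [Pre]

theorem Pre.snoc {g h : Hist S A} (H : g.Pre h) (a : A) (s : S) : g.Pre (h.snoc a s) := Or.inr H

theorem pre_snoc_self (h : Hist S A) (a : A) (s : S) : h.Pre (h.snoc a s) := (Pre.refl h).snoc a s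

theorem Pre.trans {f g h : Hist S A} (H : f.Pre g) (K : g.Pre h) : f.Pre h := by
  induction h with
  | start s => cases K; exact H
  | snoc h a s ih =>
    rcases K with rfl | K
    · exact H
    · exact Or.inr (ih K)

theorem Pre.len_le {g h : Hist S A} (H : g.Pre h) : g.len ≤ h.len := by
  induction h with
  | start s => cases H; exact le_rfl
  | snoc h a s ih =>
    rcases H with rfl | H
    · exact le_rfl
    · exact (ih H).trans (Nat.le_succ _)

theorem Pre.eq_of_len_le {g h : Hist S A} (H : g.Pre h) (hl : h.len ≤ g.len) : g = h := by
  cases h with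
  | start s => exact H
  | snoc h a s =>
    rcases H with rfl | H
    · rfl
    · have := H.len_le
      simp only [len] at hl
      omega

theorem Pre.antisymm {g h : Hist S A} (H : g.Pre h) (K : h.Pre g) : g = h :=
  H.eq_of_len_le K.len_le

theorem not_snoc_pre (h : Hist S A) (a : A) (s : S) : ¬ (h.snoc a s).Pre h := fun H => by
  have := H.len_le
  simp [len] at this

theorem ne_snoc (h : Hist S A) (a : A) (s : S) : h ≠ h.snoc a s := fun H =>
  not_snoc_pre h a s (H ▸ Pre.refl _)

theorem Pre.total {f g h : Hist S A} (H : f.Pre h) (K : g.Pre h) : f.Pre g ∨ g.Pre f := by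
  induction h with
  | start s => cases H; cases K; exact Or.inl (Pre.refl _)
  | snoc h a s ih =>
    rcases H with rfl | H
    · rcases K with rfl | K
      exacts [Or.inl (Pre.refl _), Or.inr (Or.inr K)]
    · rcases K with rfl | K
      exacts [Or.inl (Or.inr H), ih H K]

theorem Pre.eq_or_snoc {g h : Hist S A} (H : g.Pre h) : g = h ∨ ∃ a t, (g.snoc a t).Pre h := by
  induction h with
  | start s => exact Or.inl H
  | snoc h a s ih =>
    rcases H with rfl | H
    · exact Or.inl rfl
    · rcases ih H with rfl | ⟨b, t, K⟩
      exacts [Or.inr ⟨a, s, Pre.refl _⟩, Or.inr ⟨b, t, Or.inr K⟩]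

theorem snoc_pre_unique {g h : Hist S A} {a a' : A} {t t' : S} (H : (g.snoc a t).Pre h)
    (K : (g.snoc a' t').Pre h) : a = a' ∧ t = t' := by
  rcases H.total K with H | H
  · have := H.eq_of_len_le le_rfl
    simpa using this
  · have := H.eq_of_len_le le_rfl
    simpa [eq_comm] using this

/-- A sequence of finite sequences each of which extends the previous one by at most one
transition. -/
def IsChain (x : ℕ → Hist S A) : Prop := ∀ n, x (n + 1) = x n ∨ ∃ a t, x (n + 1) = (x n).snoc a t

theorem IsChain.pre {x : ℕ → Hist S A} (hx : IsChain x) {n m : ℕ} (h : n ≤ m) :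
    (x n).Pre (x m) := by
  induction m, h using Nat.le_induction with
  | base => exact Pre.refl _
  | succ m _ ih =>
    rcases hx m with e | ⟨a, t, e⟩ <;> rw [e]
    exacts [ih, ih.snoc a t]

/-- A discrete intermediate value property: growing by at most one transition at a time, the chain
cannot jump over a history. -/
theorem IsChain.exists_eq {x : ℕ → Hist S A} (hx : IsChain x) {g : Hist S A} {n : ℕ}
    (h0 : (x 0).Pre g) (hn : g.Pre (x n)) : ∃ m ≤ n, x m = g := by
  induction n with
  | zero => exact ⟨0, le_rfl, h0.antisymm hn⟩
  | succ n ih =>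
    have key : g = x (n + 1) ∨ g.Pre (x n) := by
      rcases hx n with e | ⟨a, t, e⟩ <;> rw [e] at hn ⊢
      exacts [Or.inr hn, hn]
    rcases key with rfl | h
    · exact ⟨n + 1, le_rfl, rfl⟩
    · obtain ⟨m, hm, e⟩ := ih h
      exact ⟨m, hm.trans (Nat.le_succ _), e⟩

theorem IsChain.total {x : ℕ → Hist S A} (hx : IsChain x) (n m : ℕ) :
    (x n).Pre (x m) ∨ (x m).Pre (x n) :=
  (le_total n m).imp hx.pre hx.pre

/-- Supplies the hypothesis `(x 0).Pre g` of `IsChain.exists_eq` for chains that begin in a single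
state. -/
theorem start_pre_of_pre {s : S} {g h : Hist S A} (H : (start s).Pre h) (K : g.Pre h) :
    (start s).Pre g := by
  rcases H.total K with H | H
  · exact H
  · rw [show g = start s from H]; exact Pre.refl _

end Hist

/-! ### The Markov chain of a policy: events, runs and path weights -/

namespace MDP

section Events

variable {S A : Type*}

theorem measurableSet_eval_mem (n : ℕ) (G : Set (Hist S A)) :
    MeasurableSet {ω : ℕ → Hist S A | ω n ∈ G} :=
  (measurable_pi_apply n : Measurable fun ω : ℕ → Hist S A => ω n) (MeasurableSet.of_discrete (s := G))

theorem measurableSet_visits (G : Set (Hist S A)) :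
    MeasurableSet {ω : ℕ → Hist S A | ∃ n, ω n ∈ G} := by
  rw [show {ω : ℕ → Hist S A | ∃ n, ω n ∈ G} = ⋃ n, (fun ω => ω n) ⁻¹' G by ext; simp]
  exact MeasurableSet.iUnion fun n => measurableSet_eval_mem n G

theorem ev_eq_visits (E : Set S) :
    (ev E : Set (ℕ → Hist S A)) = {ω | ∃ n, ω n ∈ {g : Hist S A | g.last ∈ E}} := by
  ext ω; simp [ev, untilEv]

theorem measurableSet_ev (E : Set S) : MeasurableSet (ev E : Set (ℕ → Hist S A)) := by
  rw [ev_eq_visits]; exact measurableSet_visits _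

end Events

variable {S A : Type*} [Fintype S] [Fintype A] {M : MDP S A}

open Hist

/-- The Markov property at time `n`: the trajectory up to `n` together with the next step is
distributed as a composition-product with the step kernel, and that kernel looks at coordinate `n`
only. Below, the trajectory construction enters only through this lemma and `PrFrom_zero`. -/
theorem lintegral_pair_PrFrom (σ : M.Policy) (h : Hist S A) (n : ℕ)
    (f : Hist S A → Hist S A → ENNReal) :
    ∫⁻ ω, f (ω n) (ω (n + 1)) ∂PrFrom σ h =
      ∫⁻ ω, ∫⁻ y, f (ω n) y ∂stepMeasure σ (ω n) ∂PrFrom σ h := by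
  unfold PrFrom
  set κ : (n : ℕ) → Kernel ((i : Finset.Iic n) → Hist S A) (Hist S A) :=
    fun n => (stepKernel σ).comap
      (fun x : (i : Finset.Iic n) → Hist S A => x ⟨n, Finset.mem_Iic.2 le_rfl⟩)
      (measurable_pi_apply _) with hκ
  have key := Kernel.partialTraj_compProd_eq_map_traj (X := fun _ => Hist S A) (κ := κ)
    (Nat.zero_le n) (x₀ := fun _ => h)
  have hm : Measurable (fun x : (i : Finset.Iic n) → Hist S A =>
      x ⟨n, Finset.mem_Iic.2 le_rfl⟩) := measurable_pi_apply _
  have hf : Measurable (fun p : Hist S A × Hist S A => f p.1 p.2) := Measurable.of_discrete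
  have hF : Measurable (fun p : ((i : Finset.Iic n) → Hist S A) × Hist S A =>
      f (p.1 ⟨n, Finset.mem_Iic.2 le_rfl⟩) p.2) :=
    hf.comp ((hm.comp measurable_fst).prodMk measurable_snd)
  have h1 := congrArg (fun μ : Measure (((i : Finset.Iic n) → Hist S A) × Hist S A) =>
    ∫⁻ p, f (p.1 ⟨n, Finset.mem_Iic.2 le_rfl⟩) p.2 ∂μ) key
  rw [lintegral_map hF (by fun_prop), Measure.lintegral_compProd hF] at h1
  refine h1.symm.trans ?_
  have hg : Measurable (fun y : Hist S A => ∫⁻ z, f y z ∂stepMeasure σ y) := Measurable.of_discrete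
  rw [← Kernel.traj_map_frestrictLe_apply]
  exact lintegral_map (hg.comp hm) (by fun_prop)

theorem lintegral_stepMeasure_of_terminal (σ : M.Policy) {h : Hist S A} (ht : M.IsTerminal h.last)
    (f : Hist S A → ENNReal) : ∫⁻ y, f y ∂stepMeasure σ h = f h := by
  rw [stepMeasure, if_pos ht, lintegral_dirac]

theorem lintegral_stepMeasure (σ : M.Policy) {h : Hist S A} (ht : ¬ M.IsTerminal h.last)
    (f : Hist S A → ENNReal) : ∫⁻ y, f y ∂stepMeasure σ h =
      ∑ a, ∑ t, ENNReal.ofReal (σ.prob h a * M.P h.last a t) * f (h.snoc a t) := by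
  rw [stepMeasure, if_neg ht]
  simp [lintegral_finsetSum_measure]

theorem PrFrom_zero (σ : M.Policy) (h : Hist S A) : ∀ᵐ ω ∂PrFrom σ h, ω 0 = h := by
  unfold PrFrom
  have hm : Measurable (fun x : (i : Finset.Iic 0) → Hist S A =>
      x ⟨0, Finset.mem_Iic.2 le_rfl⟩) := measurable_pi_apply _
  have hp : MeasurableSet {x : (i : Finset.Iic 0) → Hist S A |
      x ⟨0, Finset.mem_Iic.2 le_rfl⟩ = h} := hm (measurableSet_singleton h)
  have key := Kernel.traj_map_frestrictLe_apply (X := fun _ => Hist S A)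
    (κ := fun n => (stepKernel σ).comap
      (fun x : (i : Finset.Iic n) → Hist S A => x ⟨n, Finset.mem_Iic.2 le_rfl⟩)
      (measurable_pi_apply _)) 0 0 (fun _ => h)
  have : ∀ᵐ x ∂(Kernel.partialTraj (X := fun _ => Hist S A)
    (fun n => (stepKernel σ).comap
      (fun x : (i : Finset.Iic n) → Hist S A => x ⟨n, Finset.mem_Iic.2 le_rfl⟩)
      (measurable_pi_apply _)) 0 0 (fun _ => h)), x ⟨0, Finset.mem_Iic.2 le_rfl⟩ = h := by
    rw [Kernel.partialTraj_self, Kernel.id_apply, ae_dirac_iff hp]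
  rw [← key] at this
  exact ae_of_ae_map (by fun_prop) this

/-- A run of the Markov chain induced by `σ`, started in `h`. -/
structure IsRun (σ : M.Policy) (h : Hist S A) (ω : ℕ → Hist S A) : Prop where
  zero : ω 0 = h
  step : ∀ n, (M.IsTerminal (ω n).last ∧ ω (n + 1) = ω n) ∨
    (¬ M.IsTerminal (ω n).last ∧ ∃ a t, ω (n + 1) = (ω n).snoc a t ∧
      0 < σ.prob (ω n) a ∧ 0 < M.P (ω n).last a t)

/-- A forbidden step has probability zero at each of the countably many times. Afterwards events
need only be compared along runs, by deterministic arguments. -/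
theorem ae_isRun (σ : M.Policy) (h : Hist S A) : ∀ᵐ ω ∂PrFrom σ h, IsRun σ h ω := by
  have hs : ∀ n, ∀ᵐ ω ∂PrFrom σ h, (M.IsTerminal (ω n).last ∧ ω (n + 1) = ω n) ∨
    (¬ M.IsTerminal (ω n).last ∧ ∃ a t, ω (n + 1) = (ω n).snoc a t ∧
      0 < σ.prob (ω n) a ∧ 0 < M.P (ω n).last a t) := by
    intro n
    classical
    -- The indicator of a forbidden step from `x` to `y`.
    let f : Hist S A → Hist S A → ENNReal := fun x y =>
      if (M.IsTerminal x.last ∧ y = x) ∨ (¬ M.IsTerminal x.last ∧ ∃ a t, y = x.snoc a t ∧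
        0 < σ.prob x a ∧ 0 < M.P x.last a t) then 0 else 1
    have h0 : ∀ x, ∫⁻ y, f x y ∂stepMeasure σ x = 0 := by
      intro x
      by_cases hx : M.IsTerminal x.last
      · rw [lintegral_stepMeasure_of_terminal σ hx]
        simp [f, hx]
      · rw [lintegral_stepMeasure σ hx]
        refine Finset.sum_eq_zero fun a _ => Finset.sum_eq_zero fun t _ => ?_
        by_cases hp : 0 < σ.prob x a ∧ 0 < M.P x.last a t
        · have : f x (x.snoc a t) = 0 := by
            simp only [f]
            rw [if_pos]
            exact Or.inr ⟨hx, a, t, rfl, hp.1, hp.2⟩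
          rw [this, mul_zero]
        · have : σ.prob x a * M.P x.last a t = 0 := by
            have h1 := σ.nonneg x hx a
            have h2 := M.P_nonneg x.last a t
            rcases h1.eq_or_lt with e | h1
            · rw [← e, zero_mul]
            · rcases h2.eq_or_lt with e | h2
              · rw [← e, mul_zero]
              · exact absurd ⟨h1, h2⟩ hp
          rw [this, ENNReal.ofReal_zero, zero_mul]
    have h1 := lintegral_pair_PrFrom σ h n f
    simp only [h0, lintegral_zero] at h1
    have hmf : Measurable (fun ω : ℕ → Hist S A => f (ω n) (ω (n + 1))) := by
      have hf : Measurable (fun p : Hist S A × Hist S A => f p.1 p.2) := Measurable.of_discrete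
      exact hf.comp (((measurable_pi_apply n : Measurable fun ω : ℕ → Hist S A => ω n)).prodMk
        (measurable_pi_apply (n + 1) : Measurable fun ω : ℕ → Hist S A => ω (n + 1)))
    rw [lintegral_eq_zero_iff hmf] at h1
    filter_upwards [h1] with ω hω
    by_contra hc
    simp only [f, if_neg hc, Pi.zero_apply, one_ne_zero] at hω
  filter_upwards [PrFrom_zero σ h, ae_all_iff.2 hs] with ω h0 h1
  exact ⟨h0, h1⟩

theorem IsRun.isChain {σ : M.Policy} {h : Hist S A} {ω : ℕ → Hist S A} (hω : IsRun σ h ω) :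
    IsChain ω := fun n => by
  rcases hω.step n with ⟨_, e⟩ | ⟨_, a, t, e, _⟩
  exacts [Or.inl e, Or.inr ⟨a, t, e⟩]

theorem IsRun.eq_of_terminal {σ : M.Policy} {h : Hist S A} {ω : ℕ → Hist S A} (hω : IsRun σ h ω)
    {n m : ℕ} (hn : M.IsTerminal (ω n).last) (hm : n ≤ m) : ω m = ω n := by
  induction m, hm using Nat.le_induction with
  | base => rfl
  | succ m _ ih =>
    rcases hω.step m with ⟨_, e⟩ | ⟨ht, _⟩
    · rw [e, ih]
    · rw [ih] at ht
      exact absurd hn ht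

theorem IsRun.isPath {σ : M.Policy} {h : Hist S A} {ω : ℕ → Hist S A} (hω : IsRun σ h ω)
    (hh : M.IsPath h) (n : ℕ) : M.IsPath (ω n) := by
  induction n with
  | zero => rwa [hω.zero]
  | succ n ih =>
    rcases hω.step n with ⟨_, e⟩ | ⟨_, a, t, e, _, hp⟩
    · rwa [e]
    · rw [e]; exact ⟨ih, hp⟩

/-- A run leaves a nonterminal finite path by a transition. -/
theorem IsRun.snoc_of_ne {σ : M.Policy} {h : Hist S A} {ω : ℕ → Hist S A} (hω : IsRun σ h ω)
    {n : ℕ} (hn : ¬ M.IsTerminal (ω n).last) : ∃ a t, ω (n + 1) = (ω n).snoc a t ∧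
      0 < σ.prob (ω n) a ∧ 0 < M.P (ω n).last a t := by
  rcases hω.step n with ⟨ht, _⟩ | ⟨_, h⟩
  exacts [absurd ht hn, h]

open scoped Classical in
/-- The probability of extending `h` by the transition `(a, t)`. -/
noncomputable def pw (σ : M.Policy) (h : Hist S A) (a : A) (t : S) : ENNReal :=
  if M.IsTerminal h.last then 0 else ENNReal.ofReal (σ.prob h a * M.P h.last a t)

open scoped Classical in
/-- The probability that the chain started in `h₀` visits `g`. -/
noncomputable def wt (σ : M.Policy) (h₀ : Hist S A) : Hist S A → ENNReal
  | .start s => if Hist.start s = h₀ then 1 else 0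
  | .snoc h a t => if h.snoc a t = h₀ then 1 else wt σ h₀ h * pw σ h a t

theorem wt_self (σ : M.Policy) (h : Hist S A) : wt σ h h = 1 := by
  cases h <;> simp [wt]

theorem wt_snoc_of_ne {σ : M.Policy} {h₀ h : Hist S A} {a : A} {t : S} (hne : h.snoc a t ≠ h₀) :
    wt σ h₀ (h.snoc a t) = wt σ h₀ h * pw σ h a t := by
  simp [wt, hne]

theorem wt_start_snoc (σ : M.Policy) (s : S) (h : Hist S A) (a : A) (t : S) :
    wt σ (.start s) (h.snoc a t) = wt σ (.start s) h * pw σ h a t :=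
  wt_snoc_of_ne (by simp)

theorem wt_snoc_of_pre {σ : M.Policy} {h₀ h : Hist S A} (H : h₀.Pre h) (a : A) (t : S) :
    wt σ h₀ (h.snoc a t) = wt σ h₀ h * pw σ h a t :=
  wt_snoc_of_ne (by rintro rfl; exact not_snoc_pre _ _ _ H)

theorem pre_of_wt_ne_zero {σ : M.Policy} {h₀ g : Hist S A} (h : wt σ h₀ g ≠ 0) : h₀.Pre g := by
  induction g with
  | start s => simp only [wt] at h; split_ifs at h with e; exacts [e.symm, absurd rfl h]
  | snoc g a t ih =>
    by_cases e : g.snoc a t = h₀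
    · rw [e]; exact Pre.refl _
    · rw [wt_snoc_of_ne e] at h
      exact Or.inr (ih (left_ne_zero_of_mul h))

theorem wt_mul_of_pre {σ : M.Policy} {s : S} {g e : Hist S A} (H : g.Pre e) :
    wt σ (.start s) e = wt σ (.start s) g * wt σ g e := by
  induction e with
  | start t => cases H; rw [wt_self, mul_one]
  | snoc e a t ih =>
    rcases H with rfl | H
    · rw [wt_self, mul_one]
    · rw [wt_start_snoc, wt_snoc_of_pre H, ih H, mul_assoc]

/-- Induction on `g`. A new history `h.snoc a t` can only be reached directly from `h`. A
nonterminal `h` is occupied at one time at most, so the events of making this step at time `n` are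
disjoint, and by the Markov property each contributes the factor `pw σ h a t`. -/
theorem PrFrom_visits_singleton (σ : M.Policy) (h₀ g : Hist S A) :
    PrFrom σ h₀ {ω | ∃ n, ω n = g} = wt σ h₀ g := by
  classical
  by_cases hg : g = h₀
  · subst hg
    rw [wt_self]
    refine (prob_compl_eq_zero_iff (measurableSet_visits {g})).1 ?_
    refine measure_mono_null ?_ (ae_isRun σ g)
    intro ω hω hr
    exact hω ⟨0, hr.zero⟩
  induction g with
  | start s =>
    rw [show wt σ h₀ (start s) = 0 by simp [wt, hg]]
    refine measure_mono_null ?_ (ae_isRun σ h₀)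
    rintro ω ⟨n, hn⟩ hr
    have h1 := hr.isChain.pre (Nat.zero_le n)
    rw [hr.zero, hn] at h1
    exact hg h1.symm
  | snoc h a t ih =>
    rw [wt_snoc_of_ne hg]
    have ih' : PrFrom σ h₀ {ω | ∃ n, ω n = h} = wt σ h₀ h := by
      by_cases e : h = h₀
      · subst e
        rw [wt_self]
        refine (prob_compl_eq_zero_iff (measurableSet_visits {h})).1 ?_
        refine measure_mono_null ?_ (ae_isRun σ h)
        intro ω hω hr
        exact hω ⟨0, hr.zero⟩
      · exact ih e
    have hprev : ∀ ω, IsRun σ h₀ ω → ∀ n, ω n = h.snoc a t →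
        ¬ M.IsTerminal h.last ∧ ∃ n, ω n = h ∧ ω (n + 1) = h.snoc a t := by
      intro ω hr n
      induction n with
      | zero => intro e; exact absurd (e.symm.trans hr.zero) hg
      | succ n ih =>
        intro e
        rcases hr.step n with ⟨_, e'⟩ | ⟨hn, b, u, e', _⟩
        · exact ih (e'.symm.trans e)
        · have e2 := e'.symm.trans e
          simp only [Hist.snoc.injEq] at e2
          exact ⟨e2.1 ▸ hn, n, e2.1, e⟩
    -- A terminal history is absorbing: it has no successor, and it may be occupied at many times,
    -- so it is excluded before visit times are shown to be unique.
    by_cases ht : M.IsTerminal h.last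
    · rw [pw, if_pos ht, mul_zero]
      refine measure_mono_null ?_ (ae_isRun σ h₀)
      rintro ω ⟨n, hn⟩ hr
      exact (hprev ω hr n hn).1 ht
    have hu : ∀ ω, IsRun σ h₀ ω → ∀ n m, ω n = h → ω m = h → n = m := by
      intro ω hr n m hn hm
      wlog hnm : n < m generalizing n m
      · rcases lt_or_eq_of_le (not_lt.1 hnm) with hlt | e
        · exact (this m n hm hn hlt).symm
        · exact e.symm
      obtain ⟨b, u, e, _⟩ := hr.snoc_of_ne (n := n) (hn ▸ ht)
      have := hr.isChain.pre (Nat.succ_le_of_lt hnm)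
      rw [Nat.succ_eq_add_one, e, hn, hm] at this
      exact absurd this (not_snoc_pre _ _ _)
    have hsum : ∀ B : ℕ → Set (ℕ → Hist S A), (∀ n, MeasurableSet (B n)) →
        (∀ n, B n ⊆ {ω | ω n = h}) → PrFrom σ h₀ (⋃ n, B n) = ∑' n, PrFrom σ h₀ (B n) := by
      intro B hB hBh
      refine measure_iUnion₀ (fun n m hnm => ?_) fun n => (hB n).nullMeasurableSet
      refine measure_mono_null ?_ (ae_isRun σ h₀)
      rintro ω ⟨h1, h2⟩ hr
      exact hnm (hu ω hr n m (hBh n h1) (hBh m h2))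
    have hmn : ∀ n, MeasurableSet {ω : ℕ → Hist S A | ω n = h} := fun n =>
      measurableSet_eval_mem n {h}
    have hmn' : ∀ n, MeasurableSet {ω : ℕ → Hist S A | ω n = h ∧ ω (n + 1) = h.snoc a t} :=
      fun n => (hmn n).inter (measurableSet_eval_mem (n + 1) {h.snoc a t})
    have e1 : PrFrom σ h₀ {ω | ∃ n, ω n = h.snoc a t} =
        PrFrom σ h₀ (⋃ n, {ω | ω n = h ∧ ω (n + 1) = h.snoc a t}) := by
      refine measure_congr ?_
      filter_upwards [ae_isRun σ h₀] with ω hr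
      refine propext ⟨?_, ?_⟩
      · rintro ⟨n, hn⟩
        exact Set.mem_iUnion.2 (hprev ω hr n hn).2
      · intro hx
        obtain ⟨n, hn⟩ := Set.mem_iUnion.1 hx
        exact ⟨n + 1, hn.2⟩
    have e2 : PrFrom σ h₀ {ω | ∃ n, ω n = h} = PrFrom σ h₀ (⋃ n, {ω | ω n = h}) := by
      congr 1; ext; simp
    rw [e1, ← ih', e2, hsum _ hmn' (fun n ω hω => hω.1), hsum _ hmn (fun n ω hω => hω),
      ← ENNReal.tsum_mul_right]
    refine tsum_congr fun n => ?_
    have h3 := lintegral_pair_PrFrom σ h₀ n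
      (fun x y => if x = h ∧ y = h.snoc a t then 1 else 0)
    have h4 : ∀ x, ∫⁻ y, (if x = h ∧ y = h.snoc a t then (1 : ENNReal) else 0) ∂stepMeasure σ x =
        if x = h then pw σ h a t else 0 := by
      intro x
      by_cases hx : x = h
      · subst hx
        rw [lintegral_stepMeasure σ ht]
        simp only [true_and, Hist.snoc.injEq, if_true, pw, if_neg ht, mul_ite, mul_one, mul_zero]
        rw [Finset.sum_eq_single a, Finset.sum_eq_single t]
        all_goals simp +contextual
      · simp [hx]
    simp only [h4] at h3
    have h5 : (∫⁻ ω, (if ω n = h ∧ ω (n + 1) = h.snoc a t then (1 : ENNReal) else 0)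
        ∂PrFrom σ h₀) = PrFrom σ h₀ {ω | ω n = h ∧ ω (n + 1) = h.snoc a t} := by
      rw [← lintegral_indicator_one (hmn' n)]
      simp [Set.indicator_apply]
    have h6 : (∫⁻ ω, (if ω n = h then pw σ h a t else 0) ∂PrFrom σ h₀) =
        pw σ h a t * PrFrom σ h₀ {ω | ω n = h} := by
      rw [← lintegral_indicator_const (hmn n)]
      simp [Set.indicator_apply]
    rw [← h5, h3, h6, mul_comm]

/-- The probability of visiting a set of finite paths that is visited at most once by runs. -/
theorem PrFrom_visits (σ : M.Policy) (h₀ : Hist S A) (G : Set (Hist S A))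
    (hG : ∀ ω, IsRun σ h₀ ω → ∀ n m, ω n ∈ G → ω m ∈ G → ω n = ω m) :
    PrFrom σ h₀ {ω | ∃ n, ω n ∈ G} = ∑' g : G, wt σ h₀ g := by
  have e : {ω : ℕ → Hist S A | ∃ n, ω n ∈ G} = ⋃ g : G, {ω | ∃ n, ω n = g.1} := by
    ext ω; simp only [Set.mem_ofPred_eq, Set.mem_iUnion]
    exact ⟨fun ⟨n, hn⟩ => ⟨⟨_, hn⟩, n, rfl⟩, fun ⟨g, n, hn⟩ => ⟨n, by rw [hn]; exact g.2⟩⟩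
  rw [e, measure_iUnion₀]
  · exact tsum_congr fun g => PrFrom_visits_singleton σ h₀ g
  · intro g g' hne
    refine measure_mono_null ?_ (ae_isRun σ h₀)
    rintro ω ⟨⟨n, h1⟩, ⟨m, h2⟩⟩ hr
    exact hne (Subtype.ext (h1.symm.trans ((hG ω hr n m (h1 ▸ g.2) (h2 ▸ g'.2)).trans h2)))
  · exact fun g => (measurableSet_visits {g.1}).nullMeasurableSet

/-- States of `E` are absorbing, so a run contains at most one history ending in `E`. -/
theorem PrFrom_ev (σ : M.Policy) (h₀ : Hist S A) {E : Set S} (hE : ∀ e ∈ E, M.IsTerminal e) :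
    PrFrom σ h₀ (ev E) = ∑' g : {g : Hist S A | g.last ∈ E}, wt σ h₀ g := by
  rw [ev_eq_visits]
  refine PrFrom_visits σ h₀ _ fun ω hr n m hn hm => ?_
  rcases le_total n m with h | h
  · exact (hr.eq_of_terminal (hE _ hn) h).symm
  · exact hr.eq_of_terminal (hE _ hm) h

end MDP

/-! ### One-step expectations and reachability within `n` steps -/

namespace MDP

variable {S A : Type*} [Fintype S] [Fintype A] {M : MDP S A}

open Hist

/-- The expectation of `f` after one step of the chain. -/
noncomputable def stepOp (σ : M.Policy) (f : Hist S A → ENNReal) (h : Hist S A) : ENNReal :=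
  ∫⁻ y, f y ∂stepMeasure σ h

theorem stepOp_of_terminal (σ : M.Policy) {h : Hist S A} (ht : M.IsTerminal h.last)
    (f : Hist S A → ENNReal) : stepOp σ f h = f h :=
  lintegral_stepMeasure_of_terminal σ ht f

theorem stepOp_of_not_terminal (σ : M.Policy) {h : Hist S A} (ht : ¬ M.IsTerminal h.last)
    (f : Hist S A → ENNReal) : stepOp σ f h =
      ∑ a, ∑ t, ENNReal.ofReal (σ.prob h a * M.P h.last a t) * f (h.snoc a t) :=
  lintegral_stepMeasure σ ht f

theorem stepOp_mono (σ : M.Policy) {f g : Hist S A → ENNReal} (hfg : ∀ h, f h ≤ g h)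
    (h : Hist S A) : stepOp σ f h ≤ stepOp σ g h := lintegral_mono hfg

theorem stepOp_const_add (σ : M.Policy) (c : ENNReal) (f : Hist S A → ENNReal) (h : Hist S A) :
    stepOp σ (fun x => c + f x) h = c + stepOp σ f h := by
  simp [stepOp, lintegral_add_left]

theorem stepOp_const_mul (σ : M.Policy) (c : ENNReal) (f : Hist S A → ENNReal) (h : Hist S A) :
    stepOp σ (fun x => c * f x) h = c * stepOp σ f h :=
  lintegral_const_mul _ Measurable.of_discrete

theorem lintegral_eval_PrFrom (σ : M.Policy) (h : Hist S A) (n : ℕ) (f : Hist S A → ENNReal) :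
    ∫⁻ ω, f (ω n) ∂PrFrom σ h = (stepOp σ)^[n] f h := by
  induction n generalizing f with
  | zero =>
    rw [lintegral_congr_ae (g := fun _ => f h)
      ((PrFrom_zero σ h).mono fun ω e => by simp only [e])]
    simp
  | succ n ih =>
    rw [lintegral_pair_PrFrom σ h n (fun _ y => f y), Function.iterate_succ_apply, ← ih]
    rfl

/-- The Markov property peels off the last step. As `n`-step expectations are iterates of `stepOp`,
the first step can be peeled off instead, which allows inductions that vary the starting history. -/
theorem lintegral_eval_succ (σ : M.Policy) (h : Hist S A) (n : ℕ) (f : Hist S A → ENNReal) :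
    ∫⁻ ω, f (ω (n + 1)) ∂PrFrom σ h = stepOp σ (fun g => ∫⁻ ω, f (ω n) ∂PrFrom σ g) h := by
  simp only [lintegral_eval_PrFrom, Function.iterate_succ_apply']

/-- The probability of being in `E` after `n` steps. -/
noncomputable def reachAt (σ : M.Policy) (E : Set S) (n : ℕ) (h : Hist S A) : ENNReal :=
  PrFrom σ h {ω | (ω n).last ∈ E}

open scoped Classical in
theorem reachAt_eq_lintegral (σ : M.Policy) (E : Set S) (n : ℕ) (h : Hist S A) :
    reachAt σ E n h = ∫⁻ ω, (fun g : Hist S A => if g.last ∈ E then 1 else 0) (ω n)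
      ∂PrFrom σ h := by
  have hm : MeasurableSet {ω : ℕ → Hist S A | (ω n).last ∈ E} :=
    measurableSet_eval_mem n {g | g.last ∈ E}
  rw [reachAt, ← lintegral_indicator_one hm]
  simp [Set.indicator_apply]

open scoped Classical in
theorem reachAt_zero (σ : M.Policy) (E : Set S) (h : Hist S A) :
    reachAt σ E 0 h = if h.last ∈ E then 1 else 0 := by
  refine (reachAt_eq_lintegral σ E 0 h).trans ((lintegral_eval_PrFrom σ h 0
    (fun g => if g.last ∈ E then 1 else 0)).trans ?_)
  simp only [Function.iterate_zero, id_eq]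

theorem reachAt_succ (σ : M.Policy) (E : Set S) (n : ℕ) (h : Hist S A) :
    reachAt σ E (n + 1) h = stepOp σ (reachAt σ E n) h := by
  classical
  refine (reachAt_eq_lintegral σ E (n + 1) h).trans ((lintegral_eval_succ σ h n
    (fun g => if g.last ∈ E then 1 else 0)).trans ?_)
  congr 1
  funext g
  exact (reachAt_eq_lintegral σ E n g).symm

theorem reachAt_mono (σ : M.Policy) {E : Set S} (hE : ∀ e ∈ E, M.IsTerminal e) (h : Hist S A) :
    Monotone fun n => reachAt σ E n h := by
  refine monotone_nat_of_le_succ fun n => ?_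
  refine measure_mono_ae ?_
  filter_upwards [ae_isRun σ h] with ω hr hn
  change (ω (n + 1)).last ∈ E
  rw [hr.eq_of_terminal (hE _ hn) (Nat.le_succ n)]
  exact hn

/-- By absorption, having been in `E` by time `n` is almost surely being there at time `n`; then
continuity from below. -/
theorem PrFrom_ev_eq_iSup (σ : M.Policy) {E : Set S} (hE : ∀ e ∈ E, M.IsTerminal e)
    (h : Hist S A) : PrFrom σ h (ev E) = ⨆ n, reachAt σ E n h := by
  have e : (ev E : Set (ℕ → Hist S A)) = ⋃ n, ⋃ m ≤ n, {ω | (ω m).last ∈ E} := by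
    ext ω
    simp only [ev_eq_visits, Set.mem_ofPred_eq, Set.mem_iUnion, exists_prop]
    exact ⟨fun ⟨n, hn⟩ => ⟨n, n, le_rfl, hn⟩, fun ⟨_, n, _, hn⟩ => ⟨n, hn⟩⟩
  have hmono : Monotone fun n => ⋃ m ≤ n, {ω : ℕ → Hist S A | (ω m).last ∈ E} := by
    intro n k hnk
    exact Set.biUnion_subset_biUnion_left fun m (hm : m ≤ n) => hm.trans hnk
  rw [e, hmono.measure_iUnion]
  congr 1
  funext n
  refine measure_congr ?_
  filter_upwards [ae_isRun σ h] with ω hr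
  refine propext ⟨fun hx => ?_, fun hx => ?_⟩
  · obtain ⟨m, hm, hx⟩ := Set.mem_iUnion₂.1 hx
    change (ω n).last ∈ E
    rw [hr.eq_of_terminal (hE _ hx) hm]
    exact hx
  · exact Set.mem_iUnion₂.2 ⟨n, le_rfl, hx⟩

theorem PrFrom_ev_eq_stepOp (σ : M.Policy) {E : Set S} (hE : ∀ e ∈ E, M.IsTerminal e)
    (h : Hist S A) : PrFrom σ h (ev E) = stepOp σ (fun g => PrFrom σ g (ev E)) h := by
  simp only [PrFrom_ev_eq_iSup σ hE, stepOp]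
  rw [lintegral_iSup (fun n => Measurable.of_discrete)
    (fun n m hnm g => reachAt_mono σ hE g hnm)]
  rw [← (reachAt_mono σ hE h).iSup_nat_add 1]
  exact iSup_congr fun n => reachAt_succ σ E n h

/-! ### Optimal policies for reachability -/

/-- `V` is a supersolution of the discounted reachability equation; induction on `n` by the first
step. -/
theorem pow_mul_reachAt_le (σ : M.Policy) {E : Set S} {γ : ENNReal} (hγ : γ ≤ 1)
    {V : S → ENNReal} (hV : ∀ e ∈ E, 1 ≤ V e)
    (hs : ∀ h : Hist S A, ¬ M.IsTerminal h.last → γ * stepOp σ (fun g => V g.last) h ≤ V h.last)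
    (n : ℕ) (h : Hist S A) : γ ^ n * reachAt σ E n h ≤ V h.last := by
  classical
  induction n generalizing h with
  | zero =>
    rw [reachAt_zero]
    split_ifs with hh
    · simpa using hV _ hh
    · simp
  | succ n ih =>
    rw [reachAt_succ]
    by_cases ht : M.IsTerminal h.last
    · rw [stepOp_of_terminal σ ht]
      refine le_trans ?_ (ih h)
      gcongr ?_ * _
      exact pow_le_pow_right_of_le_one' hγ (Nat.le_succ n)
    · refine le_trans ?_ (hs h ht)
      rw [pow_succ', mul_assoc, ← stepOp_const_mul]
      gcongr
      exact stepOp_mono σ ih h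

/-- The counterpart for subsolutions. The error `γ ^ n` bounds the discounted value still to be
collected after `n` steps. It vanishes in the limit only for `γ < 1`, which is the reason for
discounting: without it, a greedy policy may loop among states of equal value and never reach `E`.
-/
theorem le_pow_add_reachAt (σ : M.Policy) {E : Set S} {γ : ENNReal} (hγ : γ ≤ 1)
    {V : S → ENNReal} (hE : ∀ e ∈ E, M.IsTerminal e) (hV1 : ∀ s, V s ≤ 1)
    (hV0 : ∀ s, M.IsTerminal s → s ∉ E → V s = 0)
    (hs : ∀ h : Hist S A, ¬ M.IsTerminal h.last → V h.last ≤ γ * stepOp σ (fun g => V g.last) h)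
    (n : ℕ) (h : Hist S A) : V h.last ≤ γ ^ n + reachAt σ E n h := by
  classical
  induction n generalizing h with
  | zero => simpa using le_add_right (hV1 h.last)
  | succ n ih =>
    by_cases ht : M.IsTerminal h.last
    · by_cases hh : h.last ∈ E
      · refine (hV1 _).trans (le_add_left ?_)
        calc (1 : ENNReal) = reachAt σ E 0 h := by rw [reachAt_zero, if_pos hh]
          _ ≤ _ := reachAt_mono σ hE h (Nat.zero_le _)
      · rw [hV0 _ ht hh]; exact zero_le
    · refine (hs h ht).trans ?_
      rw [reachAt_succ, pow_succ']
      calc γ * stepOp σ (fun g => V g.last) h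
          ≤ γ * stepOp σ (fun g => γ ^ n + reachAt σ E n g) h := by
            gcongr; exact stepOp_mono σ ih h
        _ = γ * γ ^ n + γ * stepOp σ (reachAt σ E n) h := by rw [stepOp_const_add, mul_add]
        _ ≤ _ := by gcongr; exact mul_le_of_le_one_left' hγ

/-- The choices of an enabled action in every nonterminal state. -/
abbrev Selector (M : MDP S A) : Type _ :=
  (s : {s // ¬ M.IsTerminal s}) → {a // M.Enabled s a}

instance (M : MDP S A) : Nonempty M.Selector :=
  ⟨fun s => ⟨_, (not_forall_not.1 s.2).choose_spec⟩⟩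

open scoped Classical in
/-- The memoryless deterministic policy given by a selector. -/
noncomputable def Selector.policy (d : M.Selector) : M.Policy where
  prob h a := if ht : ¬ M.IsTerminal h.last then if (d ⟨_, ht⟩).1 = a then 1 else 0 else 0
  nonneg h ht a := by rw [dif_pos ht]; split_ifs <;> norm_num
  sum_eq_one h ht := by simp [ht]
  enabled h ht a ha := by
    rw [dif_pos ht, if_neg]
    rintro rfl
    exact ha (d ⟨h.last, ht⟩).2

instance (M : MDP S A) : Nonempty M.Policy := ⟨(Classical.arbitrary M.Selector).policy⟩

/-- The expectation of `V` after action `a`. -/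
noncomputable def actVal (M : MDP S A) (V : S → ENNReal) (s : S) (a : A) : ENNReal :=
  ∑ t, ENNReal.ofReal (M.P s a t) * V t

theorem actVal_mono {V W : S → ENNReal} (h : V ≤ W) (s : S) (a : A) :
    M.actVal V s a ≤ M.actVal W s a := by
  unfold actVal
  gcongr
  exact h _

theorem actVal_one {s : S} {a : A} (h : M.Enabled s a) : M.actVal 1 s a = 1 := by
  simp only [actVal, Pi.one_apply, mul_one]
  rw [← ENNReal.ofReal_sum_of_nonneg fun t _ => M.P_nonneg s a t, h, ENNReal.ofReal_one]

theorem stepOp_last (σ : M.Policy) {h : Hist S A} (ht : ¬ M.IsTerminal h.last)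
    (V : S → ENNReal) : stepOp σ (fun g => V g.last) h =
      ∑ a, ENNReal.ofReal (σ.prob h a) * M.actVal V h.last a := by
  rw [stepOp_of_not_terminal σ ht]
  refine Finset.sum_congr rfl fun a _ => ?_
  rw [actVal, Finset.mul_sum]
  refine Finset.sum_congr rfl fun t _ => ?_
  rw [ENNReal.ofReal_mul (σ.nonneg h ht a), mul_assoc, last_snoc]

theorem sum_ofReal_prob (σ : M.Policy) {h : Hist S A} (ht : ¬ M.IsTerminal h.last) :
    ∑ a, ENNReal.ofReal (σ.prob h a) = 1 := by
  rw [← ENNReal.ofReal_sum_of_nonneg fun a _ => σ.nonneg h ht a, σ.sum_eq_one h ht,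
    ENNReal.ofReal_one]

theorem stepOp_last_le (σ : M.Policy) {h : Hist S A} (ht : ¬ M.IsTerminal h.last)
    {V : S → ENNReal} {c : ENNReal} (hc : ∀ a, M.Enabled h.last a → M.actVal V h.last a ≤ c) :
    stepOp σ (fun g => V g.last) h ≤ c := by
  rw [stepOp_last σ ht]
  calc _ ≤ ∑ a, ENNReal.ofReal (σ.prob h a) * c := by
        refine Finset.sum_le_sum fun a _ => ?_
        by_cases ha : M.Enabled h.last a
        · gcongr; exact hc a ha
        · simp [σ.enabled h ht a ha]
    _ = c := by rw [← Finset.sum_mul, sum_ofReal_prob σ ht, one_mul]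

theorem le_stepOp_last (σ : M.Policy) {h : Hist S A} (ht : ¬ M.IsTerminal h.last)
    {V : S → ENNReal} {c : ENNReal} (hc : ∀ a, M.Enabled h.last a → c ≤ M.actVal V h.last a) :
    c ≤ stepOp σ (fun g => V g.last) h := by
  rw [stepOp_last σ ht]
  calc c = ∑ a, ENNReal.ofReal (σ.prob h a) * c := by
        rw [← Finset.sum_mul, sum_ofReal_prob σ ht, one_mul]
    _ ≤ _ := by
        refine Finset.sum_le_sum fun a _ => ?_
        by_cases ha : M.Enabled h.last a
        · gcongr; exact hc a ha
        · simp [σ.enabled h ht a ha]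

theorem stepOp_last_policy (d : M.Selector) {h : Hist S A} (ht : ¬ M.IsTerminal h.last)
    (V : S → ENNReal) : stepOp (Selector.policy d) (fun g => V g.last) h =
      M.actVal V h.last (d ⟨h.last, ht⟩) := by
  classical
  rw [stepOp_last _ ht]
  simp only [Selector.policy, dif_pos ht]
  rw [Finset.sum_eq_single (d ⟨h.last, ht⟩).1]
  · simp
  · intro a _ hne
    rw [if_neg hne.symm]
    simp
  · simp

open scoped Classical in
/-- The discounted Bellman operator, where `opt` is the supremum or the infimum over the enabled
actions. -/
noncomputable def bellman (M : MDP S A) (E : Set S) (γ : ENNReal)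
    (opt : (s : S) → ({a // M.Enabled s a} → ENNReal) → ENNReal) (hm : ∀ s, Monotone (opt s)) :
    (S → ENNReal) →o (S → ENNReal) where
  toFun V s := if s ∈ E then 1 else if M.IsTerminal s then 0 else
    γ * opt s fun a => M.actVal V s a
  monotone' V W h s := by
    simp only
    split_ifs
    · exact le_rfl
    · exact le_rfl
    · gcongr
      exact hm s fun a => actVal_mono h s a.1

/-- Take the least fixed point (Knaster–Tarski). The bound by 1 holds because the constant 1 is a
pre-fixed point: by `hopt` the optimum is attained at an enabled action, whose probabilities sum to
1. -/
theorem exists_bellman (M : MDP S A) {E : Set S} (hE : ∀ e ∈ E, M.IsTerminal e) {γ : ENNReal}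
    (hγ : γ ≤ 1) (opt : (s : S) → ({a // M.Enabled s a} → ENNReal) → ENNReal)
    (hm : ∀ s, Monotone (opt s))
    (hopt : ∀ s, ¬ M.IsTerminal s → ∀ f, ∃ a, opt s f = f a) :
    ∃ V : S → ENNReal, (∀ s, V s ≤ 1) ∧ (∀ e ∈ E, 1 ≤ V e) ∧
      (∀ s, M.IsTerminal s → s ∉ E → V s = 0) ∧
      ∀ s, ¬ M.IsTerminal s → V s = γ * opt s fun a => M.actVal V s a := by
  classical
  let T := M.bellman E γ opt hm
  have hfix : T T.lfp = T.lfp := T.map_lfp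
  have hle : T.lfp ≤ 1 := by
    refine T.lfp_le fun s => ?_
    change (if s ∈ E then 1 else if M.IsTerminal s then 0 else
      γ * opt s fun a => M.actVal 1 s a) ≤ (1 : ENNReal)
    split_ifs with h1 h2
    · exact le_rfl
    · exact zero_le
    · obtain ⟨a, ha⟩ := hopt s h2 fun a => M.actVal 1 s a
      rw [ha, actVal_one a.2, mul_one]
      exact hγ
  have hval : ∀ s, T.lfp s = if s ∈ E then 1 else if M.IsTerminal s then 0 else
      γ * opt s fun a => M.actVal T.lfp s a := fun s => (congrFun hfix s).symm
  refine ⟨T.lfp, hle, fun e he => ?_, fun s hs hsE => ?_, fun s hs => ?_⟩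
  · rw [hval, if_pos he]
  · rw [hval, if_neg hsE, if_pos hs]
  · rw [hval, if_neg fun h => hs (hE s h), if_neg hs]

/-- Let `d` be greedy for the discounted value `V`. Then `V` bounds the discounted reachability of
every policy from above, while for `d` it is also a subsolution, hence at most the undiscounted
probability of reaching `E` under `d`. Only last states enter `V`, which is why `h` and `h'` may
differ otherwise. -/
theorem exists_discount_max (M : MDP S A) {E : Set S} (hE : ∀ e ∈ E, M.IsTerminal e)
    {γ : ENNReal} (hγ : γ < 1) : ∃ d : M.Selector, ∀ (σ : M.Policy) (h h' : Hist S A) (n : ℕ),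
      h.last = h'.last → γ ^ n * reachAt σ E n h ≤ PrFrom (Selector.policy d) h' (ev E) := by
  obtain ⟨V, hV1, hVE, hV0, hV⟩ := M.exists_bellman hE hγ.le
    (fun s f => ⨆ a, f a) (fun s f g h => iSup_mono h) (fun s hs f => by
      have : Nonempty {a // M.Enabled s a} := (not_forall_not.1 hs).elim fun a ha => ⟨⟨a, ha⟩⟩
      obtain ⟨a, ha⟩ := exists_eq_ciSup_of_finite (f := f)
      exact ⟨a, ha.symm⟩)
  have hmax : ∀ s : {s // ¬ M.IsTerminal s}, ∃ a : {a // M.Enabled s a},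
      M.actVal V s a = ⨆ a : {a // M.Enabled s a}, M.actVal V s a := fun s => by
    have : Nonempty {a // M.Enabled s a} := (not_forall_not.1 s.2).elim fun a ha => ⟨⟨a, ha⟩⟩
    exact exists_eq_ciSup_of_finite
  choose d hd using hmax
  refine ⟨d, fun σ h h' n hh => ?_⟩
  have h1 : γ ^ n * reachAt σ E n h ≤ V h.last := by
    refine pow_mul_reachAt_le σ hγ.le hVE (fun h ht => ?_) n h
    rw [hV _ ht]
    gcongr
    exact stepOp_last_le σ ht fun a ha => le_iSup_of_le (⟨a, ha⟩ : {a // M.Enabled h.last a}) le_rfl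
  have h2 : ∀ n, V h'.last ≤ γ ^ n + PrFrom (Selector.policy d) h' (ev E) := fun n => by
    refine (le_pow_add_reachAt (Selector.policy d) hγ.le hE hV1 hV0 (fun h ht => ?_) n h').trans ?_
    · rw [hV _ ht, stepOp_last_policy d ht, hd ⟨h.last, ht⟩]
    · gcongr
      rw [PrFrom_ev_eq_iSup _ hE]
      exact le_iSup (fun n => reachAt (Selector.policy d) E n h') n
  refine h1.trans (hh ▸ ?_)
  refine ge_of_tendsto' (x := Filter.atTop) ?_ h2
  simpa using (ENNReal.tendsto_pow_atTop_nhds_zero_of_lt_one hγ).add_const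
    (PrFrom (Selector.policy d) h' (ev E))

/-- Dual to the maximum: `V` is now a subsolution for every policy and a supersolution for the
greedy one. -/
theorem exists_discount_min (M : MDP S A) {E : Set S} (hE : ∀ e ∈ E, M.IsTerminal e)
    {γ : ENNReal} (hγ : γ < 1) : ∃ d : M.Selector, ∀ (σ : M.Policy) (h h' : Hist S A) (n : ℕ),
      h.last = h'.last → γ ^ n * reachAt (Selector.policy d) E n h' ≤ PrFrom σ h (ev E) := by
  obtain ⟨V, hV1, hVE, hV0, hV⟩ := M.exists_bellman hE hγ.le
    (fun s f => ⨅ a, f a) (fun s f g h => iInf_mono h) (fun s hs f => by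
      have : Nonempty {a // M.Enabled s a} := (not_forall_not.1 hs).elim fun a ha => ⟨⟨a, ha⟩⟩
      obtain ⟨a, ha⟩ := exists_eq_ciInf_of_finite (f := f)
      exact ⟨a, ha.symm⟩)
  have hmin : ∀ s : {s // ¬ M.IsTerminal s}, ∃ a : {a // M.Enabled s a},
      M.actVal V s a = ⨅ a : {a // M.Enabled s a}, M.actVal V s a := fun s => by
    have : Nonempty {a // M.Enabled s a} := (not_forall_not.1 s.2).elim fun a ha => ⟨⟨a, ha⟩⟩
    exact exists_eq_ciInf_of_finite
  choose d hd using hmin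
  refine ⟨d, fun σ h h' n hh => ?_⟩
  have h1 : γ ^ n * reachAt (Selector.policy d) E n h' ≤ V h'.last := by
    refine pow_mul_reachAt_le (Selector.policy d) hγ.le hVE (fun h ht => ?_) n h'
    rw [hV _ ht, stepOp_last_policy d ht, hd ⟨h.last, ht⟩]
  have h2 : ∀ n, V h.last ≤ γ ^ n + PrFrom σ h (ev E) := fun n => by
    refine (le_pow_add_reachAt σ hγ.le hE hV1 hV0 (fun h ht => ?_) n h).trans ?_
    · rw [hV _ ht]
      refine mul_le_mul_right ?_ γ
      exact le_stepOp_last σ ht fun a ha =>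
        iInf_le_of_le (⟨a, ha⟩ : {a // M.Enabled h.last a}) le_rfl
    · gcongr
      rw [PrFrom_ev_eq_iSup _ hE]
      exact le_iSup (fun n => reachAt σ E n h) n
  refine h1.trans (hh ▸ ?_)
  refine ge_of_tendsto' (x := Filter.atTop) ?_ h2
  simpa using (ENNReal.tendsto_pow_atTop_nhds_zero_of_lt_one hγ).add_const
    (PrFrom σ h (ev E))

/-- Passage from discounted to undiscounted optimality: there are only finitely many selectors, so
one of them serves infinitely many discount factors along a sequence tending to 1. For fixed `n` the
inequality survives the limit. -/
theorem exists_frequently_of_discount {ι : Type*} [Finite ι] {p : ENNReal → ι → Prop}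
    (hp : ∀ γ < 1, ∃ d, p γ d) : ∃ d, ∀ (n : ℕ) (x c : ENNReal),
      (∀ γ, p γ d → γ ^ n * x ≤ c) → x ≤ c := by
  -- Any sequence below 1 with limit 1 would do.
  let γ : ℕ → ENNReal := fun k => 1 - (k + 1 : ENNReal)⁻¹
  have hγ : ∀ k, γ k < 1 := fun k => ENNReal.sub_lt_self ENNReal.one_ne_top one_ne_zero
    (ENNReal.inv_ne_zero.2 (by finiteness))
  choose d hd using fun k => hp (γ k) (hγ k)
  obtain ⟨d₀, h₀⟩ := Finite.exists_infinite_fiber d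
  refine ⟨d₀, fun n x c hx => ?_⟩
  have hfr : ∃ᶠ k in Filter.atTop, d k = d₀ := by
    rw [Nat.frequently_atTop_iff_infinite]
    exact Set.infinite_coe_iff.1 h₀
  have hlim : Filter.Tendsto γ Filter.atTop (nhds 1) := by
    have h1 : Filter.Tendsto (fun k : ℕ => ((k : ENNReal) + 1)⁻¹) Filter.atTop (nhds 0) := by
      have := (ENNReal.tendsto_inv_nat_nhds_zero).comp (Filter.tendsto_add_atTop_nat 1)
      simpa [Function.comp_def] using this
    simpa [γ] using ENNReal.Tendsto.sub (tendsto_const_nhds (x := (1 : ENNReal))) h1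
      (Or.inl ENNReal.one_ne_top)
  have hlim' : Filter.Tendsto (fun k => γ k ^ n * x) Filter.atTop (nhds x) := by
    have h2 : Filter.Tendsto (fun k => γ k ^ n) Filter.atTop (nhds 1) := by
      simpa using ENNReal.Tendsto.pow (n := n) hlim
    simpa using ENNReal.Tendsto.mul_const h2 (Or.inl one_ne_zero)
  refine le_of_tendsto_of_frequently hlim' (hfr.mono fun k hk => ?_)
  exact hx _ (hk ▸ hd k)

/-- Memoryless deterministic policies maximize the probability of reaching a set of terminal
states. -/
theorem exists_max_policy (M : MDP S A) {E : Set S} (hE : ∀ e ∈ E, M.IsTerminal e) :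
    ∃ π : M.Policy, ∀ (σ : M.Policy) (h h' : Hist S A), h.last = h'.last →
      PrFrom σ h (ev E) ≤ PrFrom π h' (ev E) := by
  obtain ⟨d, hd⟩ := exists_frequently_of_discount fun γ hγ => M.exists_discount_max hE hγ
  refine ⟨(Selector.policy d), fun σ h h' hh => ?_⟩
  rw [PrFrom_ev_eq_iSup σ hE]
  exact iSup_le fun n => hd n _ _ fun γ hγ => hγ σ h h' n hh

/-- Memoryless deterministic policies minimize the probability of reaching a set of terminal
states. -/
theorem exists_min_policy (M : MDP S A) {E : Set S} (hE : ∀ e ∈ E, M.IsTerminal e) :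
    ∃ π : M.Policy, ∀ (σ : M.Policy) (h h' : Hist S A), h.last = h'.last →
      PrFrom π h' (ev E) ≤ PrFrom σ h (ev E) := by
  obtain ⟨d, hd⟩ := exists_frequently_of_discount fun γ hγ => M.exists_discount_min hE hγ
  refine ⟨(Selector.policy d), fun σ h h' hh => ?_⟩
  rw [PrFrom_ev_eq_iSup (Selector.policy d) hE]
  exact iSup_le fun n => hd n _ _ fun γ hγ => hγ σ h h' n hh

/-- `prMax` refers to runs started in a single state, whereas corresponding policies involve
residual policies after a history. The value of the optimal policy depends on the last state only
and so bridges the two. -/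
theorem exists_policy_prMax (M : MDP S A) {E : Set S} (hE : ∀ e ∈ E, M.IsTerminal e) :
    ∃ π : M.Policy, ∀ h : Hist S A, (PrFrom π h).real (ev E) = M.prMax E h.last ∧
      ∀ σ : M.Policy, (PrFrom σ h).real (ev E) ≤ M.prMax E h.last := by
  obtain ⟨π, hπ⟩ := M.exists_max_policy hE
  have hr : ∀ (σ : M.Policy) (h h' : Hist S A), h.last = h'.last →
      (PrFrom σ h).real (ev E) ≤ (PrFrom π h').real (ev E) := fun σ h h' hh =>
    ENNReal.toReal_mono (measure_ne_top _ _) (hπ σ h h' hh)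
  have he : ∀ h : Hist S A, (PrFrom π h).real (ev E) = M.prMax E h.last := fun h =>
    le_antisymm ((hr π h (.start h.last) rfl).trans
      (le_ciSup (f := fun σ : M.Policy => (PrFrom σ (.start h.last)).real (ev E))
        ⟨1, by rintro _ ⟨σ, rfl⟩; exact measureReal_le_one⟩ π))
      (ciSup_le fun σ => hr σ _ h rfl)
  exact ⟨π, fun h => ⟨he h, fun σ => (hr σ h h rfl).trans (he h).le⟩⟩

theorem exists_policy_prMin (M : MDP S A) {E : Set S} (hE : ∀ e ∈ E, M.IsTerminal e) :
    ∃ π : M.Policy, ∀ h : Hist S A, (PrFrom π h).real (ev E) = M.prMin E h.last ∧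
      ∀ σ : M.Policy, M.prMin E h.last ≤ (PrFrom σ h).real (ev E) := by
  obtain ⟨π, hπ⟩ := M.exists_min_policy hE
  have hr : ∀ (σ : M.Policy) (h h' : Hist S A), h.last = h'.last →
      (PrFrom π h').real (ev E) ≤ (PrFrom σ h).real (ev E) := fun σ h h' hh =>
    ENNReal.toReal_mono (measure_ne_top _ _) (hπ σ h h' hh)
  have he : ∀ h : Hist S A, (PrFrom π h).real (ev E) = M.prMin E h.last := fun h =>
    le_antisymm (le_ciInf fun σ => hr σ _ h rfl)
      ((ciInf_le (f := fun σ : M.Policy => (PrFrom σ (.start h.last)).real (ev E))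
        ⟨0, by rintro _ ⟨σ, rfl⟩; exact measureReal_nonneg⟩ π).trans (hr π h (.start h.last) rfl))
  exact ⟨π, fun h => ⟨he h, fun σ => (he h).symm.le.trans (hr σ h h rfl)⟩⟩

/-! ### Mixtures of policies -/

theorem wt_le_one (σ : M.Policy) (h g : Hist S A) : wt σ h g ≤ 1 := by
  rw [← PrFrom_visits_singleton]; exact prob_le_one

theorem wt_ne_top (σ : M.Policy) (h g : Hist S A) : wt σ h g ≠ ⊤ :=
  ne_top_of_le_ne_top ENNReal.one_ne_top (wt_le_one σ h g)

theorem pw_of_not_terminal (σ : M.Policy) {h : Hist S A} (ht : ¬ M.IsTerminal h.last) (a : A)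
    (t : S) : pw σ h a t = ENNReal.ofReal (σ.prob h a * M.P h.last a t) := if_neg ht

theorem pw_of_terminal (σ : M.Policy) {h : Hist S A} (ht : M.IsTerminal h.last) (a : A)
    (t : S) : pw σ h a t = 0 := if_pos ht

/-- Every mixture of two policies has the law of a policy. -/
theorem exists_policy_mix (π₁ π₂ : M.Policy) (h₀ : Hist S A) {l m : ℝ} (hl : 0 ≤ l) (hm : 0 ≤ m)
    (hlm : l + m = 1) : ∃ σ : M.Policy, ∀ h, wt σ h₀ h =
      ENNReal.ofReal l * wt π₁ h₀ h + ENNReal.ofReal m * wt π₂ h₀ h := by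
  classical
  -- `u h` and `v h` are the probabilities of drawing `π₁` resp. `π₂` at the outset and then
  -- visiting `h`. Choosing with the posterior weights `u h / (u h + v h)` and `v h / (u h + v h)`
  -- reproduces the law of the initial draw.
  let u : Hist S A → ℝ := fun h => l * (wt π₁ h₀ h).toReal
  let v : Hist S A → ℝ := fun h => m * (wt π₂ h₀ h).toReal
  have hu : ∀ h, 0 ≤ u h := fun h => mul_nonneg hl ENNReal.toReal_nonneg
  have hv : ∀ h, 0 ≤ v h := fun h => mul_nonneg hm ENNReal.toReal_nonneg
  have hD : ∀ h, 0 ≤ u h + v h := fun h => add_nonneg (hu h) (hv h)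
  let σ : M.Policy :=
    -- If `u h + v h = 0` the mixture never visits `h`, and any choice is fine.
    { prob := fun h a => if u h + v h = 0 then π₁.prob h a else
        (u h * π₁.prob h a + v h * π₂.prob h a) / (u h + v h)
      nonneg := fun h ht a => by
        split_ifs
        · exact π₁.nonneg h ht a
        · exact div_nonneg (add_nonneg (mul_nonneg (hu h) (π₁.nonneg h ht a))
            (mul_nonneg (hv h) (π₂.nonneg h ht a))) (hD h)
      sum_eq_one := fun h ht => by
        split_ifs with h0
        · exact π₁.sum_eq_one h ht
        · rw [← Finset.sum_div, Finset.sum_add_distrib, ← Finset.mul_sum, ← Finset.mul_sum,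
            π₁.sum_eq_one h ht, π₂.sum_eq_one h ht, mul_one, mul_one, div_self h0]
      enabled := fun h ht a ha => by
        simp [π₁.enabled h ht a ha, π₂.enabled h ht a ha] }
  refine ⟨σ, fun h => ?_⟩
  have hw : ∀ h, ENNReal.ofReal l * wt π₁ h₀ h + ENNReal.ofReal m * wt π₂ h₀ h =
      ENNReal.ofReal (u h + v h) := fun h => by
    rw [ENNReal.ofReal_add (hu h) (hv h), ENNReal.ofReal_mul hl, ENNReal.ofReal_mul hm,
      ENNReal.ofReal_toReal (wt_ne_top _ _ _), ENNReal.ofReal_toReal (wt_ne_top _ _ _)]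
  by_cases h0 : h = h₀
  · rw [h0, wt_self, wt_self, wt_self, mul_one, mul_one, ← ENNReal.ofReal_add hl hm, hlm,
      ENNReal.ofReal_one]
  induction h with
  | start s => simp [wt, h0]
  | snoc h a t ih =>
    rw [wt_snoc_of_ne h0, wt_snoc_of_ne h0, wt_snoc_of_ne h0]
    have ih' : wt σ h₀ h = ENNReal.ofReal (u h + v h) := by
      by_cases e : h = h₀
      · rw [← hw, e, wt_self, wt_self, wt_self, mul_one, mul_one, ← ENNReal.ofReal_add hl hm, hlm,
          ENNReal.ofReal_one]
      · rw [ih e, hw]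
    by_cases ht : M.IsTerminal h.last
    · simp [pw_of_terminal _ ht]
    rw [ih']
    simp only [pw_of_not_terminal _ ht]
    have hP := M.P_nonneg h.last a t
    have h1 := π₁.nonneg h ht a
    have h2 := π₂.nonneg h ht a
    have e1 : ENNReal.ofReal l * (wt π₁ h₀ h * ENNReal.ofReal (π₁.prob h a * M.P h.last a t)) =
        ENNReal.ofReal (u h * (π₁.prob h a * M.P h.last a t)) := by
      rw [ENNReal.ofReal_mul (hu h), ENNReal.ofReal_mul hl, ENNReal.ofReal_toReal (wt_ne_top _ _ _),
        mul_assoc]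
    have e2 : ENNReal.ofReal m * (wt π₂ h₀ h * ENNReal.ofReal (π₂.prob h a * M.P h.last a t)) =
        ENNReal.ofReal (v h * (π₂.prob h a * M.P h.last a t)) := by
      rw [ENNReal.ofReal_mul (hv h), ENNReal.ofReal_mul hm, ENNReal.ofReal_toReal (wt_ne_top _ _ _),
        mul_assoc]
    rw [e1, e2, ← ENNReal.ofReal_mul (hD h), ← ENNReal.ofReal_add
      (mul_nonneg (hu h) (mul_nonneg h1 hP)) (mul_nonneg (hv h) (mul_nonneg h2 hP))]
    congr 1
    by_cases hz : u h + v h = 0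
    · have h3 := hu h
      have h4 := hv h
      have hu0 : u h = 0 := by linarith
      have hv0 : v h = 0 := by linarith
      simp [hu0, hv0]
    · simp only [σ, if_neg hz]
      field_simp

theorem exists_policy_mix_ev (π₁ π₂ : M.Policy) (h₀ : Hist S A) {E : Set S}
    (hE : ∀ e ∈ E, M.IsTerminal e) {l m : ℝ} (hl : 0 ≤ l) (hm : 0 ≤ m) (hlm : l + m = 1) :
    ∃ σ : M.Policy, (PrFrom σ h₀).real (ev E) =
      l * (PrFrom π₁ h₀).real (ev E) + m * (PrFrom π₂ h₀).real (ev E) := by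
  obtain ⟨σ, hσ⟩ := exists_policy_mix π₁ π₂ h₀ hl hm hlm
  refine ⟨σ, ?_⟩
  have : PrFrom σ h₀ (ev E) = ENNReal.ofReal l * PrFrom π₁ h₀ (ev E) +
      ENNReal.ofReal m * PrFrom π₂ h₀ (ev E) := by
    simp only [PrFrom_ev _ _ hE, hσ, ENNReal.tsum_add, ENNReal.tsum_mul_left]
  rw [measureReal_def, this, ENNReal.toReal_add (by finiteness) (by finiteness),
    ENNReal.toReal_mul, ENNReal.toReal_mul, ENNReal.toReal_ofReal hl, ENNReal.toReal_ofReal hm]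
  rfl

end MDP

/-! ### Counting transitions along a chain -/

namespace Hist

variable {S A : Type*}

open scoped Classical in
/-- The number of transitions of a finite sequence that satisfy `q`. -/
noncomputable def count (q : S → A → S → Prop) : Hist S A → ℕ
  | start _ => 0
  | snoc h a t => count q h + if q h.last a t then 1 else 0

/-- The `n`-th step of `ω` is the transition `(s, a, t)`. -/
def Takes (ω : ℕ → Hist S A) (n : ℕ) (s : S) (a : A) (t : S) : Prop :=
  (ω n).last = s ∧ ω (n + 1) = (ω n).snoc a t

theorem IsChain.count_mono {ω : ℕ → Hist S A} (hω : IsChain ω) (q : S → A → S → Prop) :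
    Monotone fun n => (ω n).count q := by
  refine monotone_nat_of_le_succ fun n => ?_
  rcases hω n with e | ⟨a, t, e⟩ <;> simp [e, count]

theorem IsChain.frequently_of_count {ω : ℕ → Hist S A} (hω : IsChain ω) {q : S → A → S → Prop}
    (h : ∀ B, ∃ n, B ≤ (ω n).count q) :
    ∃ᶠ n in Filter.atTop, ∃ s a t, q s a t ∧ Takes ω n s a t := by
  rw [Filter.frequently_atTop]
  intro N
  by_contra! hc
  have hb : ∀ n ≥ N, (ω n).count q ≤ (ω N).count q := by
    intro n hn
    induction n, hn using Nat.le_induction with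
    | base => exact le_rfl
    | succ n hn ih =>
      rcases hω n with e | ⟨a, t, e⟩
      · rwa [e]
      · have hq : ¬ q (ω n).last a t := fun hq => hc n hn _ a t hq ⟨rfl, e⟩
        simpa [e, count, hq] using ih
  obtain ⟨n, hn⟩ := h ((ω N).count q + 1)
  have h1 := hω.count_mono q (le_max_left n N)
  have h2 := hb _ (le_max_right n N)
  simp only at h1
  omega

theorem IsChain.count_of_frequently {ω : ℕ → Hist S A} (hω : IsChain ω) {q : S → A → S → Prop}
    (h : ∃ᶠ n in Filter.atTop, ∃ s a t, q s a t ∧ Takes ω n s a t) (B : ℕ) :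
    ∃ n, B ≤ (ω n).count q := by
  induction B with
  | zero => exact ⟨0, Nat.zero_le _⟩
  | succ B ih =>
    obtain ⟨n, hn⟩ := ih
    obtain ⟨m, hm, s, a, t, hq, hs, e⟩ := Filter.frequently_atTop.1 h n
    refine ⟨m + 1, ?_⟩
    have := hω.count_mono q hm
    simp only at this
    rw [e, count, if_pos (by rwa [hs])]
    omega

end Hist

/-! ### Fairness and end components -/

namespace MDP

variable {S A : Type*} [Fintype S] [Fintype A] {M : MDP S A}

open Hist

theorem P_sum_le_one (M : MDP S A) (s : S) (a : A) : ∑ t, M.P s a t ≤ 1 := by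
  rcases M.P_sum s a with h | h <;> simp [h]

/-- A potential that decreases in expectation: it grows when `a` is taken in `s` and shrinks when
this leads to `t`. -/
noncomputable def potential (M : MDP S A) (s : S) (a : A) (t : S) (h : Hist S A) : ENNReal :=
  ENNReal.ofReal ((1 + M.P s a t / 2) ^ h.count (fun s' a' _ => s' = s ∧ a' = a) *
    (1 / 2) ^ h.count (fun s' a' t' => (s' = s ∧ a' = a) ∧ t' = t))

/-- With `p = M.P s a t`, taking `a` in `s` multiplies the potential by `1 + p / 2`, and by a
further `1 / 2` with probability `p`. The mean factor is at most `(1 + p / 2) * (1 - p / 2) ≤ 1`.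
Other steps do not change it. So the potential is a supermartingale under every policy. -/
theorem stepOp_potential_le (σ : M.Policy) (s : S) (a : A) (t : S) (h : Hist S A) :
    stepOp σ (M.potential s a t) h ≤ M.potential s a t h := by
  classical
  by_cases ht : M.IsTerminal h.last
  · rw [stepOp_of_terminal σ ht]
  rw [stepOp_of_not_terminal σ ht]
  set p := M.P s a t with hp
  have hp0 : 0 ≤ p := M.P_nonneg s a t
  set z : Hist S A → ℝ := fun h =>
    (1 + p / 2) ^ h.count (fun s' a' _ => s' = s ∧ a' = a) *
    (1 / 2) ^ h.count (fun s' a' t' => (s' = s ∧ a' = a) ∧ t' = t) with hz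
  have hz0 : ∀ h, 0 ≤ z h := fun h => by positivity
  have hpot : ∀ h, M.potential s a t h = ENNReal.ofReal (z h) := fun h => rfl
  have hsum : ∀ b, ∑ u, M.P h.last b u * z (h.snoc b u) ≤ z h := by
    intro b
    by_cases hb : h.last = s ∧ b = a
    · obtain ⟨hs, rfl⟩ := hb
      have e : ∀ u, M.P h.last b u * z (h.snoc b u) =
          z h * (1 + p / 2) * (M.P s b u - if u = t then M.P s b u / 2 else 0) := by
        intro u
        by_cases hu : u = t
        · simp [hz, count, hs, hu, pow_succ]; ring
        · simp [hz, count, hs, hu, pow_succ]; ring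
      simp only [e]
      rw [← Finset.mul_sum, Finset.sum_sub_distrib, Finset.sum_ite_eq' Finset.univ t,
        if_pos (Finset.mem_univ t), ← hp]
      have h1 := M.P_sum_le_one s b
      have h2 : (1 + p / 2) * (∑ u, M.P s b u - p / 2) ≤ 1 := by nlinarith
      calc _ = z h * ((1 + p / 2) * (∑ u, M.P s b u - p / 2)) := by ring
        _ ≤ z h * 1 := mul_le_mul_of_nonneg_left h2 (hz0 h)
        _ = z h := mul_one _
    · have e : ∀ u, z (h.snoc b u) = z h := by
        intro u
        simp [hz, count, hb]
      simp only [e, ← Finset.sum_mul]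
      exact mul_le_of_le_one_left (hz0 h) (M.P_sum_le_one _ _)
  calc _ = ENNReal.ofReal (∑ b, σ.prob h b * ∑ u, M.P h.last b u * z (h.snoc b u)) := by
        rw [ENNReal.ofReal_sum_of_nonneg fun b _ => mul_nonneg (σ.nonneg h ht b)
          (Finset.sum_nonneg fun u _ => mul_nonneg (M.P_nonneg _ _ _) (hz0 _))]
        refine Finset.sum_congr rfl fun b _ => ?_
        rw [Finset.mul_sum, ENNReal.ofReal_sum_of_nonneg fun u _ => mul_nonneg (σ.nonneg h ht b)
          (mul_nonneg (M.P_nonneg _ _ _) (hz0 _))]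
        refine Finset.sum_congr rfl fun u _ => ?_
        rw [hpot, ← ENNReal.ofReal_mul (mul_nonneg (σ.nonneg h ht b) (M.P_nonneg _ _ _)), mul_assoc]
    _ ≤ ENNReal.ofReal (∑ b, σ.prob h b * z h) := by
        refine ENNReal.ofReal_le_ofReal (Finset.sum_le_sum fun b _ => ?_)
        exact mul_le_mul_of_nonneg_left (hsum b) (σ.nonneg h ht b)
    _ = _ := by rw [← Finset.sum_mul, σ.sum_eq_one h ht, one_mul, hpot]

theorem lintegral_potential_le (σ : M.Policy) (s : S) (a : A) (t : S) (h : Hist S A) (n : ℕ) :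
    ∫⁻ ω, M.potential s a t (ω n) ∂PrFrom σ h ≤ M.potential s a t h := by
  induction n generalizing h with
  | zero =>
    rw [lintegral_eval_PrFrom]
    exact le_rfl
  | succ n ih =>
    rw [lintegral_eval_succ]
    exact (stepOp_mono σ ih h).trans (stepOp_potential_le σ s a t h)

/-- Almost surely, a transition of positive probability is taken infinitely often if its action is
taken infinitely often in its source. -/
theorem ae_frequently_takes (σ : M.Policy) (h : Hist S A) : ∀ᵐ ω ∂PrFrom σ h,
    ∀ s a t, 0 < M.P s a t → (∃ᶠ n in Filter.atTop, ∃ t', Takes ω n s a t') →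
      ∃ᶠ n in Filter.atTop, Takes ω n s a t := by
  simp only [ae_all_iff]
  intro s a t hp
  have hm : ∀ n, Measurable fun ω : ℕ → Hist S A => M.potential s a t (ω n) := fun n =>
    (Measurable.of_discrete (f := M.potential s a t)).comp (measurable_pi_apply n)
  -- By Fatou's lemma the limit inferior of the potential is integrable, hence almost surely finite.
  -- If `a` were taken in `s` infinitely often but led to `t` fewer than `B` times, the potential
  -- would be at least `(1 / 2) ^ B` times a power of `1 + p / 2 > 1` with exponent tending to
  -- infinity.
  have hfat : ∫⁻ ω, Filter.liminf (fun n => M.potential s a t (ω n)) Filter.atTop ∂PrFrom σ h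
      ≠ ⊤ := by
    refine ne_top_of_le_ne_top (b := M.potential s a t h) ENNReal.ofReal_ne_top ?_
    refine (lintegral_liminf_le hm).trans ?_
    refine (Filter.liminf_le_liminf (v := fun _ => M.potential s a t h)
      (Filter.Eventually.of_forall fun n => lintegral_potential_le σ s a t h n)).trans ?_
    simp
  filter_upwards [ae_lt_top (Measurable.liminf hm) hfat, ae_isRun σ h] with ω hω hr hf
  have hch := hr.isChain
  have hc := hch.count_of_frequently (q := fun s' a' _ => s' = s ∧ a' = a)
    (hf.mono fun n ⟨t', ht'⟩ => ⟨s, a, t', ⟨rfl, rfl⟩, ht'⟩)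
  suffices hB : ∀ B, ∃ n, B ≤ (ω n).count (fun s' a' t' => (s' = s ∧ a' = a) ∧ t' = t) by
    refine (hch.frequently_of_count hB).mono ?_
    rintro n ⟨s', a', t', ⟨⟨rfl, rfl⟩, rfl⟩, h⟩
    exact h
  by_contra! hB
  obtain ⟨B, hB⟩ := hB
  refine hω.ne (Filter.Tendsto.liminf_eq ?_)
  have h1 : Filter.Tendsto (fun n => (ω n).count (fun s' a' _ => s' = s ∧ a' = a))
      Filter.atTop Filter.atTop :=
    Filter.tendsto_atTop_atTop_of_monotone (hch.count_mono _) hc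
  have h2 : Filter.Tendsto (fun n : ℕ => (1 + M.P s a t / 2) ^ n) Filter.atTop Filter.atTop :=
    tendsto_pow_atTop_atTop_of_one_lt (by linarith)
  have h3 := (h2.comp h1).atTop_mul_const (show (0 : ℝ) < (1 / 2) ^ B by positivity)
  refine tendsto_nhds_top_mono' (ENNReal.tendsto_ofReal_atTop.comp h3) fun n => ?_
  refine ENNReal.ofReal_le_ofReal ?_
  refine mul_le_mul_of_nonneg_left ?_ (pow_nonneg (by linarith) _)
  exact pow_le_pow_of_le_one (by norm_num) (by norm_num) (hB n).le

theorem IsRun.enabled {σ : M.Policy} {h : Hist S A} {ω : ℕ → Hist S A} (hω : IsRun σ h ω) {n : ℕ}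
    {a : A} {t : S} (e : ω (n + 1) = (ω n).snoc a t) :
    ¬ M.IsTerminal (ω n).last ∧ M.Enabled (ω n).last a ∧ 0 < M.P (ω n).last a t := by
  rcases hω.step n with ⟨_, e'⟩ | ⟨ht, b, u, e', hp, hP⟩
  · exact absurd (e'.symm.trans e) (ne_snoc _ _ _)
  · rw [e] at e'
    simp only [Hist.snoc.injEq, true_and] at e'
    obtain ⟨rfl, rfl⟩ := e'
    refine ⟨ht, ?_, hP⟩
    by_contra hc
    exact hp.ne' (σ.enabled _ ht _ hc)

/-- The state-action pairs used infinitely often form an end component. -/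
theorem IsRun.isEndComponent {σ : M.Policy} {h : Hist S A} {ω : ℕ → Hist S A}
    (hω : IsRun σ h ω) (hnt : ∀ n, ¬ M.IsTerminal (ω n).last)
    (hfair : ∀ s a t, 0 < M.P s a t → (∃ᶠ n in Filter.atTop, ∃ t', Takes ω n s a t') →
      ∃ᶠ n in Filter.atTop, Takes ω n s a t) :
    ∃ B, M.IsEndComponent B ∧ ∀ᶠ n in Filter.atTop, ∃ a t, ω (n + 1) = (ω n).snoc a t ∧
      ((ω n).last, a) ∈ B := by
  let B : Set (S × A) := {p | ∃ᶠ n in Filter.atTop, ∃ t, Takes ω n p.1 p.2 t}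
  have hB : ∀ p, p ∈ B ↔ ∃ᶠ n in Filter.atTop, ∃ t, Takes ω n p.1 p.2 t := fun p => Iff.rfl
  have hev : ∀ᶠ n in Filter.atTop, ∀ p : S × A, (∃ t, Takes ω n p.1 p.2 t) → p ∈ B := by
    rw [Filter.eventually_all]
    intro p
    by_cases hp : p ∈ B
    · exact Filter.Eventually.of_forall fun n _ => hp
    · rw [hB, Filter.not_frequently] at hp
      exact hp.mono fun n hn h => absurd h hn
  choose α τ hατ using fun n => hω.snoc_of_ne (hnt n)
  have hev' : ∀ᶠ n in Filter.atTop, ((ω n).last, α n) ∈ B :=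
    hev.mono fun n hn => hn _ ⟨τ n, rfl, (hατ n).1⟩
  have hvis : ∀ t, (∃ᶠ n in Filter.atTop, (ω n).last = t) → t ∈ pairStates B := by
    intro t ht
    obtain ⟨n, hn, hn'⟩ := (ht.and_eventually hev').exists
    exact ⟨_, hn', hn⟩
  have hvis' : ∀ t ∈ pairStates B, ∃ᶠ n in Filter.atTop, (ω n).last = t := by
    rintro _ ⟨p, hp, rfl⟩
    exact hp.mono fun n ⟨t, h, _⟩ => h
  obtain ⟨N, hN⟩ := Filter.eventually_atTop.1 hev'
  refine ⟨B, ⟨?_, ?_, ?_, ?_⟩, ?_⟩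
  · exact ⟨_, hN N le_rfl⟩
  · intro p hp
    obtain ⟨n, t, hs, e⟩ := Filter.Frequently.exists hp
    rw [← hs]
    exact (hω.enabled e).2.1
  · intro p hp t ht
    refine hvis t ?_
    have := hfair p.1 p.2 t ht hp
    rw [Filter.frequently_atTop] at this ⊢
    intro k
    obtain ⟨n, hn, _, e⟩ := this k
    exact ⟨n + 1, by omega, by rw [e]; rfl⟩
  -- From time `N` on, every step uses a pair of `B`. Both states recur, so the stretch of the run
  -- from a visit to `s` after `N` to a later visit to `t` is a path inside `B`.
  · intro s hs t ht
    obtain ⟨n, hn, rfl⟩ := Filter.frequently_atTop.1 (hvis' s hs) N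
    obtain ⟨m, hm, rfl⟩ := Filter.frequently_atTop.1 (hvis' t ht) n
    clear hs ht
    induction m, hm using Nat.le_induction with
    | base => exact Relation.ReflTransGen.refl
    | succ m hm ih =>
      refine ih.tail ⟨α m, hN m (hn.trans hm), ?_⟩
      have := (hατ m).2.2
      rw [(hατ m).1]
      exact this
  · exact hev'.mono fun n hn => ⟨α n, τ n, (hατ n).1, hn⟩

theorem IsEndComponent.exists_isMEC {B : Set (S × A)} (hB : M.IsEndComponent B) :
    ∃ B', M.IsMEC B' ∧ B ⊆ B' := by
  obtain ⟨B', h, hmax⟩ := (Set.toFinite {B | M.IsEndComponent B}).exists_le_maximal hB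
  exact ⟨B', hmax, h⟩

/-- Almost surely, a run ends in a terminal state or eventually uses only state-action pairs
of maximal end components. -/
theorem ae_terminal_or_internal (σ : M.Policy) (h : Hist S A) : ∀ᵐ ω ∂PrFrom σ h,
    (∃ n, M.IsTerminal (ω n).last) ∨ ∀ᶠ n in Filter.atTop, ∃ a t, ω (n + 1) = (ω n).snoc a t ∧
      M.Internal (ω n).last a := by
  filter_upwards [ae_isRun σ h, ae_frequently_takes σ h] with ω hr hfair
  by_cases hT : ∃ n, M.IsTerminal (ω n).last
  · exact Or.inl hT
  · push Not at hT
    obtain ⟨B, hB, hev⟩ := hr.isEndComponent hT hfair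
    obtain ⟨B', hB', hle⟩ := hB.exists_isMEC
    exact Or.inr (hev.mono fun n ⟨a, t, e, hn⟩ => ⟨a, t, e, B', hB', hle hn⟩)

end MDP

/-! ### Relabelled histories and first arrivals in a set -/

namespace Hist

variable {S A S' A' : Type*}

@[simp] theorem last_map (f : S → S') (g : A → A') (h : Hist S A) :
    (h.map f g).last = f h.last := by
  cases h <;> rfl

theorem map_injective {f : S → S'} {g : A → A'} (hf : Function.Injective f)
    (hg : Function.Injective g) : Function.Injective (map f g) := by
  intro h
  induction h with
  | start s =>
    intro h' e
    cases h' with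
    | start s' => simp only [map, start.injEq] at e; rw [hf e]
    | snoc h' a' s' => simp [map] at e
  | snoc h a s ih =>
    intro h' e
    cases h' with
    | start s' => simp [map] at e
    | snoc h' a' s' =>
      simp only [map, snoc.injEq] at e
      rw [ih e.1, hg e.2.1, hf e.2.2]

theorem AvoidsBeforeLast.last_notMem {C : Set S} {g h : Hist S A} (hh : h.AvoidsBeforeLast C)
    (H : g.Pre h) (hne : g ≠ h) : g.last ∉ C := by
  induction h with
  | start s => exact absurd H hne
  | snoc h a s ih =>
    rcases H with rfl | H
    · exact absurd rfl hne
    · by_cases e : g = h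
      · rw [e]; exact hh.2
      · exact ih hh.1 H e

theorem AvoidsBeforeLast.eq_of_last_mem {C : Set S} {g h : Hist S A} (hh : h.AvoidsBeforeLast C)
    (H : g.Pre h) (hg : g.last ∈ C) : g = h := by
  by_contra hne
  exact hh.last_notMem H hne hg

end Hist

namespace MDP

open Hist

/-! ### Building policies pointwise; paths of positive weight -/

section General

variable {S A : Type*} [Fintype S] [Fintype A] {M : MDP S A}

/-- Policies can be chosen pointwise. -/
theorem exists_policy_of_forall {Q : Hist S A → (A → ℝ) → Prop}
    (H : ∀ h, ∃ p : A → ℝ, Q h p ∧ (¬ M.IsTerminal h.last →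
      (∀ a, 0 ≤ p a) ∧ ∑ a, p a = 1 ∧ ∀ a, ¬ M.Enabled h.last a → p a = 0)) :
    ∃ σ : M.Policy, ∀ h, Q h (σ.prob h) := by
  choose p hQ hp using H
  exact ⟨⟨p, fun h ht => (hp h ht).1, fun h ht => (hp h ht).2.1, fun h ht => (hp h ht).2.2⟩, hQ⟩

theorem Policy.valid (σ : M.Policy) (h : Hist S A) : ¬ M.IsTerminal h.last →
    (∀ a, 0 ≤ σ.prob h a) ∧ ∑ a, σ.prob h a = 1 ∧ ∀ a, ¬ M.Enabled h.last a → σ.prob h a = 0 :=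
  fun ht => ⟨σ.nonneg h ht, σ.sum_eq_one h ht, σ.enabled h ht⟩

theorem wt_congr {σ τ : M.Policy} {h : Hist S A}
    (H : ∀ e, h.Pre e → σ.prob e = τ.prob e) (e : Hist S A) : wt σ h e = wt τ h e := by
  induction e with
  | start s => rfl
  | snoc e a t ih =>
    by_cases hne : e.snoc a t = h
    · rw [hne, wt_self, wt_self]
    · rw [wt_snoc_of_ne hne, wt_snoc_of_ne hne, ih]
      by_cases h0 : wt τ h e = 0
      · simp [h0]
      · rw [pw, pw, H e (pre_of_wt_ne_zero h0)]

theorem isPath_of_wt_ne_zero {σ : M.Policy} {s : S} {g : Hist S A}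
    (h : wt σ (.start s) g ≠ 0) : M.IsPath g := by
  induction g with
  | start t => trivial
  | snoc g a t ih =>
    rw [wt_start_snoc] at h
    refine ⟨ih (left_ne_zero_of_mul h), ?_⟩
    have h2 := right_ne_zero_of_mul h
    by_cases ht : M.IsTerminal g.last
    · exact absurd (pw_of_terminal σ ht a t) h2
    · rw [pw_of_not_terminal σ ht] at h2
      refine (M.P_nonneg _ _ _).lt_of_ne fun e => h2 ?_
      rw [← e, mul_zero, ENNReal.ofReal_zero]

theorem enabled_of_P_pos {s : S} {a : A} {t : S} (h : 0 < M.P s a t) : M.Enabled s a := by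
  refine (M.P_sum s a).resolve_left fun h0 => ?_
  rw [Finset.sum_eq_zero_iff_of_nonneg fun u _ => M.P_nonneg s a u] at h0
  exact h.ne' (h0 t (Finset.mem_univ t))

theorem exists_P_pos {s : S} {a : A} (h : M.Enabled s a) : ∃ t, 0 < M.P s a t := by
  by_contra! hc
  have : ∑ t, M.P s a t = 0 :=
    Finset.sum_eq_zero fun t _ => le_antisymm (hc t) (M.P_nonneg s a t)
  rw [Enabled, this] at h
  exact zero_ne_one h

theorem P_eq_zero_of_not_enabled {s : S} {a : A} (h : ¬ M.Enabled s a) (t : S) :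
    M.P s a t = 0 := by
  by_contra hne
  exact h (enabled_of_P_pos ((M.P_nonneg s a t).lt_of_ne (Ne.symm hne)))

end General

variable {S A : Type*} [Fintype S] [Fintype A] {M : MDP S A} {C E : Set S}

/-! ### The MDP of the first step -/

theorem sum_verdict (f : Verdict → ℝ) : ∑ v, f v = f .TP + f .FP := by
  rw [show (Finset.univ : Finset Verdict) = {.TP, .FP} from rfl, Finset.sum_pair (by decide)]

theorem sum_extremal {N : Type*} [AddCommMonoid N] (f : Extremal → N) :
    ∑ x, f x = f .min + f .max := by
  rw [show (Finset.univ : Finset Extremal) = {.min, .max} from rfl, Finset.sum_pair (by decide)]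

theorem minmax_P_inl {s : S} (hs : s ∉ C) (a : A) (t : S) :
    (M.minmax C E).P (.inl s) (.inl a) (.inl t) = M.P s a t := by
  simp [minmax, minmaxP, hs]

theorem minmax_P_inl_of_mem {s : S} (hs : s ∈ C) (a : A) (t : S ⊕ Verdict) :
    (M.minmax C E).P (.inl s) (.inl a) t = 0 := by
  rcases t with t | v <;> simp [minmax, minmaxP, hs]

theorem minmax_P_inl_inr (s : S ⊕ Verdict) (a : A) (v : Verdict) :
    (M.minmax C E).P s (.inl a) (.inr v) = 0 := by
  rcases s with s | v <;> rfl

theorem minmax_P_inr_inl (s : S ⊕ Verdict) (x : Extremal) (t : S) :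
    (M.minmax C E).P s (.inr x) (.inl t) = 0 := by
  rcases s with s | v <;> rfl

theorem minmax_P_TP {s : S} (hs : s ∈ C) (x : Extremal) :
    (M.minmax C E).P (.inl s) (.inr x) (.inr .TP) = M.prExt E x s := by
  simp [minmax, minmaxP, hs]

theorem minmax_P_FP {s : S} (hs : s ∈ C) (x : Extremal) :
    (M.minmax C E).P (.inl s) (.inr x) (.inr .FP) = 1 - M.prExt E x s := by
  simp [minmax, minmaxP, hs]

theorem minmax_P_inr_of_notMem {s : S} (hs : s ∉ C) (x : Extremal) (t : S ⊕ Verdict) :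
    (M.minmax C E).P (.inl s) (.inr x) t = 0 := by
  rcases t with t | (_ | _) <;> simp [minmax, minmaxP, hs]

theorem minmax_P_verdict (v : Verdict) (a : A ⊕ Extremal) (t : S ⊕ Verdict) :
    (M.minmax C E).P (.inr v) a t = 0 := by
  rcases a with a | x <;> rfl

theorem minmax_enabled_inl {s : S} (hs : s ∉ C) (a : A) :
    (M.minmax C E).Enabled (.inl s) (.inl a) ↔ M.Enabled s a := by
  simp [Enabled, Fintype.sum_sum_type, minmax_P_inl hs, minmax_P_inl_inr]

theorem minmax_enabled_inr {s : S} (hs : s ∈ C) (x : Extremal) :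
    (M.minmax C E).Enabled (.inl s) (.inr x) := by
  simp [Enabled, Fintype.sum_sum_type, minmax_P_inr_inl, sum_verdict, minmax_P_TP hs,
    minmax_P_FP hs]

theorem minmax_not_enabled_inl {s : S} (hs : s ∈ C) (a : A) :
    ¬ (M.minmax C E).Enabled (.inl s) (.inl a) := by
  simp [Enabled, minmax_P_inl_of_mem hs]

theorem minmax_not_enabled_inr {s : S} (hs : s ∉ C) (x : Extremal) :
    ¬ (M.minmax C E).Enabled (.inl s) (.inr x) := by
  simp [Enabled, minmax_P_inr_of_notMem hs]

theorem minmax_terminal_verdict (v : Verdict) : (M.minmax C E).IsTerminal (.inr v) := by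
  intro a
  simp [Enabled, minmax_P_verdict]

theorem minmax_not_terminal_of_mem {s : S} (hs : s ∈ C) :
    ¬ (M.minmax C E).IsTerminal (.inl s) := fun h => h _ (minmax_enabled_inr hs .min)

theorem minmax_terminal_iff {s : S} (hs : s ∉ C) :
    (M.minmax C E).IsTerminal (.inl s) ↔ M.IsTerminal s := by
  constructor
  · intro h a ha
    exact h (.inl a) ((minmax_enabled_inl hs a).2 ha)
  · rintro h (a | x) ha
    · exact h a ((minmax_enabled_inl hs a).1 ha)
    · exact minmax_not_enabled_inr hs x ha

/-! ### Policies of the MDP and of the first step -/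

/-- Outside `C` the choices of `σ` are copied. On arrival in `C` the residual probability of
reaching `E` lies between the extremal ones, hence is a convex combination of them, whose
coefficients serve as the probabilities of the two new actions. -/
theorem exists_corrMinmax_of_policy (hE : ∀ e ∈ E, M.IsTerminal e) (σ : M.Policy) :
    ∃ θ : (M.minmax C E).Policy, M.CorrMinmax C E σ θ := by
  classical
  obtain ⟨θ, hθ⟩ := exists_policy_of_forall (M := M.minmax C E)
    (Q := fun h₁ p => ∀ h : Hist S A, h.map .inl .inl = h₁ →
      (h.last ∉ C → ∀ a, p (.inl a) = σ.prob h a) ∧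
      (h.last ∈ C → p (.inr .min) * M.prMin E h.last + p (.inr .max) * M.prMax E h.last =
        (PrFrom σ h).real (ev E))) (fun h₁ => by
      by_cases hh : ∃ h : Hist S A, h.map .inl .inl = h₁
      · obtain ⟨h, rfl⟩ := hh
        have hinj := map_injective (S := S) (A := A) (S' := S ⊕ Verdict) (A' := A ⊕ Extremal)
          Sum.inl_injective Sum.inl_injective
        by_cases hC : h.last ∈ C
        · obtain ⟨π, hπ⟩ := M.exists_policy_prMin hE
          obtain ⟨π', hπ'⟩ := M.exists_policy_prMax hE
          have h1 := (hπ h).2 σ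
          have h2 := (hπ' h).2 σ
          have hseg : (PrFrom σ h).real (ev E) ∈ segment ℝ (M.prMin E h.last) (M.prMax E h.last) := by
            rw [segment_eq_Icc (h1.trans h2)]
            exact ⟨h1, h2⟩
          obtain ⟨l, m, hl, hm, hlm, e⟩ := hseg
          refine ⟨Sum.elim (fun _ => 0) (fun x => match x with | .min => l | .max => m), ?_, ?_⟩
          · intro h' e'
            obtain rfl := hinj e'
            exact ⟨fun h => absurd hC h, fun _ => e⟩
          · intro _
            refine ⟨?_, ?_, ?_⟩
            · rintro (a | (_ | _))
              exacts [le_rfl, hl, hm]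
            · simp [Fintype.sum_sum_type, sum_extremal, hlm]
            · rintro (a | x) ha
              · rfl
              · rw [last_map] at ha
                exact absurd (minmax_enabled_inr hC x) ha
        · refine ⟨Sum.elim (σ.prob h) (fun _ => 0), ?_, ?_⟩
          · intro h' e'
            obtain rfl := hinj e'
            exact ⟨fun _ a => rfl, fun h => absurd h hC⟩
          · intro ht
            rw [last_map] at ht ⊢
            rw [minmax_terminal_iff hC] at ht
            refine ⟨?_, ?_, ?_⟩
            · rintro (a | x)
              exacts [σ.nonneg h ht a, le_rfl]
            · simp [Fintype.sum_sum_type, σ.sum_eq_one h ht]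
            · rintro (a | x) ha
              · rw [minmax_enabled_inl hC] at ha
                exact σ.enabled h ht a ha
              · rfl
      -- Sequences that do not come from `M` are unconstrained.
      · obtain ⟨τ⟩ : Nonempty (M.minmax C E).Policy := inferInstance
        exact ⟨τ.prob h₁, fun h e => absurd ⟨h, e⟩ hh, τ.valid h₁⟩)
  exact ⟨θ, fun h _ _ => ⟨fun hC _ => (hθ _ h rfl).1 hC, (hθ _ h rfl).2⟩⟩

theorem policy_extremal_sum (θ : (M.minmax C E).Policy) {h : Hist S A} (hC : h.last ∈ C) :
    0 ≤ θ.prob (h.map .inl .inl) (.inr .min) ∧ 0 ≤ θ.prob (h.map .inl .inl) (.inr .max) ∧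
    θ.prob (h.map .inl .inl) (.inr .min) + θ.prob (h.map .inl .inl) (.inr .max) = 1 := by
  have ht : ¬ (M.minmax C E).IsTerminal ((h.map .inl .inl : Hist (S ⊕ Verdict) (A ⊕ Extremal))).last := by
    rw [last_map]; exact minmax_not_terminal_of_mem hC
  refine ⟨θ.nonneg _ ht _, θ.nonneg _ ht _, ?_⟩
  have h1 := θ.sum_eq_one _ ht
  rw [Fintype.sum_sum_type, sum_extremal, Finset.sum_eq_zero, zero_add] at h1
  · exact h1
  · intro a _
    refine θ.enabled _ ht _ ?_
    rw [last_map]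
    exact minmax_not_enabled_inl hC a

/-- Copy `θ` before `C`. After a first arrival `g` in `C`, follow on all extensions of `g` a policy
`τ g` that mixes the minimizing and the maximizing policy with the weights `θ` gives to the two new
actions. A history has at most one prefix that is a first arrival, so this is consistent. -/
theorem exists_policy_of_corrMinmax (hE : ∀ e ∈ E, M.IsTerminal e) (θ : (M.minmax C E).Policy) :
    ∃ σ : M.Policy, M.CorrMinmax C E σ θ := by
  classical
  obtain ⟨π, hπ⟩ := M.exists_policy_prMin hE
  obtain ⟨π', hπ'⟩ := M.exists_policy_prMax hE
  have hτ : ∀ g : Hist S A, ∃ τ : M.Policy, g.last ∈ C → (PrFrom τ g).real (ev E) =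
      θ.prob (g.map .inl .inl) (.inr .min) * M.prMin E g.last +
        θ.prob (g.map .inl .inl) (.inr .max) * M.prMax E g.last := by
    intro g
    by_cases hC : g.last ∈ C
    · obtain ⟨h1, h2, h3⟩ := policy_extremal_sum θ hC
      obtain ⟨τ, hτ⟩ := exists_policy_mix_ev π π' g hE h1 h2 h3
      exact ⟨τ, fun _ => by rw [hτ, (hπ g).1, (hπ' g).1]⟩
    · exact ⟨π, fun h => absurd h hC⟩
  choose τ hτ using hτ
  obtain ⟨σ, hσ⟩ := exists_policy_of_forall (M := M) (Q := fun h p =>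
    (∀ g : Hist S A, g.Pre h → g.AvoidsBeforeLast C → g.last ∈ C → p = (τ g).prob h) ∧
    ((∀ g : Hist S A, g.Pre h → g.AvoidsBeforeLast C → g.last ∉ C) →
      ∀ a, p a = θ.prob (h.map .inl .inl) (.inl a))) (fun h => by
    by_cases hg : ∃ g : Hist S A, g.Pre h ∧ g.AvoidsBeforeLast C ∧ g.last ∈ C
    · obtain ⟨g, hgh, hga, hgC⟩ := hg
      refine ⟨(τ g).prob h, ⟨?_, ?_⟩, (τ g).valid h⟩
      · intro g' hgh' hga' hgC'
        have : g = g' := by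
          rcases hgh.total hgh' with H | H
          · exact hga'.eq_of_last_mem H hgC
          · exact (hga.eq_of_last_mem H hgC').symm
        rw [this]
      · intro hn
        exact absurd hgC (hn g hgh hga)
    · push Not at hg
      by_cases hhC : h.last ∈ C
      · refine ⟨π.prob h, ⟨fun g h1 h2 h3 => absurd h3 (hg g h1 h2), fun _ => ?_⟩, π.valid h⟩
        exfalso
        -- A history none of whose prefixes is a first arrival avoids `C` altogether, so this case
        -- cannot occur.
        have : ∀ k : Hist S A, (∀ g : Hist S A, g.Pre k → g.AvoidsBeforeLast C → g.last ∉ C) →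
            k.AvoidsBeforeLast C ∧ k.last ∉ C := by
          intro k
          induction k with
          | start s => exact fun H => ⟨trivial, H _ (Pre.refl _) trivial⟩
          | snoc k a t ih =>
            intro H
            have h1 := ih fun g hgk => H g (hgk.snoc a t)
            exact ⟨h1, H _ (Pre.refl _) h1⟩
        exact (this h hg).2 hhC
      · refine ⟨fun a => θ.prob (h.map .inl .inl) (.inl a),
          ⟨fun g h1 h2 h3 => absurd h3 (hg g h1 h2), fun _ a => rfl⟩, fun ht => ?_⟩
        have ht' : ¬ (M.minmax C E).IsTerminal
            ((h.map .inl .inl : Hist (S ⊕ Verdict) (A ⊕ Extremal))).last := by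
          rwa [last_map, minmax_terminal_iff hhC]
        refine ⟨fun a => θ.nonneg _ ht' _, ?_, fun a ha => θ.enabled _ ht' _ ?_⟩
        · have h1 := θ.sum_eq_one _ ht'
          rw [Fintype.sum_sum_type, Finset.sum_eq_zero (s := (Finset.univ : Finset Extremal)),
            add_zero] at h1
          · exact h1
          · intro x _
            refine θ.enabled _ ht' _ ?_
            rw [last_map]
            exact minmax_not_enabled_inr hhC x
        · rwa [last_map, minmax_enabled_inl hhC])
  refine ⟨σ, fun h hp ha => ⟨fun hC ht a => ?_, fun hC => ?_⟩⟩
  · refine ((hσ h).2 (fun g hgh hga hgC => ?_) a).symm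
    rw [ha.eq_of_last_mem hgh hgC] at hgC
    exact hC hgC
  · rw [← hτ h hC, measureReal_def, measureReal_def, PrFrom_ev _ _ hE, PrFrom_ev _ _ hE]
    congr 1
    refine tsum_congr fun e => wt_congr (fun e he => ?_) e.1
    exact ((hσ e).1 h he ha hC).symm

/-- Before `C` is entered, both MDPs have the same transitions and the policies agree. `CorrMinmax`
speaks about paths only, but other sequences have weight zero. -/
theorem CorrMinmax.wt_eq {σ : M.Policy} {θ : (M.minmax C E).Policy} (H : M.CorrMinmax C E σ θ)
    (s : S) {g : Hist S A} (hg : g.AvoidsBeforeLast C) :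
    wt θ (.start (.inl s)) (g.map .inl .inl) = wt σ (.start s) g := by
  induction g with
  | start t => by_cases e : t = s <;> simp [wt, Hist.map, e]
  | snoc g a t ih =>
    rw [Hist.map, wt_start_snoc, wt_start_snoc, ih hg.1]
    by_cases h0 : wt σ (.start s) g = 0
    · simp [h0]
    · congr 1
      have hp := isPath_of_wt_ne_zero h0
      by_cases ht : M.IsTerminal g.last
      · rw [pw_of_terminal _ ht, pw_of_terminal]
        rwa [last_map, minmax_terminal_iff hg.2]
      · rw [pw_of_not_terminal _ ht, pw_of_not_terminal, last_map, minmax_P_inl hg.2,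
          (H g hp hg.1).1 hg.2 ht]
        rwa [last_map, minmax_terminal_iff hg.2]

/-- Summed over the two new actions, the chance of moving to `TP` is the mixture prescribed by
`CorrMinmax`. -/
theorem CorrMinmax.wt_TP {σ : M.Policy} {θ : (M.minmax C E).Policy} (H : M.CorrMinmax C E σ θ)
    (s : S) {g : Hist S A} (hg : g.AvoidsBeforeLast C) (hC : g.last ∈ C) :
    ∑ x, wt θ (.start (.inl s)) ((g.map .inl .inl).snoc (.inr x) (.inr .TP)) =
      wt σ (.start s) g * PrFrom σ g (ev E) := by
  simp only [wt_start_snoc, ← Finset.mul_sum, H.wt_eq s hg]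
  by_cases h0 : wt σ (.start s) g = 0
  · simp [h0]
  congr 1
  have ht : ¬ (M.minmax C E).IsTerminal
      ((g.map .inl .inl : Hist (S ⊕ Verdict) (A ⊕ Extremal))).last := by
    rw [last_map]; exact minmax_not_terminal_of_mem hC
  simp only [pw_of_not_terminal θ ht, last_map, minmax_P_TP hC]
  rw [← ENNReal.ofReal_sum_of_nonneg
    fun x _ => mul_nonneg (θ.nonneg _ ht _) (M.prExt_mem E x _).1, sum_extremal]
  have := (H g (isPath_of_wt_ne_zero h0) hg).2 hC
  simp only [prExt]
  rw [this, ofReal_measureReal]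

end MDP

/-! ### Countable decompositions of events; basic facts on end components -/

namespace MDP

open Hist

theorem measure_eq_tsum_of_ae {Ω ι : Type*} [MeasurableSpace Ω] [Countable ι] {μ : Measure Ω}
    {X : Set Ω} {Y : ι → Set Ω} (hX : ∀ᵐ ω ∂μ, ω ∈ X ↔ ∃ i, ω ∈ Y i)
    (hY : ∀ᵐ ω ∂μ, ∀ i j, ω ∈ Y i → ω ∈ Y j → i = j) (hm : ∀ i, MeasurableSet (Y i)) :
    μ X = ∑' i, μ (Y i) := by
  rw [← measure_iUnion₀ _ fun i => (hm i).nullMeasurableSet]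
  · refine measure_congr ?_
    filter_upwards [hX] with ω h
    exact propext (h.trans Set.mem_iUnion.symm)
  · intro i j hij
    refine measure_mono_null ?_ hY
    rintro ω ⟨hi, hj⟩ h
    exact hij (h i j hi hj)

section General

variable {S A : Type*} [Fintype S] [Fintype A] {M : MDP S A}

instance (σ : M.Policy) : IsProbabilityMeasure (Pr σ) := by
  unfold Pr; infer_instance

theorem pw_eq (σ : M.Policy) (h : Hist S A) (a : A) (t : S) :
    pw σ h a t = ENNReal.ofReal (σ.prob h a) * ENNReal.ofReal (M.P h.last a t) := by
  by_cases ht : M.IsTerminal h.last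
  · rw [pw_of_terminal σ ht, P_eq_zero_of_not_enabled (ht a), ENNReal.ofReal_zero, mul_zero]
  · rw [pw_of_not_terminal σ ht, ENNReal.ofReal_mul' (M.P_nonneg _ _ _)]

theorem Internal.inMEC {s : S} {a : A} (h : M.Internal s a) : M.InMEC s := by
  obtain ⟨B, hB, hs⟩ := h
  exact ⟨B, hB, _, hs, rfl⟩

theorem Internal.enabled {s : S} {a : A} (h : M.Internal s a) : M.Enabled s a := by
  obtain ⟨B, hB, hs⟩ := h
  exact hB.prop.enabled _ hs

theorem InMEC.not_terminal {s : S} (h : M.InMEC s) : ¬ M.IsTerminal s := by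
  obtain ⟨B, hB, p, hp, rfl⟩ := h
  exact fun ht => ht _ (hB.prop.enabled p hp)

theorem InMEC.exists_internal {s : S} (h : M.InMEC s) : ∃ a, M.Internal s a := by
  obtain ⟨B, hB, p, hp, rfl⟩ := h
  exact ⟨p.2, B, hB, hp⟩

theorem Internal.equiv {s : S} {a : A} (h : M.Internal s a) {t : S} (ht : 0 < M.P s a t) :
    ∃ B, M.IsMEC B ∧ s ∈ pairStates B ∧ t ∈ pairStates B := by
  obtain ⟨B, hB, hs⟩ := h
  exact ⟨B, hB, ⟨_, hs, rfl⟩, hB.prop.closed _ hs t ht⟩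

end General

variable {S A : Type*} [Fintype S] [Fintype A] {M : MDP S A} {C E : Set S}

/-! ### The collapsing map -/

theorem proj_of_not_terminal {s : S ⊕ Verdict} (hs : ¬ (M.minmax C E).IsTerminal s) :
    M.proj C E s = .inr (Quotient.mk _ ⟨s, hs⟩) := by
  rcases s with s | v
  · simp only [proj, dif_pos hs]
  · exact absurd (minmax_terminal_verdict v) hs

theorem proj_of_terminal {s : S ⊕ Verdict} (hs : (M.minmax C E).IsTerminal s) :
    ∃ o, M.proj C E s = .inl o := by
  rcases s with s | (_ | _)
  · simp only [proj, dif_neg (not_not.2 hs)]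
    split_ifs
    exacts [⟨_, rfl⟩, ⟨_, rfl⟩]
  · exact ⟨_, rfl⟩
  · exact ⟨_, rfl⟩

theorem proj_eq_iff {s t : S ⊕ Verdict} (hs : ¬ (M.minmax C E).IsTerminal s) :
    M.proj C E s = M.proj C E t ↔
      s = t ∨ ∃ B, (M.minmax C E).IsMEC B ∧ s ∈ pairStates B ∧ t ∈ pairStates B := by
  constructor
  · intro h
    by_cases ht : (M.minmax C E).IsTerminal t
    · obtain ⟨o, ho⟩ := proj_of_terminal ht
      rw [ho, proj_of_not_terminal hs] at h
      cases h
    · rw [proj_of_not_terminal hs, proj_of_not_terminal ht, Sum.inr.injEq] at h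
      exact Quotient.exact h
  · rintro (rfl | ⟨B, hB, hsB, htB⟩)
    · rfl
    · have ht : ¬ (M.minmax C E).IsTerminal t := InMEC.not_terminal ⟨B, hB, htB⟩
      rw [proj_of_not_terminal hs, proj_of_not_terminal ht, Sum.inr.injEq]
      exact Quotient.sound (Or.inr ⟨B, hB, hsB, htB⟩)

theorem Internal.proj_eq {s t : S ⊕ Verdict} {a : A ⊕ Extremal}
    (h : (M.minmax C E).Internal s a) (ht : 0 < (M.minmax C E).P s a t) :
    M.proj C E t = M.proj C E s :=
  ((proj_eq_iff h.inMEC.not_terminal).2 (Or.inr (h.equiv ht))).symm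

open scoped Classical in
theorem canonical_P_ext (q : M.CanState C E) (s : S ⊕ Verdict) (a : A ⊕ Extremal)
    (u : M.CanState C E) : (M.canonical C E).P q (.ext s a) u =
      if M.proj C E s = q ∧ ¬ (M.minmax C E).Internal s a then
        ∑ t, if M.proj C E t = u then (M.minmax C E).P s a t else 0 else 0 := rfl

open scoped Classical in
theorem canonical_P_tau (q u : M.CanState C E) : (M.canonical C E).P q .tau u =
    if (∃ s, (M.minmax C E).InMEC s ∧ M.proj C E s = q) ∧ u = .inl .TN then 1 else 0 := rfl

theorem canonical_enabled_ext {q : M.CanState C E} {s : S ⊕ Verdict} {a : A ⊕ Extremal} :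
    (M.canonical C E).Enabled q (.ext s a) ↔
      M.proj C E s = q ∧ ¬ (M.minmax C E).Internal s a ∧ (M.minmax C E).Enabled s a := by
  classical
  simp only [Enabled, canonical_P_ext]
  by_cases h : M.proj C E s = q ∧ ¬ (M.minmax C E).Internal s a
  · simp only [if_pos h]
    rw [Finset.sum_comm]
    simp [h]
  · simp only [if_neg h, Finset.sum_const_zero, zero_ne_one, false_iff]
    exact fun h' => h ⟨h'.1, h'.2.1⟩

theorem canonical_enabled_tau {q : M.CanState C E} :
    (M.canonical C E).Enabled q .tau ↔ ∃ s, (M.minmax C E).InMEC s ∧ M.proj C E s = q := by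
  classical
  simp only [Enabled, canonical_P_tau]
  by_cases h : ∃ s, (M.minmax C E).InMEC s ∧ M.proj C E s = q
  · simp [h]
  · simp only [h, false_and, if_false, Finset.sum_const_zero, zero_ne_one]

theorem canonical_terminal_inl (o : Outcome) : (M.canonical C E).IsTerminal (.inl o) := by
  rintro (⟨s, a⟩ | _) h
  · rw [canonical_enabled_ext] at h
    by_cases hs : (M.minmax C E).IsTerminal s
    · exact hs a h.2.2
    · rw [proj_of_not_terminal hs] at h
      cases h.1
  · obtain ⟨s, hs, e⟩ := canonical_enabled_tau.1 h
    rw [proj_of_not_terminal hs.not_terminal] at e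
    cases e

/-- Collapsing creates no new dead ends: a class that is an end component has `τ`, and in a state
outside all end components every enabled action survives. -/
theorem canonical_terminal_proj {s : S ⊕ Verdict} :
    (M.canonical C E).IsTerminal (M.proj C E s) ↔ (M.minmax C E).IsTerminal s := by
  constructor
  · intro h
    by_contra hs
    by_cases hm : (M.minmax C E).InMEC s
    · exact h .tau (canonical_enabled_tau.2 ⟨s, hm, rfl⟩)
    · obtain ⟨a, ha⟩ := not_forall_not.1 hs
      exact h (.ext s a) (canonical_enabled_ext.2 ⟨rfl, fun hi => hm hi.inMEC, ha⟩)
  · intro h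
    obtain ⟨o, ho⟩ := proj_of_terminal h
    rw [ho]
    exact canonical_terminal_inl o

theorem collapse_snoc_of_internal {h : Hist (S ⊕ Verdict) (A ⊕ Extremal)} {a : A ⊕ Extremal}
    (ha : (M.minmax C E).Internal h.last a) (t : S ⊕ Verdict) :
    M.collapse C E (h.snoc a t) = M.collapse C E h := by
  simp [collapse, ha]

theorem collapse_snoc_of_not_internal {h : Hist (S ⊕ Verdict) (A ⊕ Extremal)} {a : A ⊕ Extremal}
    (ha : ¬ (M.minmax C E).Internal h.last a) (t : S ⊕ Verdict) :
    M.collapse C E (h.snoc a t) =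
      (M.collapse C E h).snoc (.ext h.last a) (M.proj C E t) := by
  simp [collapse, ha]

/-- An omitted step does not change the class, as end components are closed under transitions of
positive probability; hence the restriction to paths. -/
theorem IsPath.collapse_last {h : Hist (S ⊕ Verdict) (A ⊕ Extremal)}
    (hh : (M.minmax C E).IsPath h) : (M.collapse C E h).last = M.proj C E h.last := by
  induction h with
  | start s => rfl
  | snoc h a t ih =>
    by_cases ha : (M.minmax C E).Internal h.last a
    · rw [collapse_snoc_of_internal ha, ih hh.1, last_snoc, ha.proj_eq hh.2]
    · rw [collapse_snoc_of_not_internal ha]; rfl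

/-- The sequence does not use the action `τ`. -/
def TauFree : Hist (M.CanState C E) (CanAct S A) → Prop
  | .start _ => True
  | .snoc h (.ext _ _) _ => TauFree h
  | .snoc _ .tau _ => False

theorem tauFree_collapse (h : Hist (S ⊕ Verdict) (A ⊕ Extremal)) :
    TauFree (M.collapse C E h) := by
  induction h with
  | start s => trivial
  | snoc h a t ih =>
    by_cases ha : (M.minmax C E).Internal h.last a
    · rw [collapse_snoc_of_internal ha]; exact ih
    · rw [collapse_snoc_of_not_internal ha]; exact ih

theorem pre_collapse {g g' : Hist (S ⊕ Verdict) (A ⊕ Extremal)} (hg : g.Pre g') :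
    (M.collapse C E g).Pre (M.collapse C E g') := by
  induction g' with
  | start s => cases hg; exact Pre.refl _
  | snoc g' b t ih =>
    rcases hg with rfl | hg
    · exact Pre.refl _
    · by_cases hb : (M.minmax C E).Internal g'.last b
      · rw [collapse_snoc_of_internal hb]; exact ih hg
      · rw [collapse_snoc_of_not_internal hb]; exact (ih hg).snoc _ _

theorem isChain_collapse {ω : ℕ → Hist (S ⊕ Verdict) (A ⊕ Extremal)} (hω : IsChain ω) :
    IsChain fun n => M.collapse C E (ω n) := by
  intro n
  dsimp only
  rcases hω n with e | ⟨a, t, e⟩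
  · exact Or.inl (by rw [e])
  · by_cases ha : (M.minmax C E).Internal (ω n).last a
    · exact Or.inl (by rw [e, collapse_snoc_of_internal ha])
    · exact Or.inr ⟨_, _, by rw [e, collapse_snoc_of_not_internal ha]⟩

section Run

variable {θ : (M.minmax C E).Policy} {s₀ : S ⊕ Verdict}
  {ω : ℕ → Hist (S ⊕ Verdict) (A ⊕ Extremal)}

/-- Go back in time to the moment at which the last transition of the collapsed history was added.
-/
theorem IsRun.exists_leave (hω : IsRun θ (.start s₀) ω) {n : ℕ}
    {ρ : Hist (M.CanState C E) (CanAct S A)} {s : S ⊕ Verdict} {a : A ⊕ Extremal}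
    {u : M.CanState C E} (e : M.collapse C E (ω n) = ρ.snoc (.ext s a) u) :
    ∃ m < n, M.collapse C E (ω m) = ρ ∧ (ω m).last = s ∧ ¬ (M.minmax C E).Internal s a ∧
      ∃ t, ω (m + 1) = (ω m).snoc a t ∧ M.proj C E t = u := by
  induction n with
  | zero => rw [hω.zero] at e; simp [collapse] at e
  | succ n ih =>
    have hprev : M.collapse C E (ω n) = ρ.snoc (.ext s a) u → _ := fun e =>
      (ih e).imp fun m hm => (⟨hm.1.trans (Nat.lt_succ_self n), hm.2⟩ :
        m < n + 1 ∧ _)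
    rcases hω.isChain n with e' | ⟨b, t, e'⟩
    · exact hprev (by rw [← e', e])
    · by_cases hb : (M.minmax C E).Internal (ω n).last b
      · refine hprev ?_
        rwa [e', collapse_snoc_of_internal hb] at e
      · rw [e', collapse_snoc_of_not_internal hb] at e
        simp only [Hist.snoc.injEq, CanAct.ext.injEq] at e
        obtain ⟨h1, ⟨h2, rfl⟩, h3⟩ := e
        exact ⟨n, Nat.lt_succ_self n, h1, h2, h2 ▸ hb, t, e', h3⟩

end Run

/-- The event that the collapsed run has the prefix `ρ`. -/
def prefixEv (M : MDP S A) (C E : Set S) (ρ : Hist (M.CanState C E) (CanAct S A)) :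
    Set (ℕ → Hist (S ⊕ Verdict) (A ⊕ Extremal)) := {ω | ∃ n, M.collapse C E (ω n) = ρ}

/-- The event that the collapsed run continues with the given action after `ρ`, where `τ` stands
for staying in the current end component forever. -/
def leaveEv (M : MDP S A) (C E : Set S) (ρ : Hist (M.CanState C E) (CanAct S A)) :
    CanAct S A → Set (ℕ → Hist (S ⊕ Verdict) (A ⊕ Extremal))
  | .ext s a => {ω | ∃ n u, M.collapse C E (ω n) = ρ.snoc (.ext s a) u}
  | .tau => {ω | ∃ k, ∀ n ≥ k, M.collapse C E (ω n) = ρ}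

theorem corrQuotient_iff {θ : (M.minmax C E).Policy} {υ : (M.canonical C E).Policy} :
    M.CorrQuotient C E θ υ ↔ ∀ ρ : Hist (M.CanState C E) (CanAct S A),
      ¬ (M.canonical C E).IsTerminal ρ.last → ∀ b,
        υ.prob ρ b * (Pr θ).real (M.prefixEv C E ρ) = (Pr θ).real (M.leaveEv C E ρ b) := by
  refine forall₂_congr fun ρ _ => ⟨?_, ?_⟩
  · rintro ⟨h1, h2⟩ (⟨s, a⟩ | _)
    exacts [h1 s a, h2]
  · intro h
    exact ⟨fun s a => h (.ext s a), h .tau⟩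

theorem measurableSet_prefixEv (ρ : Hist (M.CanState C E) (CanAct S A)) :
    MeasurableSet (M.prefixEv C E ρ) :=
  measurableSet_visits {g | M.collapse C E g = ρ}

theorem measurableSet_leaveEv (ρ : Hist (M.CanState C E) (CanAct S A)) (b : CanAct S A) :
    MeasurableSet (M.leaveEv C E ρ b) := by
  rcases b with ⟨s, a⟩ | _
  · exact measurableSet_visits {g | ∃ u, M.collapse C E g = ρ.snoc (.ext s a) u}
  · rw [show M.leaveEv C E ρ .tau = ⋃ k, ⋂ n, ⋂ (_ : n ≥ k),
      {ω : ℕ → Hist (S ⊕ Verdict) (A ⊕ Extremal) | ω n ∈ {g | M.collapse C E g = ρ}} by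
      ext ω; simp [leaveEv]]
    exact MeasurableSet.iUnion fun k => MeasurableSet.iInter fun n => MeasurableSet.iInter
      fun _ => measurableSet_eval_mem n _

/-- Once the collapsed run has reached `ρ`, it either stays there forever or has a unique next
transition. Hence the conditional probabilities that define a corresponding policy sum to 1. -/
theorem prob_prefixEv (θ : (M.minmax C E).Policy) (s₀ : S ⊕ Verdict)
    (ρ : Hist (M.CanState C E) (CanAct S A)) :
    PrFrom θ (.start s₀) (M.prefixEv C E ρ) =
      ∑ b, PrFrom θ (.start s₀) (M.leaveEv C E ρ b) := by
  rw [← tsum_fintype (L := .unconditional _)]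
  refine measure_eq_tsum_of_ae ?_ ?_ (measurableSet_leaveEv ρ)
  · filter_upwards [ae_isRun θ (.start s₀)] with ω hr
    have hch := isChain_collapse (M := M) (C := C) (E := E) hr.isChain
    constructor
    · rintro ⟨n, hn⟩
      by_cases hst : ∀ m ≥ n, M.collapse C E (ω m) = ρ
      · exact ⟨.tau, n, hst⟩
      · push Not at hst
        obtain ⟨m, hm, hne⟩ := hst
        have hp := hch.pre hm
        simp only [hn] at hp
        -- The collapsed run has moved beyond `ρ`, so it visited an immediate extension of `ρ`. Its
        -- new action is not `τ`, because collapsed histories are `τ`-free.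
        rcases hp.eq_or_snoc with e | ⟨b, u, hp'⟩
        · exact absurd e.symm hne
        · have h0 := hch.pre (Nat.zero_le n)
          simp only [hn] at h0
          obtain ⟨k, _, hk⟩ := hch.exists_eq (h0.trans (pre_snoc_self ρ b u)) hp'
          rcases b with ⟨s, a⟩ | _
          · exact ⟨.ext s a, k, u, hk⟩
          · have := tauFree_collapse (M := M) (C := C) (E := E) (ω k)
            rw [show M.collapse C E (ω k) = _ from hk] at this
            exact this.elim
    · rintro ⟨⟨s, a⟩ | _, h⟩
      · obtain ⟨n, u, hn⟩ := h
        obtain ⟨m, _, hm, _⟩ := hr.exists_leave hn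
        exact ⟨m, hm⟩
      · obtain ⟨k, hk⟩ := h
        exact ⟨k, hk k le_rfl⟩
  · filter_upwards [ae_isRun θ (.start s₀)] with ω hr
    have hch := isChain_collapse (M := M) (C := C) (E := E) hr.isChain
    have hst : ∀ s a, ω ∈ M.leaveEv C E ρ (.ext s a) → ω ∉ M.leaveEv C E ρ .tau := by
      rintro s a ⟨n, u, hn⟩ ⟨k, hk⟩
      have h1 := hch.pre (le_max_left n k)
      simp only [hn, hk _ (le_max_right n k)] at h1
      exact not_snoc_pre _ _ _ h1
    rintro (⟨s, a⟩ | _) (⟨s', a'⟩ | _) h h'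
    · obtain ⟨n, u, hn⟩ := h
      obtain ⟨n', u', hn'⟩ := h'
      have h1 := hch.pre (le_max_left n n')
      have h2 := hch.pre (le_max_right n n')
      simp only [hn] at h1
      simp only [hn'] at h2
      exact (snoc_pre_unique h1 h2).1
    · exact absurd h' (hst _ _ h)
    · exact absurd h (hst _ _ h')
    · rfl

/-- For `τ`: a run that stays at a nonterminal class still takes steps, and these are internal, so
the class is an end component. -/
theorem prob_leaveEv_eq_zero (θ : (M.minmax C E).Policy) (s₀ : S ⊕ Verdict)
    {ρ : Hist (M.CanState C E) (CanAct S A)} (hρ : ¬ (M.canonical C E).IsTerminal ρ.last)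
    {b : CanAct S A} (hb : ¬ (M.canonical C E).Enabled ρ.last b) :
    PrFrom θ (.start s₀) (M.leaveEv C E ρ b) = 0 := by
  refine measure_mono_null ?_ (ae_isRun θ (.start s₀))
  intro ω hω hr
  apply hb
  have hp := hr.isPath trivial
  rcases b with ⟨s, a⟩ | _
  · obtain ⟨n, u, hn⟩ := hω
    obtain ⟨m, _, hm, hs, hi, t, e, _⟩ := hr.exists_leave hn
    rw [canonical_enabled_ext, ← hs, ← hm, (hp m).collapse_last]
    exact ⟨rfl, hs ▸ hi, (hr.enabled e).2.1⟩
  · obtain ⟨k, hk⟩ := hω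
    have h1 := hk k le_rfl
    have h2 := (hp k).collapse_last
    rw [h1] at h2
    rw [h2, canonical_terminal_proj] at hρ
    obtain ⟨a, t, e, _⟩ := hr.snoc_of_ne hρ
    have h3 := hk (k + 1) (Nat.le_succ k)
    rw [canonical_enabled_tau]
    by_cases ha : (M.minmax C E).Internal (ω k).last a
    · exact ⟨_, ha.inMEC, h2.symm⟩
    · rw [e, collapse_snoc_of_not_internal ha, h1] at h3
      exact absurd h3.symm (ne_snoc _ _ _)

theorem prob_leaveEv_le (θ : (M.minmax C E).Policy) (s₀ : S ⊕ Verdict)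
    (ρ : Hist (M.CanState C E) (CanAct S A)) (b : CanAct S A) :
    PrFrom θ (.start s₀) (M.leaveEv C E ρ b) ≤ PrFrom θ (.start s₀) (M.prefixEv C E ρ) := by
  rw [prob_prefixEv]
  exact Finset.single_le_sum (f := fun b => PrFrom θ (.start s₀) (M.leaveEv C E ρ b))
    (fun _ _ => zero_le) (Finset.mem_univ b)

/-- Conditional probabilities where the prefix has positive probability, an arbitrary policy
elsewhere. -/
theorem exists_corrQuotient_of_policy (θ : (M.minmax C E).Policy) :
    ∃ υ : (M.canonical C E).Policy, M.CorrQuotient C E θ υ := by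
  obtain ⟨τ⟩ : Nonempty (M.canonical C E).Policy := inferInstance
  obtain ⟨υ, hυ⟩ := exists_policy_of_forall (M := M.canonical C E) (Q := fun ρ p =>
    ¬ (M.canonical C E).IsTerminal ρ.last → ∀ b,
      p b * (Pr θ).real (M.prefixEv C E ρ) = (Pr θ).real (M.leaveEv C E ρ b)) (fun ρ => by
    by_cases h0 : (Pr θ).real (M.prefixEv C E ρ) = 0
    · refine ⟨τ.prob ρ, fun _ b => ?_, τ.valid ρ⟩
      rw [h0, mul_zero]
      refine le_antisymm measureReal_nonneg (le_of_le_of_eq ?_ h0)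
      exact ENNReal.toReal_mono (measure_ne_top _ _) (prob_leaveEv_le θ _ ρ b)
    · refine ⟨fun b => (Pr θ).real (M.leaveEv C E ρ b) / (Pr θ).real (M.prefixEv C E ρ),
        fun _ b => div_mul_cancel₀ _ h0, fun hρ => ⟨fun b => by positivity, ?_, fun b hb => ?_⟩⟩
      · rw [← Finset.sum_div, div_eq_one_iff_eq h0]
        simp only [measureReal_def, Pr]
        rw [prob_prefixEv, ENNReal.toReal_sum fun b _ => measure_ne_top _ _]
      · simp only [measureReal_def, Pr]
        rw [prob_leaveEv_eq_zero θ _ hρ hb]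
        simp)
  exact ⟨υ, corrQuotient_iff.2 hυ⟩

/-- A run leaves `ρ` by `(s, a)` at one history `h` at most, which has collapse `ρ` and ends in `s`.
Summing over `h` gives the common factor. Given the choice of `a`, the successor is drawn from `P s
a` whatever `h` was, and the successors projecting to `u` add up to the canonical transition
probability. -/
theorem prob_leave_formula (θ : (M.minmax C E).Policy) (s₀ : S ⊕ Verdict)
    {ρ : Hist (M.CanState C E) (CanAct S A)} {s : S ⊕ Verdict} {a : A ⊕ Extremal}
    (hen : (M.canonical C E).Enabled ρ.last (.ext s a)) :
    PrFrom θ (.start s₀) (M.leaveEv C E ρ (.ext s a)) =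
      (∑' h : {h | M.collapse C E h = ρ ∧ h.last = s},
        wt θ (.start s₀) h * ENNReal.ofReal (θ.prob h a)) ∧
    ∀ u, PrFrom θ (.start s₀) (M.prefixEv C E (ρ.snoc (.ext s a) u)) =
      (∑' h : {h | M.collapse C E h = ρ ∧ h.last = s},
        wt θ (.start s₀) h * ENNReal.ofReal (θ.prob h a)) *
        ENNReal.ofReal ((M.canonical C E).P ρ.last (.ext s a) u) := by
  classical
  obtain ⟨hs, hi, ha⟩ := canonical_enabled_ext.1 hen
  let H : Set (Hist (S ⊕ Verdict) (A ⊕ Extremal)) := {h | M.collapse C E h = ρ ∧ h.last = s}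
  let V : S ⊕ Verdict → Set (ℕ → Hist (S ⊕ Verdict) (A ⊕ Extremal)) := fun t =>
    {ω | ∃ n, ω n ∈ (fun h : Hist (S ⊕ Verdict) (A ⊕ Extremal) => h.snoc a t) '' H}
  have hVm : ∀ t, MeasurableSet (V t) := fun t => measurableSet_visits _
  have hcol : ∀ h ∈ H, ∀ t, M.collapse C E (h.snoc a t) = ρ.snoc (.ext s a) (M.proj C E t) := by
    rintro h ⟨h1, h2⟩ t
    rw [collapse_snoc_of_not_internal (h2 ▸ hi), h1, h2]
  have huniq : ∀ ω, IsRun θ (.start s₀) ω → ∀ h ∈ H, ∀ h' ∈ H, ∀ t t' n n',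
      ω n = h.snoc a t → ω n' = h'.snoc a t' → h.snoc a t = h'.snoc a t' := by
    intro ω hr h hh h' hh' t t' n n' e e'
    -- After leaving `ρ`, the collapsed history is strictly longer and cannot return to `ρ`.
    have key : ∀ h ∈ H, ∀ h' ∈ H, ∀ t t', (h.snoc a t).Pre (h'.snoc a t') →
        h.snoc a t = h'.snoc a t' := by
      intro h hh h' hh' t t' hp
      rcases hp with e | hp
      · exact e
      · exfalso
        have := pre_collapse (M := M) (C := C) (E := E) hp
        rw [hcol h hh, hh'.1] at this
        exact not_snoc_pre _ _ _ this
    have ht := hr.isChain.total n n'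
    rw [e, e'] at ht
    exact ht.elim (key h hh h' hh' t t') fun H => (key h' hh' h hh t' t H).symm
  have hV : ∀ t, PrFrom θ (.start s₀) (V t) =
      (∑' h : H, wt θ (.start s₀) h * ENNReal.ofReal (θ.prob h a)) *
        ENNReal.ofReal ((M.minmax C E).P s a t) := by
    intro t
    have h1 := PrFrom_visits θ (.start s₀)
      ((fun h : Hist (S ⊕ Verdict) (A ⊕ Extremal) => h.snoc a t) '' H) (by
        rintro ω hr n m ⟨h, hh, e⟩ ⟨h', hh', e'⟩
        rw [← e, ← e']
        exact huniq ω hr h hh h' hh' t t n m e.symm e'.symm)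
    refine h1.trans ?_
    rw [tsum_image (fun g => wt θ (.start s₀) g)
      (fun h _ h' _ e => by simpa using e : Set.InjOn _ H), ← ENNReal.tsum_mul_right]
    refine tsum_congr fun h => ?_
    rw [wt_start_snoc, pw_eq, mul_assoc, h.2.2]
  have hdisj : ∀ᵐ ω ∂PrFrom θ (.start s₀), ∀ t t', ω ∈ V t → ω ∈ V t' → t = t' := by
    filter_upwards [ae_isRun θ (.start s₀)] with ω hr
    rintro t t' ⟨n, h, hh, e⟩ ⟨n', h', hh', e'⟩
    have := huniq ω hr h hh h' hh' t t' n n' e.symm e'.symm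
    simp only [Hist.snoc.injEq, true_and] at this
    exact this.2
  have h1 : PrFrom θ (.start s₀) (M.leaveEv C E ρ (.ext s a)) =
      ∑' t, PrFrom θ (.start s₀) (V t) := by
    refine measure_eq_tsum_of_ae ?_ hdisj hVm
    filter_upwards [ae_isRun θ (.start s₀)] with ω hr
    constructor
    · rintro ⟨n, u, hn⟩
      obtain ⟨m, _, hm, hs, _, t, e, _⟩ := hr.exists_leave hn
      exact ⟨t, m + 1, ω m, ⟨hm, hs⟩, e.symm⟩
    · rintro ⟨t, n, h, hh, e⟩
      exact ⟨n, _, by rw [← e]; exact hcol h hh t⟩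
  have h2 : ∀ u, PrFrom θ (.start s₀) (M.prefixEv C E (ρ.snoc (.ext s a) u)) =
      ∑' t, PrFrom θ (.start s₀) {ω | M.proj C E t = u ∧ ω ∈ V t} := by
    intro u
    refine measure_eq_tsum_of_ae ?_ ?_ fun t => (MeasurableSet.const _).inter (hVm t)
    · filter_upwards [ae_isRun θ (.start s₀)] with ω hr
      constructor
      · rintro ⟨n, hn⟩
        obtain ⟨m, _, hm, hs, _, t, e, ht⟩ := hr.exists_leave hn
        exact ⟨t, ht, m + 1, ω m, ⟨hm, hs⟩, e.symm⟩
      · rintro ⟨t, rfl, n, h, hh, e⟩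
        exact ⟨n, by rw [← e]; exact hcol h hh t⟩
    · filter_upwards [hdisj] with ω hω t t' h h'
      exact hω t t' h.2 h'.2
  have h3 : ∀ u t, PrFrom θ (.start s₀) {ω | M.proj C E t = u ∧ ω ∈ V t} =
      (∑' h : H, wt θ (.start s₀) h * ENNReal.ofReal (θ.prob h a)) *
        ENNReal.ofReal (if M.proj C E t = u then (M.minmax C E).P s a t else 0) := by
    intro u t
    by_cases ht : M.proj C E t = u
    · simp only [ht, true_and, if_true]
      exact hV t
    · simp [ht]
  refine ⟨?_, fun u => ?_⟩
  · rw [h1]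
    simp only [hV, tsum_fintype, ← Finset.mul_sum]
    rw [← ENNReal.ofReal_sum_of_nonneg fun t _ => (M.minmax C E).P_nonneg _ _ _,
      show ∑ t, (M.minmax C E).P s a t = 1 from ha, ENNReal.ofReal_one, mul_one]
  · rw [h2]
    simp only [h3, tsum_fintype, ← Finset.mul_sum]
    rw [← ENNReal.ofReal_sum_of_nonneg, canonical_P_ext, if_pos ⟨hs, hi⟩]
    intro t _
    split_ifs
    exacts [(M.minmax C E).P_nonneg _ _ _, le_rfl]

/-- The probability of leaving by `(s, a)` to `u` is the one of leaving by `(s, a)` times the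
transition probability. -/
theorem prob_prefixEv_snoc (θ : (M.minmax C E).Policy) (s₀ : S ⊕ Verdict)
    {ρ : Hist (M.CanState C E) (CanAct S A)} (hρ : ¬ (M.canonical C E).IsTerminal ρ.last)
    (s : S ⊕ Verdict) (a : A ⊕ Extremal) (u : M.CanState C E) :
    PrFrom θ (.start s₀) (M.prefixEv C E (ρ.snoc (.ext s a) u)) =
      PrFrom θ (.start s₀) (M.leaveEv C E ρ (.ext s a)) *
        ENNReal.ofReal ((M.canonical C E).P ρ.last (.ext s a) u) := by
  by_cases hen : (M.canonical C E).Enabled ρ.last (.ext s a)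
  swap
  · have h0 := prob_leaveEv_eq_zero θ s₀ hρ hen
    rw [h0, zero_mul]
    refine measure_mono_null ?_ h0
    rintro ω ⟨n, hn⟩
    exact ⟨n, u, hn⟩
  rw [(prob_leave_formula θ s₀ hen).1, (prob_leave_formula θ s₀ hen).2]

end MDP

namespace MDP

open Hist

/-- The minimum principle: an average of values at least `m` can equal `m` only if all values of
positive weight do. -/
theorem eq_of_average_le {ι : Type*} [Fintype ι] {w f : ι → ENNReal} {m : ENNReal} (hm : m ≠ ⊤)
    (hw : ∑ i, w i = 1) (hf : ∀ i, w i ≠ 0 → m ≤ f i) (h : ∑ i, w i * f i ≤ m) {v : ι}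
    (hv : w v ≠ 0) : f v = m := by
  classical
  refine le_antisymm ?_ (hf v hv)
  by_contra! hlt
  have hwt : ∀ i, w i ≠ ⊤ := fun i => ne_top_of_le_ne_top ENNReal.one_ne_top
    (hw ▸ Finset.single_le_sum (f := w) (fun _ _ => zero_le) (Finset.mem_univ i))
  have h1 : ∀ i, w i * m ≤ w i * f i := fun i => by
    by_cases hi : w i = 0
    · simp [hi]
    · gcongr
      exact hf i hi
  have h2 : ∑ i, w i * m < ∑ i, w i * f i := by
    rw [← Finset.add_sum_erase _ _ (Finset.mem_univ v), ← Finset.add_sum_erase _ (fun i => w i * f i)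
      (Finset.mem_univ v)]
    refine ENNReal.add_lt_add_of_lt_of_le ?_ ?_ (Finset.sum_le_sum fun i _ => h1 i)
    · exact ENNReal.sum_ne_top.2 fun i _ => ENNReal.mul_ne_top (hwt i) hm
    · exact (ENNReal.mul_lt_mul_iff_right hv (hwt v)).2 hlt
  rw [← Finset.sum_mul, hw, one_mul] at h2
  exact absurd h2 (not_lt.2 h)

/-! ### The uniform walk inside maximal end components -/

section Walk

variable {S A : Type*} [Fintype S] [Fintype A] {M : MDP S A}

open scoped Classical in
/-- The uniform distribution over the actions that belong to a maximal end component. -/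
noncomputable def unif (M : MDP S A) (s : S) (a : A) : ℝ :=
  if M.Internal s a then ((Finset.univ.filter fun b => M.Internal s b).card : ℝ)⁻¹ else 0

theorem unif_nonneg (M : MDP S A) (s : S) (a : A) : 0 ≤ M.unif s a := by
  unfold unif
  split_ifs
  exacts [by positivity, le_rfl]

theorem unif_pos {s : S} {a : A} (h : M.Internal s a) : 0 < M.unif s a := by
  classical
  rw [unif, if_pos h]
  have : 0 < (Finset.univ.filter fun b => M.Internal s b).card :=
    Finset.card_pos.2 ⟨a, by simp [h]⟩
  positivity

theorem unif_of_not_internal {s : S} {a : A} (h : ¬ M.Internal s a) : M.unif s a = 0 := if_neg h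

theorem sum_unif {s : S} (h : M.InMEC s) : ∑ a, M.unif s a = 1 := by
  classical
  obtain ⟨a, ha⟩ := h.exists_internal
  have : (Finset.univ.filter fun b => M.Internal s b).card ≠ 0 :=
    Finset.card_ne_zero.2 ⟨a, by simp [ha]⟩
  simp only [unif]
  rw [← Finset.sum_filter, Finset.sum_const, nsmul_eq_mul, mul_inv_cancel₀]
  exact_mod_cast this

open scoped Classical in
/-- The MDP restricted to the state-action pairs of maximal end components, where `s₀` is made
terminal. -/
noncomputable def walk (M : MDP S A) (s₀ : S) : MDP S A where
  P x a t := if x ≠ s₀ ∧ M.Internal x a then M.P x a t else 0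
  P_nonneg x a t := by
    split_ifs
    exacts [M.P_nonneg _ _ _, le_rfl]
  P_sum x a := by
    split_ifs with h
    exacts [M.P_sum x a, Or.inl Finset.sum_const_zero]
  init := s₀

open scoped Classical in
theorem walk_P (M : MDP S A) (s₀ x : S) (a : A) (t : S) :
    (M.walk s₀).P x a t = if x ≠ s₀ ∧ M.Internal x a then M.P x a t else 0 := rfl

theorem walk_enabled {s₀ x : S} {a : A} :
    (M.walk s₀).Enabled x a ↔ x ≠ s₀ ∧ M.Internal x a := by
  simp only [Enabled, walk_P]
  constructor
  · intro h
    by_contra hc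
    simp [hc] at h
  · intro h
    simp only [h, ne_eq, not_false_eq_true, true_and, if_true]
    exact h.2.enabled

theorem walk_terminal {s₀ x : S} : (M.walk s₀).IsTerminal x ↔ x = s₀ ∨ ¬ M.InMEC x := by
  constructor
  · intro h
    by_contra! hc
    obtain ⟨a, ha⟩ := hc.2.exists_internal
    exact h a (walk_enabled.2 ⟨hc.1, ha⟩)
  · rintro h a ha
    rw [walk_enabled] at ha
    exact h.elim ha.1 fun h => h ha.2.inMEC

/-- The policy of the uniform walk. -/
noncomputable def walkPolicy (M : MDP S A) (s₀ : S) : (M.walk s₀).Policy where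
  prob h a := M.unif h.last a
  nonneg h _ a := M.unif_nonneg _ _
  sum_eq_one h ht := by
    rw [walk_terminal] at ht
    push Not at ht
    exact sum_unif ht.2
  enabled h ht a ha := by
    rw [walk_terminal] at ht
    push Not at ht
    refine unif_of_not_internal fun hi => ha (walk_enabled.2 ⟨ht.1, hi⟩)

/-- Inside a maximal end component, the uniform walk reaches every state almost surely. -/
theorem walkPolicy_hits (M : MDP S A) {s₀ : S} {g : Hist S A} (hg : M.mecSetoid g.last s₀) :
    PrFrom (M.walkPolicy s₀) g (ev {s₀}) = 1 := by
  classical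
  have hT : ∀ e ∈ ({s₀} : Set S), (M.walk s₀).IsTerminal e := by
    rintro e rfl
    exact walk_terminal.2 (Or.inl rfl)
  -- The infimum over histories makes a function of the state, so that it need not be shown that the
  -- hitting probability of this memoryless walk is independent of the history.
  let f : S → ENNReal := fun t =>
    ⨅ h : {h : Hist S A // h.last = t}, PrFrom (M.walkPolicy s₀) h.1 (ev {s₀})
  have hf : ∀ h : Hist S A, f h.last ≤ PrFrom (M.walkPolicy s₀) h (ev {s₀}) := fun h =>
    iInf_le_of_le (⟨h, rfl⟩ : {h' : Hist S A // h'.last = h.last}) le_rfl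
  have hf0 : 1 ≤ f s₀ := by
    refine le_iInf fun ⟨h, hh⟩ => ?_
    rw [PrFrom_ev_eq_iSup _ hT]
    refine le_iSup_of_le 0 ?_
    rw [reachAt_zero, if_pos (by exact hh)]
  let K : Set S := {t | M.mecSetoid t s₀}
  -- Minimum principle: the minimum over the class spreads along internal transitions, all of which
  -- the uniform walk takes with positive probability. Connectedness carries it to `s₀`, where the
  -- value is 1.
  obtain ⟨t₀, ht₀, hmin⟩ := Set.exists_min_image K f (Set.toFinite K) ⟨s₀, M.mecSetoid.refl s₀⟩
  have hstep : ∀ t ∈ K, t ≠ s₀ → f t = f t₀ → ∀ a v, M.Internal t a → 0 < M.P t a v →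
      f v = f t₀ := by
    intro t ht hne hft a v ha hv
    have hnt : ¬ (M.walk s₀).IsTerminal t := by
      rw [walk_terminal]; push Not; exact ⟨hne, ha.inMEC⟩
    let w : A × S → ENNReal := fun p =>
      ENNReal.ofReal (M.unif t p.1 * (M.walk s₀).P t p.1 p.2)
    have hsum : ∀ F : S → ENNReal, ∑ p, w p * F p.2 =
        ∑ b, ∑ u, ENNReal.ofReal (M.unif t b * (M.walk s₀).P t b u) * F u := fun F =>
      Fintype.sum_prod_type _
    have h1 : ∑ p, w p = 1 := by
      have e1 := hsum fun _ => 1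
      simp only [mul_one] at e1
      rw [e1]
      have e2 := stepOp_of_not_terminal (M.walkPolicy s₀) (h := .start t) hnt fun _ => 1
      simp only [stepOp, lintegral_one, measure_univ, mul_one] at e2
      exact e2.symm
    have h2 : ∑ p, w p * f p.2 ≤ f t₀ := by
      rw [← hft, hsum]
      refine le_iInf fun ⟨h, hh⟩ => ?_
      subst hh
      rw [PrFrom_ev_eq_stepOp _ hT, stepOp_of_not_terminal _ hnt]
      refine Finset.sum_le_sum fun b _ => Finset.sum_le_sum fun u _ => ?_
      exact mul_le_mul_right (hf (h.snoc b u)) _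
    have hpos : ∀ p : A × S, w p ≠ 0 → M.Internal t p.1 ∧ 0 < M.P t p.1 p.2 := by
      intro p hp
      simp only [w, walk_P] at hp
      by_cases hi : t ≠ s₀ ∧ M.Internal t p.1
      · rw [if_pos hi] at hp
        refine ⟨hi.2, (M.P_nonneg _ _ _).lt_of_ne fun e => hp ?_⟩
        rw [← e, mul_zero, ENNReal.ofReal_zero]
      · simp [hi] at hp
    have hfin : f t₀ ≠ ⊤ := ne_top_of_le_ne_top ENNReal.one_ne_top
      ((hmin s₀ (M.mecSetoid.refl s₀)).trans ((hf (.start s₀)).trans prob_le_one))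
    refine eq_of_average_le (f := fun p : A × S => f p.2) (v := (a, v)) hfin h1
      (fun p hp => hmin _ ?_) h2 ?_
    · exact M.mecSetoid.trans (M.mecSetoid.symm (Or.inr ((hpos p hp).1.equiv (hpos p hp).2))) ht
    · simp only [w, walk_P, if_pos (show t ≠ s₀ ∧ M.Internal t a from ⟨hne, ha⟩)]
      exact (ENNReal.ofReal_pos.2 (mul_pos (unif_pos ha) hv)).ne'
  have hle : 1 ≤ f t₀ := by
    rcases ht₀ with rfl | ⟨B, hB, h1, h2⟩
    · exact hf0
    -- Minimality cannot be pushed past `s₀`, which is terminal for the walk; but a path passing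
    -- through `s₀` has by then reached its goal. Hence the disjunction.
    · have key : ∀ v, Relation.ReflTransGen (fun u v => ∃ a, (u, a) ∈ B ∧ 0 < M.P u a v) t₀ v →
          f s₀ = f t₀ ∨ (M.mecSetoid v s₀ ∧ f v = f t₀) := by
        intro v hv
        induction hv with
        | refl => exact Or.inr ⟨Or.inr ⟨B, hB, h1, h2⟩, rfl⟩
        | tail _ hstep' ih =>
          obtain ⟨a, haB, hP⟩ := hstep'
          rcases ih with h | ⟨hK, hfu⟩
          · exact Or.inl h
          · rename_i u v _
            by_cases hu : u = s₀
            · exact Or.inl (hu ▸ hfu)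
            · have hi : M.Internal u a := ⟨B, hB, haB⟩
              exact Or.inr ⟨M.mecSetoid.trans (M.mecSetoid.symm (Or.inr (hi.equiv hP))) hK,
                hstep u hK hu hfu a v hi hP⟩
      rcases key s₀ (hB.prop.connected _ h1 _ h2) with h | h
      · rwa [h] at hf0
      · rw [← h.2]; exact hf0
  exact le_antisymm prob_le_one (hle.trans ((hmin _ hg).trans (hf g)))

end Walk

end MDP

namespace MDP

open Hist

variable {S A : Type*} [Fintype S] [Fintype A] {M : MDP S A} {C E : Set S}

/-! ### From policies of the canonical MDP to policies of the first step -/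

theorem sum_canAct {N : Type*} [AddCommMonoid N] (f : CanAct S A → N) :
    ∑ b, f b = f .tau + ∑ s, ∑ a, f (.ext s a) := by
  rw [Fintype.sum_equiv CanAct.equivOption f (fun o => f (CanAct.equivOption.symm o))
    fun b => by simp, Fintype.sum_option, Fintype.sum_prod_type]
  rfl

open scoped Classical in
/-- The prefix of a finite path at which the current collapsed state was entered. -/
noncomputable def entry (M : MDP S A) (C E : Set S) :
    Hist (S ⊕ Verdict) (A ⊕ Extremal) → Hist (S ⊕ Verdict) (A ⊕ Extremal)
  | .start s => .start s
  | .snoc h a t => if (M.minmax C E).Internal h.last a then entry M C E h else .snoc h a t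

open scoped Classical in
/-- The states visited since the current collapsed state was entered, without the last one. -/
noncomputable def vis (M : MDP S A) (C E : Set S) :
    Hist (S ⊕ Verdict) (A ⊕ Extremal) → Set (S ⊕ Verdict)
  | .start _ => ∅
  | .snoc h a _ => if (M.minmax C E).Internal h.last a then insert h.last (vis M C E h) else ∅

theorem entry_pre (h : Hist (S ⊕ Verdict) (A ⊕ Extremal)) : (M.entry C E h).Pre h := by
  induction h with
  | start s => exact Pre.refl _
  | snoc h a t ih =>
    rw [entry]
    split_ifs
    exacts [ih.snoc a t, Pre.refl _]

theorem entry_entry (h : Hist (S ⊕ Verdict) (A ⊕ Extremal)) :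
    M.entry C E (M.entry C E h) = M.entry C E h := by
  induction h with
  | start s => rfl
  | snoc h a t ih =>
    by_cases ha : (M.minmax C E).Internal h.last a
    · simpa [entry, ha] using ih
    · simp [entry, ha]

theorem collapse_entry (h : Hist (S ⊕ Verdict) (A ⊕ Extremal)) :
    M.collapse C E (M.entry C E h) = M.collapse C E h := by
  induction h with
  | start s => rfl
  | snoc h a t ih =>
    by_cases ha : (M.minmax C E).Internal h.last a
    · simpa [entry, collapse, ha] using ih
    · simp [entry, ha]

theorem not_internal_of_entry {h : Hist (S ⊕ Verdict) (A ⊕ Extremal)} {a : A ⊕ Extremal}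
    {t : S ⊕ Verdict} (he : M.entry C E (h.snoc a t) = h.snoc a t) :
    ¬ (M.minmax C E).Internal h.last a := by
  intro hi
  simp only [entry, hi, if_true] at he
  have := entry_pre (M := M) (C := C) (E := E) h
  rw [he] at this
  exact not_snoc_pre _ _ _ this

theorem vis_of_entry {h : Hist (S ⊕ Verdict) (A ⊕ Extremal)} (he : M.entry C E h = h) :
    M.vis C E h = ∅ := by
  cases h with
  | start s => rfl
  | snoc h a t => simp [vis, not_internal_of_entry he]

/-- Equal collapsed histories mean that only internal steps lie between `g` and `h`. -/
theorem entry_eq_of_pre {g h : Hist (S ⊕ Verdict) (A ⊕ Extremal)} (H : g.Pre h)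
    (e : M.collapse C E g = M.collapse C E h) : M.entry C E g = M.entry C E h := by
  induction h with
  | start s => cases H; rfl
  | snoc h a t ih =>
    rcases H with rfl | H
    · rfl
    · by_cases ha : (M.minmax C E).Internal h.last a
      · rw [collapse_snoc_of_internal ha] at e
        rw [ih H e]
        simp [entry, ha]
      · rw [collapse_snoc_of_not_internal ha] at e
        have := pre_collapse (M := M) (C := C) (E := E) H
        rw [e] at this
        exact absurd this (not_snoc_pre _ _ _)

open scoped Classical in
/-- The probability that `υ` chooses `τ` or leaves from a state that is not in `V`. -/
noncomputable def remaining (υ : (M.canonical C E).Policy)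
    (ρ : Hist (M.CanState C E) (CanAct S A)) (V : Set (S ⊕ Verdict)) : ℝ :=
  υ.prob ρ .tau + ∑ s, if s ∈ V then 0 else ∑ a, υ.prob ρ (.ext s a)

theorem remaining_empty (υ : (M.canonical C E).Policy) {ρ : Hist (M.CanState C E) (CanAct S A)}
    (hρ : ¬ (M.canonical C E).IsTerminal ρ.last) : remaining υ ρ ∅ = 1 := by
  have := υ.sum_eq_one ρ hρ
  rw [sum_canAct] at this
  simpa [remaining] using this

theorem remaining_nonneg (υ : (M.canonical C E).Policy) {ρ : Hist (M.CanState C E) (CanAct S A)}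
    (hρ : ¬ (M.canonical C E).IsTerminal ρ.last) (V : Set (S ⊕ Verdict)) :
    0 ≤ remaining υ ρ V := by
  refine add_nonneg (υ.nonneg ρ hρ _) (Finset.sum_nonneg fun s _ => ?_)
  split_ifs
  exacts [le_rfl, Finset.sum_nonneg fun a _ => υ.nonneg ρ hρ _]

open scoped Classical in
theorem remaining_eq_add (υ : (M.canonical C E).Policy) (ρ : Hist (M.CanState C E) (CanAct S A))
    (V : Set (S ⊕ Verdict)) (s : S ⊕ Verdict) : remaining υ ρ V =
      remaining υ ρ (insert s V) + ∑ a, if s ∈ V then 0 else υ.prob ρ (.ext s a) := by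
  have : (∑ a, if s ∈ V then 0 else υ.prob ρ (.ext s a)) =
      ∑ s', if s' = s then (if s ∈ V then 0 else ∑ a, υ.prob ρ (.ext s a)) else 0 := by
    rw [Finset.sum_ite_eq' Finset.univ s, if_pos (Finset.mem_univ s)]
    split_ifs <;> simp
  rw [this, remaining, remaining, add_assoc, ← Finset.sum_add_distrib]
  congr 1
  refine Finset.sum_congr rfl fun s' _ => ?_
  by_cases h : s' = s
  · subst h; simp
  · simp [h]

open scoped Classical in
/-- The probability with which `υ` leaves by `a`; it is offered at the first visit only. -/
noncomputable def exitProb (υ : (M.canonical C E).Policy)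
    (h : Hist (S ⊕ Verdict) (A ⊕ Extremal)) (a : A ⊕ Extremal) : ℝ :=
  if h.last ∈ M.vis C E h then 0 else υ.prob (M.collapse C E h) (.ext h.last a)

open scoped Classical in
/-- The unnormalized probability of choosing `a` in the policy that walks uniformly and leaves
according to `υ`. -/
noncomputable def walkExit (υ : (M.canonical C E).Policy)
    (h : Hist (S ⊕ Verdict) (A ⊕ Extremal)) (a : A ⊕ Extremal) : ℝ :=
  if (M.minmax C E).Internal h.last a then (M.minmax C E).unif h.last a *
    remaining υ (M.collapse C E h) (insert h.last (M.vis C E h))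
  else exitProb υ h a

/-- The policy `θ` of the first step walks uniformly inside end components and leaves them
according to `υ`. -/
def IsWalkExit (υ : (M.canonical C E).Policy) (θ : (M.minmax C E).Policy) : Prop :=
  ∀ h, ¬ (M.minmax C E).IsTerminal h.last → (M.collapse C E h).last = M.proj C E h.last →
    remaining υ (M.collapse C E h) (M.vis C E h) ≠ 0 → ∀ a,
      θ.prob h a = walkExit υ h a / remaining υ (M.collapse C E h) (M.vis C E h)

theorem exitProb_nonneg (υ : (M.canonical C E).Policy) {h : Hist (S ⊕ Verdict) (A ⊕ Extremal)}
    (hρ : ¬ (M.canonical C E).IsTerminal (M.collapse C E h).last) (a : A ⊕ Extremal) :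
    0 ≤ exitProb υ h a := by
  unfold exitProb
  split_ifs
  exacts [le_rfl, υ.nonneg _ hρ _]

theorem walkExit_nonneg (υ : (M.canonical C E).Policy) {h : Hist (S ⊕ Verdict) (A ⊕ Extremal)}
    (hρ : ¬ (M.canonical C E).IsTerminal (M.collapse C E h).last) (a : A ⊕ Extremal) :
    0 ≤ walkExit υ h a := by
  unfold walkExit
  split_ifs
  exacts [mul_nonneg (unif_nonneg _ _ _) (remaining_nonneg υ hρ _), exitProb_nonneg υ hρ a]

theorem remaining_eq_add_exitProb (υ : (M.canonical C E).Policy)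
    (h : Hist (S ⊕ Verdict) (A ⊕ Extremal)) :
    remaining υ (M.collapse C E h) (M.vis C E h) =
      remaining υ (M.collapse C E h) (insert h.last (M.vis C E h)) + ∑ a, exitProb υ h a :=
  remaining_eq_add υ _ _ _

theorem exitProb_of_not_enabled (υ : (M.canonical C E).Policy)
    {h : Hist (S ⊕ Verdict) (A ⊕ Extremal)}
    (hρ : ¬ (M.canonical C E).IsTerminal (M.collapse C E h).last) {a : A ⊕ Extremal}
    (ha : ¬ (M.canonical C E).Enabled (M.collapse C E h).last (.ext h.last a)) :
    exitProb υ h a = 0 := by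
  unfold exitProb
  split_ifs
  exacts [rfl, υ.enabled _ hρ _ ha]

/-- The remaining mass splits into the exits offered now and the mass that walks on. Outside all end
components no walking is possible, but there the class is a single state: it has neither `τ` nor
exits from other states, so nothing is left to walk on. -/
theorem sum_walkExit (υ : (M.canonical C E).Policy) {h : Hist (S ⊕ Verdict) (A ⊕ Extremal)}
    (ht : ¬ (M.minmax C E).IsTerminal h.last)
    (hl : (M.collapse C E h).last = M.proj C E h.last) :
    ∑ a, walkExit υ h a = remaining υ (M.collapse C E h) (M.vis C E h) := by
  classical
  have hρ : ¬ (M.canonical C E).IsTerminal (M.collapse C E h).last := by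
    rwa [hl, canonical_terminal_proj]
  have e : ∀ a, walkExit υ h a = (M.minmax C E).unif h.last a *
      remaining υ (M.collapse C E h) (insert h.last (M.vis C E h)) + exitProb υ h a := by
    intro a
    unfold walkExit
    split_ifs with hi
    · rw [exitProb_of_not_enabled υ hρ, add_zero]
      rw [canonical_enabled_ext]
      exact fun h' => h'.2.1 hi
    · rw [unif_of_not_internal hi, zero_mul, zero_add]
  simp only [e]
  rw [Finset.sum_add_distrib, ← Finset.sum_mul, remaining_eq_add_exitProb]
  congr 1
  by_cases hm : (M.minmax C E).InMEC h.last
  · rw [sum_unif hm, one_mul]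
  · have hu : ∀ s, M.proj C E s = (M.collapse C E h).last → s = h.last := by
      intro s hs
      rw [hl] at hs
      rcases (proj_eq_iff ht).1 hs.symm with e | ⟨B, hB, hB', _⟩
      · exact e.symm
      · exact absurd ⟨B, hB, hB'⟩ hm
    have h0 : remaining υ (M.collapse C E h) (insert h.last (M.vis C E h)) = 0 := by
      unfold remaining
      rw [υ.enabled _ hρ, zero_add]
      · refine Finset.sum_eq_zero fun s _ => ?_
        split_ifs with hs
        · rfl
        · refine Finset.sum_eq_zero fun a _ => υ.enabled _ hρ _ fun hen => hs ?_
          exact Or.inl (hu s (canonical_enabled_ext.1 hen).1)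
      · intro hen
        obtain ⟨s, hs, e⟩ := canonical_enabled_tau.1 hen
        exact hm (hu s e ▸ hs)
    rw [h0, mul_zero]

theorem exists_isWalkExit (υ : (M.canonical C E).Policy) :
    ∃ θ : (M.minmax C E).Policy, IsWalkExit υ θ := by
  obtain ⟨τ⟩ : Nonempty (M.minmax C E).Policy := inferInstance
  refine exists_policy_of_forall (M := M.minmax C E) (Q := fun h p =>
    ¬ (M.minmax C E).IsTerminal h.last → (M.collapse C E h).last = M.proj C E h.last →
    remaining υ (M.collapse C E h) (M.vis C E h) ≠ 0 → ∀ a,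
      p a = walkExit υ h a / remaining υ (M.collapse C E h) (M.vis C E h)) fun h => ?_
  by_cases hh : (M.collapse C E h).last = M.proj C E h.last ∧
    remaining υ (M.collapse C E h) (M.vis C E h) ≠ 0
  · refine ⟨fun a => walkExit υ h a / remaining υ (M.collapse C E h) (M.vis C E h),
      fun _ _ _ _ => rfl, fun ht => ?_⟩
    have hρ : ¬ (M.canonical C E).IsTerminal (M.collapse C E h).last := by
      rwa [hh.1, canonical_terminal_proj]
    refine ⟨fun a => div_nonneg (walkExit_nonneg υ hρ a) (remaining_nonneg υ hρ _), ?_,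
      fun a ha => ?_⟩
    · rw [← Finset.sum_div, sum_walkExit υ ht hh.1, div_self hh.2]
    · change walkExit υ h a / _ = 0
      rw [walkExit, if_neg fun hi => ha hi.enabled, exitProb_of_not_enabled υ hρ, zero_div]
      rw [canonical_enabled_ext]
      exact fun h' => ha h'.2.2
  · exact ⟨τ.prob h, fun _ h1 h2 => absurd ⟨h1, h2⟩ hh, τ.valid h⟩

open scoped Classical in
/-- The weight of a finite path under the uniform walk that leaves according to `υ`, without the
normalizing factor of the current stay in a collapsed state. -/
noncomputable def walkWt (υ : (M.canonical C E).Policy) :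
    Hist (S ⊕ Verdict) (A ⊕ Extremal) → ENNReal
  | .start s => if s = .inl M.init then 1 else 0
  | .snoc h a t => walkWt υ h * ENNReal.ofReal (if (M.minmax C E).Internal h.last a then
      (M.minmax C E).unif h.last a else exitProb υ h a) *
      ENNReal.ofReal ((M.minmax C E).P h.last a t)

theorem isPath_of_walkWt_ne_zero {υ : (M.canonical C E).Policy}
    {h : Hist (S ⊕ Verdict) (A ⊕ Extremal)} (hh : walkWt υ h ≠ 0) : (M.minmax C E).IsPath h := by
  induction h with
  | start s => trivial
  | snoc h a t ih =>
    refine ⟨ih (left_ne_zero_of_mul (left_ne_zero_of_mul hh)), ?_⟩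
    exact ENNReal.ofReal_pos.1 (pos_iff_ne_zero.2 (right_ne_zero_of_mul hh))

open scoped Classical in
/-- The normalizing factor. -/
noncomputable def mass (υ : (M.canonical C E).Policy)
    (h : Hist (S ⊕ Verdict) (A ⊕ Extremal)) : ℝ :=
  if (M.minmax C E).IsTerminal h.last then 1 else remaining υ (M.collapse C E h) (M.vis C E h)

theorem mass_of_entry (υ : (M.canonical C E).Policy) {h : Hist (S ⊕ Verdict) (A ⊕ Extremal)}
    (hp : (M.minmax C E).IsPath h) (he : M.entry C E h = h) : mass υ h = 1 := by
  unfold mass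
  split_ifs with ht
  · rfl
  · rw [vis_of_entry he, remaining_empty]
    rwa [hp.collapse_last, canonical_terminal_proj]

/-- Valid even where the normalizing factor vanishes, since the nonnegative numbers `walkExit υ h a`
then sum to zero. -/
theorem IsWalkExit.mass_mul_prob {υ : (M.canonical C E).Policy} {θ : (M.minmax C E).Policy}
    (H : IsWalkExit υ θ) {h : Hist (S ⊕ Verdict) (A ⊕ Extremal)}
    (hp : (M.minmax C E).IsPath h) (ht : ¬ (M.minmax C E).IsTerminal h.last) (a : A ⊕ Extremal) :
    mass υ h * θ.prob h a = walkExit υ h a := by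
  have hρ : ¬ (M.canonical C E).IsTerminal (M.collapse C E h).last := by
    rwa [hp.collapse_last, canonical_terminal_proj]
  rw [mass, if_neg ht]
  by_cases h0 : remaining υ (M.collapse C E h) (M.vis C E h) = 0
  · have := sum_walkExit υ ht hp.collapse_last
    rw [h0, Finset.sum_eq_zero_iff_of_nonneg fun a _ => walkExit_nonneg υ hρ a] at this
    rw [h0, zero_mul, this a (Finset.mem_univ a)]
  · rw [H h ht hp.collapse_last h0, mul_div_cancel₀ _ h0]

theorem mass_nonneg (υ : (M.canonical C E).Policy) {h : Hist (S ⊕ Verdict) (A ⊕ Extremal)}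
    (hp : (M.minmax C E).IsPath h) : 0 ≤ mass υ h := by
  unfold mass
  split_ifs with ht
  · exact zero_le_one
  · refine remaining_nonneg υ ?_ _
    rwa [hp.collapse_last, canonical_terminal_proj]

/-- The normalizing factors telescope: an internal step has the factor `unif` times the new
remaining mass over the old one, and an external step cancels the current mass and restarts it at 1.
-/
theorem IsWalkExit.wt_eq {υ : (M.canonical C E).Policy} {θ : (M.minmax C E).Policy}
    (H : IsWalkExit υ θ) (h : Hist (S ⊕ Verdict) (A ⊕ Extremal)) :
    wt θ (.start (.inl M.init)) h = walkWt υ h * ENNReal.ofReal (mass υ h) := by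
  classical
  induction h with
  | start s =>
    by_cases hs : s = .inl M.init
    · simp [wt, walkWt, hs, mass_of_entry υ (h := .start (.inl M.init)) trivial rfl]
    · simp [wt, walkWt, hs]
  | snoc h a t ih =>
    rw [wt_start_snoc, pw_eq, ih]
    by_cases h0 : walkWt υ h = 0
    · simp [walkWt, h0]
    have hp := isPath_of_walkWt_ne_zero h0
    rcases ((M.minmax C E).P_nonneg h.last a t).eq_or_lt with hP | hP
    · simp [walkWt, ← hP]
    have ht : ¬ (M.minmax C E).IsTerminal h.last := fun ht => ht a (enabled_of_P_pos hP)
    have key : ENNReal.ofReal (mass υ h) * ENNReal.ofReal (θ.prob h a) =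
        ENNReal.ofReal (if (M.minmax C E).Internal h.last a then
          (M.minmax C E).unif h.last a else exitProb υ h a) *
          ENNReal.ofReal (mass υ (h.snoc a t)) := by
      rw [← ENNReal.ofReal_mul (mass_nonneg υ hp), H.mass_mul_prob hp ht, walkExit]
      split_ifs with hi
      · have ht' : ¬ (M.minmax C E).IsTerminal t := by
          rw [← canonical_terminal_proj, hi.proj_eq hP, canonical_terminal_proj]
          exact ht
        rw [mass, last_snoc, if_neg ht', collapse_snoc_of_internal hi,
          ENNReal.ofReal_mul (unif_nonneg _ _ _)]
        simp [vis, hi]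
      · rw [mass_of_entry υ (h := h.snoc a t) ⟨hp, hP⟩ (by simp [entry, hi]), ENNReal.ofReal_one,
          mul_one]
    calc _ = walkWt υ h * (ENNReal.ofReal (mass υ h) * ENNReal.ofReal (θ.prob h a)) *
          ENNReal.ofReal ((M.minmax C E).P h.last a t) := by ring
      _ = _ := by rw [key, walkWt]; ring

open scoped Classical in
-- During a stay that began with `g`, the unnormalized weights are those of the uniform walk. Since
-- that walk stops at `s`, only histories in which `s` occurs at most at the end get weight.
theorem walkWt_mul_wt_walk (υ : (M.canonical C E).Policy) (s : S ⊕ Verdict)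
    {g : Hist (S ⊕ Verdict) (A ⊕ Extremal)} (hg : M.entry C E g = g)
    (h : Hist (S ⊕ Verdict) (A ⊕ Extremal)) :
    walkWt υ g * wt ((M.minmax C E).walkPolicy s) g h =
      if M.entry C E h = g ∧ s ∉ M.vis C E h then walkWt υ h else 0 := by
  by_cases hh : h = g
  · rw [hh, wt_self, vis_of_entry hg, hg]; simp
  induction h with
  | start t =>
    have : wt ((M.minmax C E).walkPolicy s) g (.start t) = 0 := by simp [wt, hh]
    rw [this, mul_zero, if_neg]
    exact fun h' => hh h'.1
  | snoc h a t ih =>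
    have ih' : walkWt υ g * wt ((M.minmax C E).walkPolicy s) g h =
        if M.entry C E h = g ∧ s ∉ M.vis C E h then walkWt υ h else 0 := by
      by_cases e : h = g
      · rw [e, wt_self, vis_of_entry hg, hg]; simp
      · exact ih e
    rw [wt_snoc_of_ne hh, ← mul_assoc, ih', pw_eq, walk_P]
    by_cases hi : (M.minmax C E).Internal h.last a
    · by_cases hs : h.last = s
      · simp [hs, vis, hs ▸ hi]
      · simp [hi, hs, vis, entry, walkWt, Ne.symm hs, walkPolicy, mul_assoc]
    · simp [hi, entry, hh]

/-- The prefix `ρ` is reached with the total unnormalized weight of the entries `g` into the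
corresponding stay. Leaving by `(s, a)` happens at the first visit to `s`, with unnormalized
probability `υ.prob ρ (.ext s a)`. As the uniform walk from `g` hits `s` almost surely, the first
visits to `s` carry the whole weight of `g`. Hence the leaving probability is the prescribed
fraction of the prefix probability. -/
theorem IsWalkExit.corrQuotient {υ : (M.canonical C E).Policy} {θ : (M.minmax C E).Policy}
    (H : IsWalkExit υ θ) : M.CorrQuotient C E θ υ := by
  classical
  rw [corrQuotient_iff]
  intro ρ hρ
  -- A run with prefix `ρ` passes through exactly one entry history with collapse `ρ`, and at an
  -- entry the normalizing factor is 1.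
  have hpre : Pr θ (M.prefixEv C E ρ) = ∑' g : Hist (S ⊕ Verdict) (A ⊕ Extremal),
      if M.entry C E g = g ∧ M.collapse C E g = ρ then walkWt υ g else 0 := by
    have h1 := PrFrom_visits θ (.start (.inl M.init))
      {g | M.entry C E g = g ∧ M.collapse C E g = ρ} (by
        rintro ω hr n m ⟨hn1, hn2⟩ ⟨hm1, hm2⟩
        rw [← hn1, ← hm1]
        rcases hr.isChain.total n m with hp | hp
        · exact entry_eq_of_pre hp (hn2.trans hm2.symm)
        · exact (entry_eq_of_pre hp (hm2.trans hn2.symm)).symm)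
    have h2 : Pr θ (M.prefixEv C E ρ) = PrFrom θ (.start (.inl M.init))
        {ω | ∃ n, ω n ∈ {g | M.entry C E g = g ∧ M.collapse C E g = ρ}} := by
      refine measure_congr ?_
      filter_upwards [ae_isRun θ (.start (.inl M.init))] with ω hr
      refine propext ⟨?_, ?_⟩
      · rintro ⟨n, hn⟩
        have hp := entry_pre (M := M) (C := C) (E := E) (ω n)
        have h0 := hr.isChain.pre (Nat.zero_le n)
        rw [hr.zero] at h0
        obtain ⟨m, _, hm⟩ := hr.isChain.exists_eq
          (by rw [hr.zero]; exact start_pre_of_pre h0 hp) hp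
        refine ⟨m, ?_, ?_⟩
        · rw [hm]; exact entry_entry _
        · rw [hm, collapse_entry, hn]
      · rintro ⟨n, _, hn⟩
        exact ⟨n, hn⟩
    rw [h2, h1, tsum_subtype {g | M.entry C E g = g ∧ M.collapse C E g = ρ}
      (fun g => wt θ (.start (.inl M.init)) g)]
    refine tsum_congr fun g => ?_
    rw [Set.indicator_apply]
    by_cases hg : M.entry C E g = g ∧ M.collapse C E g = ρ
    · rw [if_pos hg, if_pos (by exact hg), H.wt_eq]
      by_cases h0 : walkWt υ g = 0
      · rw [h0, zero_mul]
      · rw [mass_of_entry υ (isPath_of_walkWt_ne_zero h0) hg.1, ENNReal.ofReal_one, mul_one]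
    · rw [if_neg hg, if_neg (by exact hg)]
  have hext : ∀ s a, Pr θ (M.leaveEv C E ρ (.ext s a)) =
      ENNReal.ofReal (υ.prob ρ (.ext s a)) * Pr θ (M.prefixEv C E ρ) := by
    intro s a
    by_cases hen : (M.canonical C E).Enabled ρ.last (.ext s a)
    swap
    · rw [υ.enabled ρ hρ _ hen, ENNReal.ofReal_zero, zero_mul]
      exact prob_leaveEv_eq_zero θ _ hρ hen
    obtain ⟨hs, hi, ha⟩ := canonical_enabled_ext.1 hen
    -- The weight of an entry is redistributed over the histories at which its stay meets `s` for
    -- the first time.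
    have hhit : ∀ g : Hist (S ⊕ Verdict) (A ⊕ Extremal),
        (if M.entry C E g = g ∧ M.collapse C E g = ρ then walkWt υ g else 0) =
        ∑' h : Hist (S ⊕ Verdict) (A ⊕ Extremal), if M.entry C E h = g then
          (if M.collapse C E h = ρ ∧ h.last = s ∧ s ∉ M.vis C E h then walkWt υ h else 0)
          else 0 := by
      intro g
      by_cases hg : M.entry C E g = g ∧ M.collapse C E g = ρ
      · rw [if_pos hg]
        have e1 : ∀ h : Hist (S ⊕ Verdict) (A ⊕ Extremal), (if M.entry C E h = g then
            (if M.collapse C E h = ρ ∧ h.last = s ∧ s ∉ M.vis C E h then walkWt υ h else 0)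
            else 0) = walkWt υ g * Set.indicator {h | h.last ∈ ({s} : Set (S ⊕ Verdict))}
              (fun h => wt ((M.minmax C E).walkPolicy s) g h) h := by
          intro h
          rw [Set.indicator_apply]
          have hm : h ∈ {h : Hist (S ⊕ Verdict) (A ⊕ Extremal) | h.last ∈ ({s} : Set (S ⊕ Verdict))}
            ↔ h.last = s := Iff.rfl
          simp only [hm]
          by_cases hl : h.last = s
          · rw [if_pos hl, walkWt_mul_wt_walk υ s hg.1]
            by_cases he : M.entry C E h = g
            · have : M.collapse C E h = ρ := by
                rw [← collapse_entry, he, hg.2]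
              simp [he, hl, this]
            · simp [he]
          · simp [hl]
        simp only [e1]
        rw [ENNReal.tsum_mul_left, ← tsum_subtype, ← PrFrom_ev]
        · by_cases h0 : walkWt υ g = 0
          · rw [h0, zero_mul]
          · have hp := isPath_of_walkWt_ne_zero h0
            have hl := hp.collapse_last
            rw [hg.2, ← hs] at hl
            have ht : ¬ (M.minmax C E).IsTerminal s := fun ht => ht a ha
            rw [walkPolicy_hits, mul_one]
            exact (M.minmax C E).mecSetoid.symm ((proj_eq_iff ht).1 hl)
        · rintro e rfl
          exact walk_terminal.2 (Or.inl rfl)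
      · rw [if_neg hg]
        symm
        rw [ENNReal.tsum_eq_zero]
        intro h
        by_cases he : M.entry C E h = g
        · rw [if_pos he, if_neg]
          rintro ⟨h1, -, -⟩
          refine hg ⟨?_, ?_⟩
          · rw [← he, entry_entry]
          · rw [← he, collapse_entry, h1]
        · rw [if_neg he]
    rw [hpre]
    simp only [hhit]
    -- After exchanging the sums, each `h` occurs for the single entry `M.entry C E h`.
    rw [ENNReal.tsum_comm, ← ENNReal.tsum_mul_left]
    refine (prob_leave_formula θ (.inl M.init) hen).1.trans ?_
    rw [tsum_subtype {h | M.collapse C E h = ρ ∧ h.last = s}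
      (fun h => wt θ (.start (.inl M.init)) h * ENNReal.ofReal (θ.prob h a))]
    refine tsum_congr fun h => ?_
    rw [tsum_eq_single (M.entry C E h) fun g hg => if_neg hg.symm, if_pos rfl, Set.indicator_apply]
    by_cases hh : M.collapse C E h = ρ ∧ h.last = s
    · rw [if_pos (by exact hh), H.wt_eq]
      by_cases h0 : walkWt υ h = 0
      · simp [h0]
      have hp := isPath_of_walkWt_ne_zero h0
      have ht : ¬ (M.minmax C E).IsTerminal h.last := fun ht => ht a (hh.2 ▸ ha)
      rw [mul_assoc, ← ENNReal.ofReal_mul (mass_nonneg υ hp), H.mass_mul_prob hp ht, walkExit,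
        if_neg (hh.2 ▸ hi), exitProb, hh.1, hh.2]
      by_cases hv : s ∈ M.vis C E h
      · simp [hv]
      · simp [hv, mul_comm]
    · rw [if_neg (by exact hh), if_neg fun h' => hh ⟨h'.1, h'.2.1⟩, mul_zero]
  have hextR : ∀ s a, υ.prob ρ (.ext s a) * (Pr θ).real (M.prefixEv C E ρ) =
      (Pr θ).real (M.leaveEv C E ρ (.ext s a)) := by
    intro s a
    rw [measureReal_def, measureReal_def, hext, ENNReal.toReal_mul,
      ENNReal.toReal_ofReal (υ.nonneg ρ hρ _)]
  rintro (⟨s, a⟩ | _)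
  · exact hextR s a
  -- The statement for `τ` follows from the others, because both sides sum to the prefix
  -- probability.
  · have h1 : (Pr θ).real (M.prefixEv C E ρ) = ∑ b, (Pr θ).real (M.leaveEv C E ρ b) := by
      simp only [measureReal_def]
      rw [← ENNReal.toReal_sum fun b _ => measure_ne_top _ _]
      exact congrArg ENNReal.toReal (prob_prefixEv θ (.inl M.init) ρ)
    have h2 := υ.sum_eq_one ρ hρ
    rw [sum_canAct] at h1 h2
    simp only [← hextR, ← Finset.sum_mul] at h1
    have h3 := congrArg (· * (Pr θ).real (M.prefixEv C E ρ)) h2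
    simp only [add_mul, one_mul] at h3
    linarith

theorem exists_policy_of_corrQuotient (υ : (M.canonical C E).Policy) :
    ∃ θ : (M.minmax C E).Policy, M.CorrQuotient C E θ υ :=
  (exists_isWalkExit υ).imp fun _ H => H.corrQuotient

end MDP

namespace MDP

open Hist

variable {S A : Type*} [Fintype S] [Fintype A] {M : MDP S A} {C E : Set S}

/-! ### The states of `C` in the canonical MDP -/

/-- The copies of `TP` and `FP` among the outcomes. -/
def Verdict.outcome : Verdict → Outcome
  | .TP => .TP
  | .FP => .FP

theorem proj_verdict (v : Verdict) : M.proj C E (.inr v) = .inl v.outcome := by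
  cases v <;> rfl

theorem proj_inl_ne_outcome (s : S) (v : Verdict) : M.proj C E (.inl s) ≠ .inl v.outcome := by
  by_cases hs : (M.minmax C E).IsTerminal (.inl s)
  · simp only [proj, dif_neg (not_not.2 hs)]
    split_ifs <;> cases v <;> simp [Verdict.outcome]
  · rw [proj_of_not_terminal hs]; simp

theorem proj_eq_outcome {s : S ⊕ Verdict} {v : Verdict} :
    M.proj C E s = .inl v.outcome ↔ s = .inr v := by
  constructor
  · rcases s with s | w
    · exact fun h => absurd h (proj_inl_ne_outcome s v)
    · rw [proj_verdict]
      cases v <;> cases w <;> simp [Verdict.outcome]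
  · rintro rfl
    exact proj_verdict v

theorem minmax_step_of_mem {c : S} (hc : c ∈ C) {a : A ⊕ Extremal} {t : S ⊕ Verdict}
    (h : 0 < (M.minmax C E).P (.inl c) a t) : ∃ x v, a = .inr x ∧ t = .inr v := by
  rcases a with a | x
  · rw [minmax_P_inl_of_mem hc] at h
    exact absurd h (lt_irrefl _)
  · rcases t with t | v
    · rw [minmax_P_inr_inl] at h
      exact absurd h (lt_irrefl _)
    · exact ⟨x, v, rfl, rfl⟩

theorem minmax_step_verdict {s : S ⊕ Verdict} {a : A ⊕ Extremal} {v : Verdict}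
    (h : 0 < (M.minmax C E).P s a (.inr v)) : ∃ c ∈ C, ∃ x, s = .inl c ∧ a = .inr x := by
  rcases a with a | x
  · rw [minmax_P_inl_inr] at h
    exact absurd h (lt_irrefl _)
  · rcases s with s | w
    · by_cases hs : s ∈ C
      · exact ⟨s, hs, x, rfl, rfl⟩
      · rw [minmax_P_inr_of_notMem hs] at h
        exact absurd h (lt_irrefl _)
    · rw [minmax_P_verdict] at h
      exact absurd h (lt_irrefl _)

theorem minmax_step_inl {s : S ⊕ Verdict} {a : A ⊕ Extremal} {t : S}
    (h : 0 < (M.minmax C E).P s a (.inl t)) : ∃ s', s' ∉ C ∧ ∃ a', s = .inl s' ∧ a = .inl a' := by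
  rcases a with a | x
  · rcases s with s | w
    · by_cases hs : s ∈ C
      · rw [minmax_P_inl_of_mem hs] at h
        exact absurd h (lt_irrefl _)
      · exact ⟨s, hs, a, rfl, rfl⟩
    · rw [minmax_P_verdict] at h
      exact absurd h (lt_irrefl _)
  · rw [minmax_P_inr_inl] at h
    exact absurd h (lt_irrefl _)

/-- All transitions from `c` lead to terminal states. Thus `c` forms a class of its own, and it gets
no action `τ`. -/
theorem not_inMEC_of_mem {c : S} (hc : c ∈ C) : ¬ (M.minmax C E).InMEC (.inl c) := by
  intro h
  obtain ⟨a, ha⟩ := h.exists_internal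
  obtain ⟨t, ht⟩ := exists_P_pos ha.enabled
  obtain ⟨B, hB, _, htB⟩ := ha.equiv ht
  obtain ⟨x, v, _, rfl⟩ := minmax_step_of_mem hc ht
  exact InMEC.not_terminal ⟨B, hB, htB⟩ (minmax_terminal_verdict v)

theorem proj_eq_of_mem {c : S} (hc : c ∈ C) {s : S ⊕ Verdict} :
    M.proj C E s = M.proj C E (.inl c) ↔ s = .inl c := by
  refine ⟨fun h => ?_, fun h => by rw [h]⟩
  rcases (proj_eq_iff (minmax_not_terminal_of_mem hc)).1 h.symm with e | ⟨B, hB, hcB, _⟩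
  · exact e.symm
  · exact absurd ⟨B, hB, hcB⟩ (not_inMEC_of_mem hc)

theorem canonical_not_terminal_of_mem {c : S} (hc : c ∈ C) :
    ¬ (M.canonical C E).IsTerminal (M.proj C E (.inl c)) := by
  rw [canonical_terminal_proj]
  exact minmax_not_terminal_of_mem hc

theorem canonical_ext_pos {q u : M.CanState C E} {s : S ⊕ Verdict} {a : A ⊕ Extremal}
    (h : 0 < (M.canonical C E).P q (.ext s a) u) : M.proj C E s = q ∧
      ¬ (M.minmax C E).Internal s a ∧ ∃ t, M.proj C E t = u ∧ 0 < (M.minmax C E).P s a t := by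
  classical
  rw [canonical_P_ext] at h
  split_ifs at h with hq
  · refine ⟨hq.1, hq.2, ?_⟩
    obtain ⟨t, _, ht⟩ := Finset.exists_ne_zero_of_sum_ne_zero h.ne'
    split_ifs at ht with hu
    · exact ⟨t, hu, ((M.minmax C E).P_nonneg s a t).lt_of_ne (Ne.symm ht)⟩
    · exact absurd rfl ht
  · exact absurd h (lt_irrefl _)

theorem canonical_tau_pos {q u : M.CanState C E} (h : 0 < (M.canonical C E).P q .tau u) :
    (∃ s, (M.minmax C E).InMEC s ∧ M.proj C E s = q) ∧ u = .inl .TN := by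
  classical
  rw [canonical_P_tau] at h
  split_ifs at h with hq
  · exact hq
  · exact absurd h (lt_irrefl _)

theorem canonical_step_of_mem {c : S} (hc : c ∈ C) {b : CanAct S A} {u : M.CanState C E}
    (h : 0 < (M.canonical C E).P (M.proj C E (.inl c)) b u) :
    ∃ x : Extremal, ∃ v : Verdict, b = .ext (.inl c) (.inr x) ∧ u = .inl v.outcome := by
  rcases b with ⟨s, a⟩ | _
  · obtain ⟨hs, _, t, ht, hP⟩ := canonical_ext_pos h
    rw [proj_eq_of_mem hc] at hs
    subst hs
    obtain ⟨x, v, rfl, rfl⟩ := minmax_step_of_mem hc hP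
    exact ⟨x, v, rfl, by rw [← ht, proj_verdict]⟩
  · obtain ⟨⟨s, hs, e⟩, _⟩ := canonical_tau_pos h
    rw [proj_eq_of_mem hc] at e
    exact absurd (e ▸ hs) (not_inMEC_of_mem hc)

theorem canonical_step_outcome {q : M.CanState C E} {b : CanAct S A} {v : Verdict}
    (h : 0 < (M.canonical C E).P q b (.inl v.outcome)) :
    ∃ c ∈ C, ∃ x : Extremal, q = M.proj C E (.inl c) ∧ b = .ext (.inl c) (.inr x) := by
  rcases b with ⟨s, a⟩ | _
  · obtain ⟨hs, _, t, ht, hP⟩ := canonical_ext_pos h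
    rw [proj_eq_outcome] at ht
    subst ht
    obtain ⟨c, hc, x, rfl, rfl⟩ := minmax_step_verdict hP
    exact ⟨c, hc, x, hs.symm, rfl⟩
  · have := (canonical_tau_pos h).2
    cases v <;> simp [Verdict.outcome] at this

/-- `τ` leads only to `TN`, which is terminal, so it can only be the last step of a path, and then
the path ends in `TN`. -/
theorem tauFree_of_isPath {ρ : Hist (M.CanState C E) (CanAct S A)}
    (hρ : (M.canonical C E).IsPath ρ) (hl : ρ.last ≠ .inl .TN) : TauFree ρ := by
  induction ρ with
  | start q => trivial
  | snoc ρ b u ih =>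
    rcases b with ⟨s, a⟩ | _
    · refine ih hρ.1 fun e => ?_
      have := enabled_of_P_pos hρ.2
      rw [e] at this
      exact canonical_terminal_inl _ _ this
    · exact absurd (canonical_tau_pos hρ.2).2 hl

/-- A run that visits `c ∈ C` in the canonical MDP proceeds to `TP` or `FP`. -/
theorem IsRun.after_mem {υ : (M.canonical C E).Policy} {ρ₀ : Hist (M.CanState C E) (CanAct S A)}
    {ω : ℕ → Hist (M.CanState C E) (CanAct S A)} (hω : IsRun υ ρ₀ ω) {c : S} (hc : c ∈ C) {n : ℕ}
    (hn : (ω n).last = M.proj C E (.inl c)) : ∃ x : Extremal, ∃ v : Verdict, ∀ m > n,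
      ω m = (ω n).snoc (.ext (.inl c) (.inr x)) (.inl v.outcome) := by
  obtain ⟨b, u, e, _, hP⟩ := hω.snoc_of_ne (n := n) (hn ▸ canonical_not_terminal_of_mem hc)
  rw [hn] at hP
  obtain ⟨x, v, rfl, rfl⟩ := canonical_step_of_mem hc hP
  refine ⟨x, v, fun m hm => ?_⟩
  rw [← e]
  refine hω.eq_of_terminal ?_ hm
  rw [e]
  exact canonical_terminal_inl _

theorem IsRun.unique_mem {υ : (M.canonical C E).Policy}
    {ρ₀ : Hist (M.CanState C E) (CanAct S A)} {ω : ℕ → Hist (M.CanState C E) (CanAct S A)}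
    (hω : IsRun υ ρ₀ ω) {c c' : S} (hc : c ∈ C) (hc' : c' ∈ C) {n m : ℕ}
    (hn : (ω n).last = M.proj C E (.inl c)) (hm : (ω m).last = M.proj C E (.inl c')) : n = m := by
  have key : ∀ {c c' : S}, c ∈ C → c' ∈ C → ∀ {n m : ℕ}, (ω n).last = M.proj C E (.inl c) →
      (ω m).last = M.proj C E (.inl c') → ¬ n < m := by
    intro c c' hc hc' n m hn hm h
    obtain ⟨x, v, e⟩ := hω.after_mem hc hn
    rw [e m h, last_snoc] at hm
    refine canonical_not_terminal_of_mem (M := M) (E := E) hc' ?_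
    rw [← hm]
    exact canonical_terminal_inl _
  exact le_antisymm (not_lt.1 (key hc' hc hm hn)) (not_lt.1 (key hc hc' hn hm))

theorem IsRun.before_outcome {υ : (M.canonical C E).Policy} {s : S}
    {ω : ℕ → Hist (M.CanState C E) (CanAct S A)} (hω : IsRun υ (.start (M.proj C E (.inl s))) ω)
    {v : Verdict} {m : ℕ} (hm : (ω m).last = .inl v.outcome) :
    ∃ n < m, ∃ c ∈ C, (ω n).last = M.proj C E (.inl c) := by
  induction m with
  | zero =>
    rw [hω.zero] at hm
    exact absurd hm (proj_inl_ne_outcome s v)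
  | succ m ih =>
    rcases hω.step m with ⟨_, e⟩ | ⟨_, b, u, e, _, hP⟩
    · obtain ⟨n, hn, h⟩ := ih (e ▸ hm)
      exact ⟨n, hn.trans (Nat.lt_succ_self m), h⟩
    · rw [e, last_snoc] at hm
      rw [hm] at hP
      obtain ⟨c, hc, x, hq, _⟩ := canonical_step_outcome hP
      exact ⟨m, Nat.lt_succ_self m, c, hc, hq⟩

/-! ### Runs of the first step -/

/-- A step into an original state is an original step from a state outside `C`. -/
theorem exists_map_of_isPath {s : S} {h : Hist (S ⊕ Verdict) (A ⊕ Extremal)}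
    (h0 : (Hist.start (.inl s)).Pre h) (hp : (M.minmax C E).IsPath h) {t : S}
    (ht : h.last = .inl t) : ∃ g : Hist S A, h = g.map .inl .inl ∧ g.AvoidsBeforeLast C := by
  induction h generalizing t with
  | start s' =>
    obtain rfl : s' = .inl t := ht
    exact ⟨.start t, rfl, trivial⟩
  | snoc h a u ih =>
    obtain rfl : u = .inl t := ht
    obtain ⟨s', hs', a', e, rfl⟩ := minmax_step_inl hp.2
    obtain ⟨g, rfl, hg⟩ := ih (h0.resolve_left (by simp)) hp.1 e
    rw [last_map, Sum.inl.injEq] at e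
    exact ⟨g.snoc a' t, rfl, hg, e ▸ hs'⟩

theorem IsRun.exists_map {θ : (M.minmax C E).Policy} {s : S}
    {ω : ℕ → Hist (S ⊕ Verdict) (A ⊕ Extremal)} (hω : IsRun θ (.start (.inl s)) ω) {n : ℕ} {t : S}
    (hn : (ω n).last = .inl t) :
    ∃ g : Hist S A, ω n = g.map .inl .inl ∧ g.AvoidsBeforeLast C ∧ g.last = t := by
  have h0 := hω.isChain.pre (Nat.zero_le n)
  rw [hω.zero] at h0
  obtain ⟨g, e, hg⟩ := exists_map_of_isPath h0 (hω.isPath trivial n) hn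
  refine ⟨g, e, hg, ?_⟩
  rw [e, last_map, Sum.inl.injEq] at hn
  exact hn

theorem IsRun.unique_minmax_mem {θ : (M.minmax C E).Policy}
    {h₀ : Hist (S ⊕ Verdict) (A ⊕ Extremal)}
    {ω : ℕ → Hist (S ⊕ Verdict) (A ⊕ Extremal)} (hω : IsRun θ h₀ ω) {c : S} (hc : c ∈ C)
    {n m : ℕ} (hn : (ω n).last = .inl c) (hm : (ω m).last = .inl c) : ω n = ω m := by
  have key : ∀ {n m : ℕ}, (ω n).last = .inl c → (ω m).last = .inl c → ¬ n < m := by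
    intro n m hn hm h
    obtain ⟨a, t, e, _, hP⟩ := hω.snoc_of_ne (n := n) (hn ▸ minmax_not_terminal_of_mem hc)
    rw [hn] at hP
    obtain ⟨x, v, rfl, rfl⟩ := minmax_step_of_mem hc hP
    have e2 : ω m = ω (n + 1) := hω.eq_of_terminal (by rw [e]; exact minmax_terminal_verdict v) h
    rw [e2, e, last_snoc] at hm
    cases hm
  rw [le_antisymm (not_lt.1 (key hm hn)) (not_lt.1 (key hn hm))]

theorem IsRun.unique_of_terminal {S' A' : Type*} [Fintype S'] [Fintype A'] {N : MDP S' A'}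
    {σ : N.Policy} {h₀ : Hist S' A'} {ω : ℕ → Hist S' A'} (hω : IsRun σ h₀ ω) {n m : ℕ}
    (hn : N.IsTerminal (ω n).last) (hm : N.IsTerminal (ω m).last) : ω n = ω m := by
  rcases le_total n m with h | h
  · exact (hω.eq_of_terminal hn h).symm
  · exact hω.eq_of_terminal hm h

/-! ### Transfer of probabilities -/

/-- Induction on `ρ`: times the prefix probability, the choice of `υ` is the leaving probability,
and `prob_prefixEv_snoc` supplies the transition probability. At terminal `ρ` nothing can follow on
either side. -/
theorem CorrQuotient.wt_eq {θ : (M.minmax C E).Policy} {υ : (M.canonical C E).Policy}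
    (H : M.CorrQuotient C E θ υ) {ρ : Hist (M.CanState C E) (CanAct S A)} (hρ : TauFree ρ) :
    wt υ (.start (M.proj C E (.inl M.init))) ρ = Pr θ (M.prefixEv C E ρ) := by
  classical
  induction ρ with
  | start q =>
    by_cases hq : q = M.proj C E (.inl M.init)
    · subst hq
      rw [wt_self]
      refine ((prob_compl_eq_zero_iff (measurableSet_prefixEv _)).1 ?_).symm
      refine measure_mono_null ?_ (ae_isRun θ (.start (.inl M.init)))
      intro ω hω hr
      exact hω ⟨0, by rw [hr.zero]; rfl⟩
    · rw [show wt υ (.start (M.proj C E (.inl M.init))) (.start q) = 0 by simp [wt, hq]]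
      refine (measure_mono_null ?_ (ae_isRun θ (.start (.inl M.init)))).symm
      rintro ω ⟨n, hn⟩ hr
      have h0 := (isChain_collapse (M := M) (C := C) (E := E) hr.isChain).pre (Nat.zero_le n)
      simp only [hn, hr.zero] at h0
      have h1 : Hist.start (M.proj C E (.inl M.init)) = (.start q : Hist _ (CanAct S A)) := h0
      simp only [Hist.start.injEq] at h1
      exact hq h1.symm
  | snoc ρ b u ih =>
    rcases b with ⟨s, a⟩ | _
    swap
    · exact hρ.elim
    rw [wt_start_snoc, ih hρ]
    by_cases ht : (M.canonical C E).IsTerminal ρ.last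
    · rw [pw_of_terminal _ ht, mul_zero]
      refine (measure_mono_null ?_ (ae_isRun θ (.start (.inl M.init)))).symm
      rintro ω ⟨n, hn⟩ hr
      obtain ⟨m, _, hm, _, _, t, e, _⟩ := hr.exists_leave hn
      rw [← hm, (hr.isPath trivial m).collapse_last, canonical_terminal_proj] at ht
      exact (hr.enabled e).1 ht
    · have h1 := corrQuotient_iff.1 H ρ ht (.ext s a)
      have h2 : Pr θ (M.prefixEv C E ρ) * ENNReal.ofReal (υ.prob ρ (.ext s a)) =
          Pr θ (M.leaveEv C E ρ (.ext s a)) := by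
        rw [← ofReal_measureReal (measure_ne_top (Pr θ) (M.leaveEv C E ρ (.ext s a))), ← h1,
          ENNReal.ofReal_mul (υ.nonneg ρ ht _), ofReal_measureReal, mul_comm]
      rw [pw_eq, ← mul_assoc, h2]
      exact (prob_prefixEv_snoc θ (.inl M.init) ht s a u).symm

theorem CorrQuotient.wt_tau {θ : (M.minmax C E).Policy} {υ : (M.canonical C E).Policy}
    (H : M.CorrQuotient C E θ υ) {ρ : Hist (M.CanState C E) (CanAct S A)} (hρ : TauFree ρ)
    (ht : ¬ (M.canonical C E).IsTerminal ρ.last) :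
    wt υ (.start (M.proj C E (.inl M.init))) (ρ.snoc .tau (.inl .TN)) =
      Pr θ (M.leaveEv C E ρ .tau) := by
  rw [wt_start_snoc, H.wt_eq hρ, pw_eq, ← mul_assoc]
  have h1 := corrQuotient_iff.1 H ρ ht .tau
  have h2 : Pr θ (M.prefixEv C E ρ) * ENNReal.ofReal (υ.prob ρ .tau) =
      Pr θ (M.leaveEv C E ρ .tau) := by
    rw [← ofReal_measureReal (measure_ne_top (Pr θ) (M.leaveEv C E ρ .tau)), ← h1,
      ENNReal.ofReal_mul (υ.nonneg ρ ht _), ofReal_measureReal, mul_comm]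
  rw [h2]
  by_cases hen : (M.canonical C E).Enabled ρ.last .tau
  · rw [canonical_P_tau, if_pos ⟨canonical_enabled_tau.1 hen, rfl⟩, ENNReal.ofReal_one, mul_one]
  · have h0 : Pr θ (M.leaveEv C E ρ .tau) = 0 := prob_leaveEv_eq_zero θ (.inl M.init) ht hen
    rw [h0, zero_mul]

/-- Transfer from the first step to the canonical MDP. -/
theorem CorrQuotient.prob_visits {θ : (M.minmax C E).Policy} {υ : (M.canonical C E).Policy}
    (H : M.CorrQuotient C E θ υ) {Q : Set (Hist (M.CanState C E) (CanAct S A))}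
    (hQ : ∀ ρ ∈ Q, TauFree ρ)
    (hυ : ∀ ω, IsRun υ (.start (M.proj C E (.inl M.init))) ω →
      ∀ n m, ω n ∈ Q → ω m ∈ Q → ω n = ω m)
    (hθ : ∀ ω, IsRun θ (.start (.inl M.init)) ω → ∀ n m, M.collapse C E (ω n) ∈ Q →
      M.collapse C E (ω m) ∈ Q → M.collapse C E (ω n) = M.collapse C E (ω m)) :
    Pr υ {ω | ∃ n, ω n ∈ Q} = Pr θ {ω | ∃ n, M.collapse C E (ω n) ∈ Q} := by
  refine (PrFrom_visits υ _ Q hυ).trans ?_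
  symm
  refine (measure_eq_tsum_of_ae (Y := fun ρ : Q => M.prefixEv C E ρ.1) ?_ ?_
    fun ρ => measurableSet_prefixEv _).trans ?_
  · refine Filter.Eventually.of_forall fun ω => ⟨?_, ?_⟩
    · rintro ⟨n, hn⟩
      exact ⟨⟨_, hn⟩, n, rfl⟩
    · rintro ⟨ρ, n, hn⟩
      exact ⟨n, by rw [hn]; exact ρ.2⟩
  · refine (ae_isRun θ (.start (.inl M.init))).mono fun ω hr => ?_
    rintro ρ ρ' ⟨n, hn⟩ ⟨m, hm⟩
    refine Subtype.ext ?_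
    rw [← hn, ← hm]
    exact hθ ω hr n m (by rw [hn]; exact ρ.2) (by rw [hm]; exact ρ'.2)
  · exact tsum_congr fun ρ => (H.wt_eq (hQ ρ.1 ρ.2)).symm

theorem IsRun.collapse_unique_of_terminal {θ : (M.minmax C E).Policy} {s : S ⊕ Verdict}
    {ω : ℕ → Hist (S ⊕ Verdict) (A ⊕ Extremal)} (hω : IsRun θ (.start s) ω) {n m : ℕ}
    (hn : (M.canonical C E).IsTerminal (M.collapse C E (ω n)).last)
    (hm : (M.canonical C E).IsTerminal (M.collapse C E (ω m)).last) :
    M.collapse C E (ω n) = M.collapse C E (ω m) := by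
  have hp := hω.isPath trivial
  rw [(hp _).collapse_last, canonical_terminal_proj] at hn hm
  rw [hω.unique_of_terminal hn hm]

/-- Transfer from the MDP to the first step. -/
theorem CorrMinmax.prob_visits {σ : M.Policy} {θ : (M.minmax C E).Policy}
    (H : M.CorrMinmax C E σ θ) {G : Set (Hist S A)} (hG : ∀ g ∈ G, g.AvoidsBeforeLast C)
    (hσ : ∀ ω, IsRun σ (.start M.init) ω → ∀ n m, ω n ∈ G → ω m ∈ G → ω n = ω m)
    (hθ : ∀ ω, IsRun θ (.start (.inl M.init)) ω → ∀ n m, ω n ∈ map .inl .inl '' G →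
      ω m ∈ map .inl .inl '' G → ω n = ω m) :
    Pr σ {ω | ∃ n, ω n ∈ G} = Pr θ {ω | ∃ n, ω n ∈ map .inl .inl '' G} := by
  refine (PrFrom_visits σ _ G hσ).trans ?_
  symm
  refine (PrFrom_visits θ _ _ hθ).trans ?_
  rw [tsum_image (fun h => wt θ (.start (.inl M.init)) h)
    (map_injective Sum.inl_injective Sum.inl_injective).injOn]
  exact tsum_congr fun g => H.wt_eq M.init (hG g.1 g.2)

end MDP

namespace MDP

open Hist

variable {S A : Type*} [Fintype S] [Fintype A] {M : MDP S A} {C E : Set S}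

/-! ### Events of runs -/

theorem mem_ev {S A : Type*} {T : Set S} {ω : ℕ → Hist S A} :
    ω ∈ ev T ↔ ∃ n, (ω n).last ∈ T := by
  simp [ev, untilEv]

theorem measurableSet_untilEv (X T : Set S) :
    MeasurableSet (untilEv X T : Set (ℕ → Hist S A)) := by
  have : (untilEv X T : Set (ℕ → Hist S A)) =
      ⋃ j, (⋂ i, ⋂ _ : i < j, {ω | ω i ∈ {g : Hist S A | g.last ∈ X}}) ∩
        {ω | ω j ∈ {g : Hist S A | g.last ∈ T}} := by
    ext ω; simp [untilEv]
  rw [this]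
  exact .iUnion fun j => (MeasurableSet.iInter fun i => .iInter fun _ =>
    measurableSet_eval_mem i _).inter (measurableSet_eval_mem j _)

theorem PrFrom_congr {σ : M.Policy} {h : Hist S A} {X Y : Set (ℕ → Hist S A)}
    (H : ∀ ω, IsRun σ h ω → (ω ∈ X ↔ ω ∈ Y)) : PrFrom σ h X = PrFrom σ h Y :=
  measure_congr ((ae_isRun σ h).mono fun ω hω => propext (H ω hω))

theorem IsRun.avoidsBeforeLast {σ : M.Policy} {s : S} {ω : ℕ → Hist S A}
    (hω : IsRun σ (.start s) ω) {j : ℕ} (hj : ∀ i < j, (ω i).last ∉ C) :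
    (ω j).AvoidsBeforeLast C := by
  induction j with
  | zero => rw [hω.zero]; trivial
  | succ j ih =>
    have h1 := ih fun i hi => hj i (hi.trans (Nat.lt_succ_self j))
    rcases hω.isChain j with e | ⟨a, t, e⟩
    · rw [e]; exact h1
    · rw [e]; exact ⟨h1, hj j (Nat.lt_succ_self j)⟩

/-- The finite sequences whose last state `c` is their first state in `C`. -/
def firstAt (C : Set S) (c : S) : Set (Hist S A) := {g | g.AvoidsBeforeLast C ∧ g.last = c}

theorem IsRun.mem_untilEv_iff {σ : M.Policy} {s : S} {ω : ℕ → Hist S A}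
    (hω : IsRun σ (.start s) ω) {c : S} :
    ω ∈ untilEv Cᶜ {c} ↔ ∃ n, ω n ∈ firstAt C c := by
  classical
  constructor
  · rintro ⟨j, hj, hc⟩
    exact ⟨j, hω.avoidsBeforeLast hj, hc⟩
  · rintro ⟨n, hn⟩
    -- Take the earliest time at which this history occurs: a state `c` that is terminal in `M`
    -- repeats forever, and an arbitrary time `n` may come after its first visit.
    have hex : ∃ j, ω j = ω n := ⟨n, rfl⟩
    have e := Nat.find_spec hex
    refine ⟨Nat.find hex, fun i hi => ?_, ?_⟩
    · refine hn.1.last_notMem ?_ (Nat.find_min hex hi)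
      rw [← e]
      exact hω.isChain.pre hi.le
    · rw [e]; exact hn.2

theorem eq_of_mem_firstAt {c c' : S} (hc : c ∈ C) (hc' : c' ∈ C) {g g' h h' : Hist S A}
    (hg : g ∈ firstAt C c) (hg' : g' ∈ firstAt C c') (H : g.Pre h) (H' : g'.Pre h')
    (hh : h.Pre h' ∨ h'.Pre h) : g = g' := by
  have key : g.Pre g' ∨ g'.Pre g := by
    rcases hh with K | K
    · exact (H.trans K).total H'
    · exact H.total (H'.trans K)
  rcases key with K | K
  · exact hg'.1.eq_of_last_mem K (hg.2 ▸ hc)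
  · exact (hg.1.eq_of_last_mem K (hg'.2 ▸ hc')).symm

theorem mem_ev_iff_exists_untilEv {S A : Type*} {C : Set S} {ω : ℕ → Hist S A} :
    ω ∈ ev C ↔ ∃ c : C, ω ∈ untilEv Cᶜ {c.1} := by
  classical
  rw [mem_ev]
  constructor
  · intro h
    exact ⟨⟨_, Nat.find_spec h⟩, Nat.find h, fun i hi => Nat.find_min h hi, rfl⟩
  · rintro ⟨⟨c, hc⟩, j, _, hj⟩
    obtain rfl : (ω j).last = c := hj
    exact ⟨j, hc⟩

theorem eq_of_mem_untilEv {S A : Type*} {C : Set S} {ω : ℕ → Hist S A} {c c' : S} (hc : c ∈ C)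
    (hc' : c' ∈ C) (h : ω ∈ untilEv Cᶜ {c}) (h' : ω ∈ untilEv Cᶜ {c'}) : c = c' := by
  obtain ⟨j, hj, e⟩ := h
  obtain ⟨j', hj', e'⟩ := h'
  obtain rfl : (ω j).last = c := e
  obtain rfl : (ω j').last = c' := e'
  rcases lt_trichotomy j j' with k | rfl | k
  · exact absurd hc (hj' _ k)
  · rfl
  · exact absurd hc' (hj _ k)

/-- Splitting along the first state in `C`. -/
theorem measure_inter_ev_eq_tsum {S A : Type*} [Countable S] [Fintype S] [Fintype A]
    (μ : Measure (ℕ → Hist S A)) (C : Set S) {X : Set (ℕ → Hist S A)} (hX : MeasurableSet X) :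
    μ (ev C ∩ X) = ∑' c : C, μ (untilEv Cᶜ {c.1} ∩ X) := by
  refine measure_eq_tsum_of_ae (Filter.Eventually.of_forall fun ω => ?_)
    (Filter.Eventually.of_forall fun ω c c' h h' => ?_)
    fun c => (measurableSet_untilEv _ _).inter hX
  · rw [Set.mem_inter_iff, mem_ev_iff_exists_untilEv]
    simp
  · exact Subtype.ext (eq_of_mem_untilEv c.2 c'.2 h.1 h'.1)

/-! ### Runs of the canonical MDP -/

section CanonicalRun

variable {υ : (M.canonical C E).Policy} {s : S} {ω : ℕ → Hist (M.CanState C E) (CanAct S A)}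

theorem IsRun.mem_untilEv_canC (hω : IsRun υ (.start (M.proj C E (.inl s))) ω) {c : S}
    (hc : c ∈ C) : ω ∈ untilEv (M.canC C E)ᶜ {M.proj C E (.inl c)} ↔
      ∃ n, (ω n).last = M.proj C E (.inl c) := by
  constructor
  · rintro ⟨j, _, hj⟩
    exact ⟨j, hj⟩
  · rintro ⟨n, hn⟩
    refine ⟨n, ?_, hn⟩
    rintro i hi ⟨c', hc', e⟩
    exact hi.ne (hω.unique_mem hc' hc e.symm hn)

theorem IsRun.outcome_unique (hω : IsRun υ (.start (M.proj C E (.inl s))) ω) {n m : ℕ}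
    {o o' : Outcome} (hn : (ω n).last = .inl o) (hm : (ω m).last = .inl o') : o = o' := by
  have := hω.unique_of_terminal (hn ▸ canonical_terminal_inl o) (hm ▸ canonical_terminal_inl o')
  rw [this, hm] at hn
  exact (Sum.inl_injective hn).symm

/-- A run visits a state of `C` iff it ends in `TP` or `FP`. -/
theorem IsRun.mem_ev_canC (hω : IsRun υ (.start (M.proj C E (.inl s))) ω) :
    ω ∈ ev (M.canC C E) ↔ ∃ v : Verdict, ω ∈ ev {.inl v.outcome} := by
  simp only [mem_ev]
  constructor
  · rintro ⟨n, c, hc, hn⟩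
    obtain ⟨x, v, e⟩ := hω.after_mem hc hn.symm
    exact ⟨v, n + 1, by rw [e _ (Nat.lt_succ_self n)]; rfl⟩
  · rintro ⟨v, m, hm⟩
    obtain ⟨n, _, c, hc, hn⟩ := hω.before_outcome hm
    exact ⟨n, c, hc, hn.symm⟩

theorem IsRun.not_mem_ev_of_ne (hω : IsRun υ (.start (M.proj C E (.inl s))) ω) {o o' : Outcome}
    (h : ω ∈ ev {.inl o}) (hne : o ≠ o') : ω ∉ ev {.inl o'} := by
  simp only [mem_ev] at h ⊢
  rintro ⟨m, hm⟩
  obtain ⟨n, hn⟩ := h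
  exact hne (hω.outcome_unique hn hm)

theorem mem_ev_canE {ω : ℕ → Hist (M.CanState C E) (CanAct S A)} :
    ω ∈ ev (M.canE C E) ↔ ω ∈ ev {.inl .TP} ∨ ω ∈ ev {.inl .FN} := by
  simp only [mem_ev, canE, Set.mem_insert_iff, Set.mem_singleton_iff, exists_or]

end CanonicalRun

/-! ### Corresponding policies -/

section Corresponding

variable {σ : M.Policy} {θ : (M.minmax C E).Policy} {υ : (M.canonical C E).Policy}

/-- First arrivals at `c` keep their weight in the first step. There they correspond to the visits
of the class of `c`, which is a singleton. A canonical run visits the copy of `C` only once, so each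
visit is a first one. -/
theorem prob_first_eq (H₁ : M.CorrMinmax C E σ θ) (H₂ : M.CorrQuotient C E θ υ) {c : S}
    (hc : c ∈ C) : Pr σ (untilEv Cᶜ {c}) =
      Pr υ (untilEv (M.canC C E)ᶜ {M.proj C E (.inl c)}) := by
  have h1 : Pr σ (untilEv Cᶜ {c}) = Pr σ {ω | ∃ n, ω n ∈ firstAt C c} :=
    PrFrom_congr fun ω hω => hω.mem_untilEv_iff
  have h2 : Pr σ {ω | ∃ n, ω n ∈ firstAt C c} =
      Pr θ {ω | ∃ n, ω n ∈ map .inl .inl '' (firstAt C c : Set (Hist S A))} := by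
    refine H₁.prob_visits (fun g hg => hg.1) ?_ ?_
    · intro ω hω n m hn hm
      exact eq_of_mem_firstAt hc hc hn hm (.refl _) (.refl _) (hω.isChain.total n m)
    · rintro ω hω n m ⟨g, hg, e⟩ ⟨g', hg', e'⟩
      refine hω.unique_minmax_mem hc ?_ ?_
      · rw [← e, last_map, hg.2]
      · rw [← e', last_map, hg'.2]
  have h3 : Pr θ {ω | ∃ n, ω n ∈ map .inl .inl '' (firstAt C c : Set (Hist S A))} =
      Pr θ {ω | ∃ n, M.collapse C E (ω n) ∈
        {ρ | TauFree ρ ∧ ρ.last = M.proj C E (.inl c)}} := by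
    refine PrFrom_congr fun ω hω => exists_congr fun n => ?_
    have hl := (hω.isPath trivial n).collapse_last
    constructor
    · rintro ⟨g, hg, e⟩
      refine ⟨tauFree_collapse _, ?_⟩
      rw [hl, ← e, last_map, hg.2]
    · rintro ⟨_, e⟩
      rw [hl, proj_eq_of_mem hc] at e
      obtain ⟨g, e1, hg, hgc⟩ := hω.exists_map e
      exact ⟨g, ⟨hg, hgc⟩, e1.symm⟩
  have h4 := H₂.prob_visits (Q := {ρ | TauFree ρ ∧ ρ.last = M.proj C E (.inl c)})
    (fun ρ hρ => hρ.1) (fun ω hω n m hn hm => by rw [hω.unique_mem hc hc hn.2 hm.2])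
    (fun ω hω n m hn hm => by
      have hn := hn.2
      have hm := hm.2
      rw [(hω.isPath trivial _).collapse_last, proj_eq_of_mem hc] at hn hm
      rw [hω.unique_minmax_mem hc hn hm])
  rw [h1, h2, h3, ← h4]
  refine PrFrom_congr fun ω hω => ?_
  rw [IsRun.mem_untilEv_canC hω hc]
  refine exists_congr fun n => ⟨fun h => h.2, fun h => ⟨?_, h⟩⟩
  refine tauFree_of_isPath (hω.isPath trivial n) fun e => ?_
  refine canonical_not_terminal_of_mem (M := M) (E := E) hc ?_
  rw [← h, e]
  exact canonical_terminal_inl _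

/-- The weight of an extension of `g` factors at `g`, which exhibits the residual policy after `g`.
-/
theorem PrFrom_extend (σ : M.Policy) (hE : ∀ e ∈ E, M.IsTerminal e) (s : S) (g : Hist S A) :
    PrFrom σ (.start s) {ω | ∃ n, ω n ∈ {e | g.Pre e ∧ e.last ∈ E}} =
      wt σ (.start s) g * PrFrom σ g (ev E) := by
  rw [PrFrom_visits, PrFrom_ev σ g hE, ← ENNReal.tsum_mul_left,
    tsum_subtype _ (fun e => wt σ (.start s) e),
    tsum_subtype {e : Hist S A | e.last ∈ E} (fun e => wt σ (.start s) g * wt σ g e)]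
  · refine tsum_congr fun e => ?_
    by_cases he : e.last ∈ E
    · by_cases hp : g.Pre e
      · rw [Set.indicator_of_mem (show e ∈ {e | g.Pre e ∧ e.last ∈ E} from ⟨hp, he⟩),
          Set.indicator_of_mem (show e ∈ {e : Hist S A | e.last ∈ E} from he),
          wt_mul_of_pre hp]
      · rw [Set.indicator_of_notMem (fun h => hp h.1),
          Set.indicator_of_mem (show e ∈ {e : Hist S A | e.last ∈ E} from he),
          not_not.1 (mt pre_of_wt_ne_zero hp), mul_zero]
    · rw [Set.indicator_of_notMem (fun h => he h.2),
        Set.indicator_of_notMem (show e ∉ {e : Hist S A | e.last ∈ E} from he)]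
  · exact fun ω hω n m hn hm => hω.unique_of_terminal (hE _ hn.2) (hE _ hm.2)

theorem prob_first_inter_eq_tsum (σ : M.Policy) (hE : ∀ e ∈ E, M.IsTerminal e) {c : S}
    (hc : c ∈ C) : Pr σ (untilEv Cᶜ {c} ∩ ev E) =
      ∑' g : (firstAt C c : Set (Hist S A)),
        wt σ (.start M.init) g * PrFrom σ g (ev E) := by
  refine (measure_eq_tsum_of_ae
    (Y := fun g : (firstAt C c : Set (Hist S A)) =>
      {ω : ℕ → Hist S A | ∃ n, ω n ∈ {e | g.1.Pre e ∧ e.last ∈ E}}) ?_ ?_ fun g => measurableSet_visits _).trans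
    (tsum_congr fun g => PrFrom_extend σ hE M.init g.1)
  · refine (ae_isRun σ (.start M.init)).mono fun ω hω => ?_
    rw [Set.mem_inter_iff, hω.mem_untilEv_iff, mem_ev]
    constructor
    · rintro ⟨⟨n, hn⟩, m, hm⟩
      refine ⟨⟨_, hn⟩, m, ?_, hm⟩
      rcases le_total n m with h | h
      · exact hω.isChain.pre h
      · rw [← hω.eq_of_terminal (hE _ hm) h]
        exact .refl _
    · rintro ⟨g, n, hg, hn⟩
      have h0 := hω.isChain.pre (Nat.zero_le n)
      rw [hω.zero] at h0
      obtain ⟨m, _, e⟩ := hω.isChain.exists_eq (by rw [hω.zero]; exact start_pre_of_pre h0 hg) hg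
      exact ⟨⟨m, by rw [e]; exact g.2⟩, n, hn⟩
  · refine (ae_isRun σ (.start M.init)).mono fun ω hω => ?_
    rintro g g' ⟨n, hg, _⟩ ⟨m, hg', _⟩
    exact Subtype.ext (eq_of_mem_firstAt hc hc g.2 g'.2 hg hg' (hω.isChain.total n m))

/-- Split by the first arrival `g` at `c`. Reaching `E` afterwards has the same probability as the
direct step from the image of `g` to `TP` by one of the two new actions, and this step survives
collapsing. -/
theorem prob_first_inter_eq (H₁ : M.CorrMinmax C E σ θ) (H₂ : M.CorrQuotient C E θ υ)
    (hE : ∀ e ∈ E, M.IsTerminal e) {c : S} (hc : c ∈ C) : Pr σ (untilEv Cᶜ {c} ∩ ev E) =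
      Pr υ (untilEv (M.canC C E)ᶜ {M.proj C E (.inl c)} ∩ ev {.inl .TP}) := by
  set f : ↥(firstAt (A := A) C c) × Extremal → Hist (S ⊕ Verdict) (A ⊕ Extremal) :=
    fun p => (p.1.1.map .inl .inl).snoc (.inr p.2) (.inr .TP) with hf
  have f_inj : Function.Injective f := by
    rintro ⟨g, x⟩ ⟨g', x'⟩ e
    simp only [hf, Hist.snoc.injEq, Sum.inr.injEq, and_true] at e
    obtain ⟨e1, rfl⟩ := e
    rw [Subtype.ext (map_injective Sum.inl_injective Sum.inl_injective e1)]
  have h1 : Pr σ (untilEv Cᶜ {c} ∩ ev E) = Pr θ {ω | ∃ n, ω n ∈ Set.range f} := by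
    rw [prob_first_inter_eq_tsum σ hE hc]
    symm
    refine (PrFrom_visits θ _ _ ?_).trans ?_
    · rintro ω hω n m ⟨p, e⟩ ⟨p', e'⟩
      refine hω.unique_of_terminal ?_ ?_
      · rw [← e]; exact minmax_terminal_verdict _
      · rw [← e']; exact minmax_terminal_verdict _
    · rw [tsum_range (fun h => wt θ (.start (M.minmax C E).init) h) f_inj,
        ENNReal.tsum_prod (f := fun g x => wt θ (.start (M.minmax C E).init) (f (g, x)))]
      refine tsum_congr fun g => ?_
      rw [tsum_fintype]
      exact H₁.wt_TP M.init g.2.1 (by rw [g.2.2]; exact hc)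
  -- Recording the action, and not only the outcome `TP`, keeps track of the state `c` through which
  -- it was reached.
  set Q : Set (Hist (M.CanState C E) (CanAct S A)) :=
    {ρ' | ∃ ρ, ∃ x : Extremal, TauFree ρ ∧
      ρ' = ρ.snoc (.ext (.inl c) (.inr x)) (.inl .TP)}
  have h2 : Pr θ {ω | ∃ n, ω n ∈ Set.range f} = Pr θ {ω | ∃ n, M.collapse C E (ω n) ∈ Q} := by
    refine PrFrom_congr fun ω hω => ⟨?_, ?_⟩
    · rintro ⟨n, ⟨g, x⟩, e⟩
      refine ⟨n, M.collapse C E (g.1.map .inl .inl), x, tauFree_collapse _, ?_⟩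
      have hl : (g.1.map .inl .inl : Hist (S ⊕ Verdict) (A ⊕ Extremal)).last = .inl c := by
        rw [last_map, g.2.2]
      rw [← e, hf, collapse_snoc_of_not_internal, hl]
      · rfl
      · rw [hl]
        exact fun h => not_inMEC_of_mem hc h.inMEC
    · rintro ⟨n, ρ, x, _, e⟩
      obtain ⟨m, _, _, hm, _, t, et, ht⟩ := IsRun.exists_leave hω e
      obtain rfl : t = .inr .TP := (proj_eq_outcome (v := .TP)).1 ht
      obtain ⟨g, eg, hg, hgc⟩ := hω.exists_map hm
      exact ⟨m + 1, ⟨⟨g, hg, hgc⟩, x⟩, by rw [et, eg]⟩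
  have h3 := H₂.prob_visits (Q := Q) (by rintro _ ⟨ρ, x, h, rfl⟩; exact h)
    (by
      rintro ω hω n m ⟨ρ, x, _, e⟩ ⟨ρ', x', _, e'⟩
      refine hω.unique_of_terminal ?_ ?_
      · rw [e]; exact canonical_terminal_inl _
      · rw [e']; exact canonical_terminal_inl _)
    (by
      rintro ω hω n m ⟨ρ, x, _, e⟩ ⟨ρ', x', _, e'⟩
      refine hω.collapse_unique_of_terminal ?_ ?_
      · rw [e]; exact canonical_terminal_inl _
      · rw [e']; exact canonical_terminal_inl _)
  rw [h1, h2, ← h3]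
  refine PrFrom_congr fun ω hω => ?_
  rw [Set.mem_inter_iff, IsRun.mem_untilEv_canC hω hc, mem_ev]
  constructor
  · rintro ⟨n, ρ, x, _, e⟩
    refine ⟨?_, n, by rw [e]; rfl⟩
    have h0 := hω.isChain.pre (Nat.zero_le n)
    have hp := hω.isPath trivial n
    rw [e] at hp
    have hρ : ρ.Pre (ω n) := by rw [e]; exact pre_snoc_self _ _ _
    obtain ⟨m, _, em⟩ := hω.isChain.exists_eq
      (by rw [hω.zero] at h0 ⊢; exact start_pre_of_pre h0 hρ) hρ
    exact ⟨m, by rw [em]; exact (canonical_ext_pos hp.2).1.symm⟩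
  · rintro ⟨⟨n, hn⟩, m, hm⟩
    obtain ⟨x, v, e⟩ := hω.after_mem hc hn
    have hv : v.outcome = .TP :=
      IsRun.outcome_unique hω (n := n + 1) (by rw [e _ (Nat.lt_succ_self n)]; rfl) hm
    refine ⟨n + 1, ω n, x, ?_, by rw [e _ (Nat.lt_succ_self n), hv]⟩
    refine tauFree_of_isPath (hω.isPath trivial n) fun e => ?_
    refine canonical_not_terminal_of_mem (M := M) (E := E) hc ?_
    rw [← hn, e]
    exact canonical_terminal_inl _

theorem proj_eq_FN_iff (hE : ∀ e ∈ E, M.IsTerminal e) (hC : C ⊆ Eᶜ) {s : S ⊕ Verdict} :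
    M.proj C E s = .inl .FN ↔ ∃ e ∈ E, s = .inl e := by
  constructor
  · intro h
    rcases s with s | v
    · refine ⟨s, ?_, rfl⟩
      simp only [proj] at h
      split_ifs at h with _ hs
      · exact hs
      · simp at h
    · rw [proj_verdict] at h
      cases v <;> simp [Verdict.outcome] at h
  · rintro ⟨e, he, rfl⟩
    have ht : (M.minmax C E).IsTerminal (.inl e) :=
      (minmax_terminal_iff fun h => hC h he).2 (hE e he)
    simp [proj, ht, he]

/-- States of `E` are absorbing and lie outside `C`, so avoiding `C` up to the arrival in `E` means
avoiding it forever. -/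
theorem prob_FN_eq (H₁ : M.CorrMinmax C E σ θ) (H₂ : M.CorrQuotient C E θ υ)
    (hE : ∀ e ∈ E, M.IsTerminal e) (hC : C ⊆ Eᶜ) :
    Pr σ ((ev C)ᶜ ∩ ev E) = Pr υ (ev {.inl .FN}) := by
  set G : Set (Hist S A) := {g | g.AvoidsBeforeLast C ∧ g.last ∈ E}
  have h1 : Pr σ ((ev C)ᶜ ∩ ev E) = Pr σ {ω | ∃ n, ω n ∈ G} := by
    refine PrFrom_congr fun ω hω => ?_
    rw [Set.mem_inter_iff, Set.mem_compl_iff, mem_ev, mem_ev]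
    constructor
    · rintro ⟨h, n, hn⟩
      exact ⟨n, hω.avoidsBeforeLast fun i _ hi => h ⟨i, hi⟩, hn⟩
    · rintro ⟨n, hn, he⟩
      refine ⟨?_, n, he⟩
      rintro ⟨m, hm⟩
      have hne : ω m ≠ ω n := fun e => hC hm (by rw [e]; exact he)
      rcases le_total m n with h | h
      · exact hn.last_notMem (hω.isChain.pre h) hne hm
      · exact hne (hω.eq_of_terminal (hE _ he) h)
  have ht : ∀ e ∈ E, (M.minmax C E).IsTerminal (.inl e) := fun e he =>
    (minmax_terminal_iff fun h => hC h he).2 (hE e he)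
  have h2 : Pr σ {ω | ∃ n, ω n ∈ G} = Pr θ {ω | ∃ n, ω n ∈ map .inl .inl '' G} := by
    refine H₁.prob_visits (fun g hg => hg.1) ?_ ?_
    · exact fun ω hω n m hn hm => hω.unique_of_terminal (hE _ hn.2) (hE _ hm.2)
    · rintro ω hω n m ⟨g, hg, e⟩ ⟨g', hg', e'⟩
      refine hω.unique_of_terminal ?_ ?_
      · rw [← e, last_map]; exact ht _ hg.2
      · rw [← e', last_map]; exact ht _ hg'.2
  have h3 : Pr θ {ω | ∃ n, ω n ∈ map .inl .inl '' G} =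
      Pr θ {ω | ∃ n, M.collapse C E (ω n) ∈ {ρ | TauFree ρ ∧ ρ.last = .inl .FN}} := by
    refine PrFrom_congr fun ω hω => exists_congr fun n => ?_
    have hl := (hω.isPath trivial n).collapse_last
    constructor
    · rintro ⟨g, hg, e⟩
      refine ⟨tauFree_collapse _, ?_⟩
      rw [hl, proj_eq_FN_iff hE hC, ← e, last_map]
      exact ⟨_, hg.2, rfl⟩
    · rintro ⟨_, e⟩
      rw [hl, proj_eq_FN_iff hE hC] at e
      obtain ⟨t, hte, e⟩ := e
      obtain ⟨g, e1, hg, hgt⟩ := hω.exists_map e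
      exact ⟨g, ⟨hg, hgt ▸ hte⟩, e1.symm⟩
  have h4 := H₂.prob_visits (Q := {ρ | TauFree ρ ∧ ρ.last = .inl .FN}) (fun ρ hρ => hρ.1)
    (fun ω hω n m hn hm => hω.unique_of_terminal
      (by rw [hn.2]; exact canonical_terminal_inl _)
      (by rw [hm.2]; exact canonical_terminal_inl _))
    (fun ω hω n m hn hm => hω.collapse_unique_of_terminal
      (by rw [hn.2]; exact canonical_terminal_inl _)
      (by rw [hm.2]; exact canonical_terminal_inl _))
  rw [h1, h2, h3, ← h4]
  refine PrFrom_congr fun ω hω => ?_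
  rw [mem_ev]
  refine exists_congr fun n => ⟨fun h => h.2, fun h => ⟨?_, h⟩⟩
  refine tauFree_of_isPath (hω.isPath trivial n) ?_
  rw [show (ω n).last = .inl .FN from h]
  simp

/-- Almost all runs of the canonical MDP under a policy that corresponds to one of the MDP of the
first step are finite. -/
theorem CorrQuotient.prob_terminal (H : M.CorrQuotient C E θ υ) :
    Pr υ (ev (Set.range Sum.inl)) = 1 := by
  refine le_antisymm prob_le_one ?_
  -- A canonical run can end in two ways: without `τ` (the set `Q`), or by `τ` after a nonterminal
  -- history (an element of `D`). Their weights are transferred to `θ` separately.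
  set Q : Set (Hist (M.CanState C E) (CanAct S A)) :=
    {ρ | TauFree ρ ∧ ρ.last ∈ Set.range Sum.inl}
  set D : Set (Hist (M.CanState C E) (CanAct S A)) :=
    {ρ | TauFree ρ ∧ ¬ (M.canonical C E).IsTerminal ρ.last}
  set f : D → Hist (M.CanState C E) (CanAct S A) := fun ρ => ρ.1.snoc .tau (.inl .TN) with hf
  have f_inj : Function.Injective f := fun ρ ρ' e => by
    simp only [hf, Hist.snoc.injEq, and_true] at e
    exact Subtype.ext e
  have hter : ∀ ρ ∈ Q ∪ Set.range f, (M.canonical C E).IsTerminal ρ.last := by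
    rintro ρ (⟨_, o, e⟩ | ⟨ρ, rfl⟩)
    · rw [← e]; exact canonical_terminal_inl o
    · exact canonical_terminal_inl _
  have hdis : Disjoint Q (Set.range f) := by
    rw [Set.disjoint_right]
    rintro _ ⟨ρ, rfl⟩ h
    exact h.1
  have h1 : Pr υ {ω | ∃ n, ω n ∈ Q ∪ Set.range f} =
      (∑' ρ : Q, wt υ (.start (M.proj C E (.inl M.init))) ρ) +
        ∑' ρ : D, Pr θ (M.leaveEv C E ρ .tau) := by
    refine (PrFrom_visits υ _ _ fun ω hω n m hn hm =>
      hω.unique_of_terminal (hter _ hn) (hter _ hm)).trans ?_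
    rw [ENNReal.summable.tsum_union_disjoint hdis ENNReal.summable,
      tsum_range (fun ρ => wt υ (.start (M.canonical C E).init) ρ) f_inj]
    exact congrArg _ (tsum_congr fun ρ => H.wt_tau ρ.2.1 ρ.2.2)
  have h2 : Pr θ {ω | ∃ n, M.collapse C E (ω n) ∈ Q} =
      ∑' ρ : Q, wt υ (.start (M.proj C E (.inl M.init))) ρ := by
    have hter' : ∀ ρ ∈ Q, (M.canonical C E).IsTerminal ρ.last := fun ρ h => hter ρ (.inl h)
    have hυ : ∀ ω, IsRun υ (.start (M.proj C E (.inl M.init))) ω →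
        ∀ n m, ω n ∈ Q → ω m ∈ Q → ω n = ω m := fun ω hω n m hn hm =>
      hω.unique_of_terminal (hter' _ hn) (hter' _ hm)
    rw [← H.prob_visits (fun ρ h => h.1) hυ fun ω hω n m hn hm =>
      hω.collapse_unique_of_terminal (hter' _ hn) (hter' _ hm)]
    exact PrFrom_visits υ _ _ hυ
  -- Almost surely a run of the first step ends or from some time on takes internal steps only; then
  -- its collapsed history is eventually constant.
  have h3 : Pr θ ({ω | ∃ n, M.collapse C E (ω n) ∈ Q} ∪ ⋃ ρ : D, M.leaveEv C E ρ .tau) = 1 := by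
    rw [← measure_univ (μ := Pr θ)]
    refine measure_congr ?_
    filter_upwards [ae_isRun θ (.start (.inl M.init)), ae_terminal_or_internal θ _] with ω hω h
    refine propext (iff_of_true ?_ trivial)
    have hl := fun n => (hω.isPath trivial n).collapse_last
    rcases h with ⟨n, hn⟩ | h
    · refine Or.inl ⟨n, tauFree_collapse _, ?_⟩
      obtain ⟨o, ho⟩ := proj_of_terminal hn
      exact ⟨o, by rw [hl, ho]⟩
    · obtain ⟨k, hk⟩ := Filter.eventually_atTop.1 h
      refine Or.inr (Set.mem_iUnion.2 ⟨⟨M.collapse C E (ω k), tauFree_collapse _, ?_⟩, k, ?_⟩)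
      · obtain ⟨a, t, e, _⟩ := hk k le_rfl
        rw [hl, canonical_terminal_proj]
        exact (hω.enabled e).1
      · intro n hn
        induction n, hn using Nat.le_induction with
        | base => rfl
        | succ n hn ih =>
          obtain ⟨a, t, e, ha⟩ := hk n hn
          rw [e, collapse_snoc_of_internal ha, ih]
  calc (1 : ENNReal) = _ := h3.symm
    _ ≤ Pr θ {ω | ∃ n, M.collapse C E (ω n) ∈ Q} + ∑' ρ : D, Pr θ (M.leaveEv C E ρ .tau) :=
      (measure_union_le _ _).trans (add_le_add le_rfl (measure_iUnion_le _))
    _ = Pr υ {ω | ∃ n, ω n ∈ Q ∪ Set.range f} := by rw [h1, h2]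
    _ ≤ Pr υ (ev (Set.range Sum.inl)) := by
      refine measure_mono ?_
      rintro ω ⟨n, hn⟩
      rw [mem_ev]
      refine ⟨n, ?_⟩
      rcases hn with h | ⟨ρ, e⟩
      · exact h.2
      · rw [← e]; exact ⟨_, rfl⟩

theorem prob_visit_C_eq (H₁ : M.CorrMinmax C E σ θ) (H₂ : M.CorrQuotient C E θ υ) :
    Pr σ (ev C) = Pr υ (ev (M.canC C E)) := by
  have h1 := measure_inter_ev_eq_tsum (Pr σ) C MeasurableSet.univ
  simp only [Set.inter_univ] at h1
  rw [h1]
  symm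
  refine (measure_eq_tsum_of_ae
    (Y := fun c : C => untilEv (M.canC C E)ᶜ {M.proj C E (.inl c.1)}) ?_ ?_
    fun c => measurableSet_untilEv _ _).trans
    (tsum_congr fun c => (prob_first_eq H₁ H₂ c.2).symm)
  · refine (ae_isRun υ (.start (M.proj C E (.inl M.init)))).mono fun ω hω => ?_
    rw [mem_ev]
    constructor
    · rintro ⟨n, c, hc, e⟩
      exact ⟨⟨c, hc⟩, (hω.mem_untilEv_canC hc).2 ⟨n, e.symm⟩⟩
    · rintro ⟨⟨c, hc⟩, h⟩
      obtain ⟨n, hn⟩ := (hω.mem_untilEv_canC hc).1 h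
      exact ⟨n, c, hc, hn.symm⟩
  · refine (ae_isRun υ (.start (M.proj C E (.inl M.init)))).mono fun ω hω => ?_
    intro c c' h h'
    obtain ⟨n, hn⟩ := (hω.mem_untilEv_canC c.2).1 h
    obtain ⟨m, hm⟩ := (hω.mem_untilEv_canC c'.2).1 h'
    rw [hω.unique_mem c.2 c'.2 hn hm, hm] at hn
    exact Subtype.ext (Sum.inl_injective ((proj_eq_of_mem c.2).1 hn)).symm

theorem prob_TP_eq (H₁ : M.CorrMinmax C E σ θ) (H₂ : M.CorrQuotient C E θ υ)
    (hE : ∀ e ∈ E, M.IsTerminal e) : Pr σ (ev C ∩ ev E) = Pr υ (ev {.inl .TP}) := by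
  rw [measure_inter_ev_eq_tsum (Pr σ) C (measurableSet_ev E),
    tsum_congr fun c : C => prob_first_inter_eq H₁ H₂ hE c.2]
  set Y : C → Set (ℕ → Hist (M.CanState C E) (CanAct S A)) := fun c =>
    untilEv (M.canC C E)ᶜ {M.proj C E (.inl c.1)} ∩ ev {.inl .TP}
  have hm : ∀ c, MeasurableSet (Y c) := fun c =>
    (measurableSet_untilEv _ _).inter (measurableSet_ev _)
  symm
  refine measure_eq_tsum_of_ae (μ := Pr υ) (Y := Y) ?_ ?_ hm
  · refine (ae_isRun υ (.start (M.proj C E (.inl M.init)))).mono fun ω hω => ?_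
    constructor
    · intro h
      obtain ⟨n, c, hc, e⟩ := mem_ev.1 (hω.mem_ev_canC.2 ⟨.TP, h⟩)
      have hU := (hω.mem_untilEv_canC hc).2 ⟨n, e.symm⟩
      exact ⟨⟨c, hc⟩, Set.mem_inter hU h⟩
    · rintro ⟨c, h⟩
      exact h.2
  · refine (ae_isRun υ (.start (M.proj C E (.inl M.init)))).mono fun ω hω => ?_
    rintro c c' ⟨h, _⟩ ⟨h', _⟩
    obtain ⟨n, hn⟩ := (hω.mem_untilEv_canC c.2).1 h
    obtain ⟨m, hm⟩ := (hω.mem_untilEv_canC c'.2).1 h'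
    rw [hω.unique_mem c.2 c'.2 hn hm, hm] at hn
    exact Subtype.ext (Sum.inl_injective ((proj_eq_of_mem c.2).1 hn)).symm

theorem prob_canC_inter_TP (υ : (M.canonical C E).Policy) :
    Pr υ (ev (M.canC C E) ∩ ev {.inl .TP}) = Pr υ (ev {.inl .TP}) :=
  PrFrom_congr (h := .start (M.proj C E (.inl M.init))) fun _ hω =>
    ⟨fun h => h.2, fun h => ⟨hω.mem_ev_canC.2 ⟨.TP, h⟩, h⟩⟩

/-- Subtract the `TP` part from the event of reaching `C`; canonical runs through `C` end in `TP` or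
`FP`. -/
theorem prob_FP_eq (H₁ : M.CorrMinmax C E σ θ) (H₂ : M.CorrQuotient C E θ υ)
    (hE : ∀ e ∈ E, M.IsTerminal e) : Pr σ (ev C ∩ (ev E)ᶜ) = Pr υ (ev {.inl .FP}) := by
  have h1 := measure_inter_add_sdiff (μ := Pr σ) (ev C) (measurableSet_ev E)
  have h2 := measure_inter_add_sdiff (μ := Pr υ) (ev (M.canC C E))
    (measurableSet_ev {.inl .TP})
  have h3 : Pr υ (ev (M.canC C E) \ ev {.inl .TP}) = Pr υ (ev {.inl .FP}) := by
    refine PrFrom_congr (h := .start (M.proj C E (.inl M.init))) fun ω hω => ?_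
    rw [Set.mem_sdiff, hω.mem_ev_canC]
    constructor
    · rintro ⟨⟨_ | _, h⟩, h'⟩
      exacts [absurd h h', h]
    · exact fun h => ⟨⟨.FP, h⟩, hω.not_mem_ev_of_ne h (by simp)⟩
  rw [prob_canC_inter_TP, h3, ← prob_visit_C_eq H₁ H₂, ← prob_TP_eq H₁ H₂ hE, ← h1] at h2
  exact ((ENNReal.add_right_inj (measure_ne_top _ _)).1 h2).symm

/-- Subtract the `FN` part from the event of avoiding `C`. In the canonical MDP the rest is `TN`
only because runs under `υ` terminate almost surely. -/
theorem prob_TN_eq (H₁ : M.CorrMinmax C E σ θ) (H₂ : M.CorrQuotient C E θ υ)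
    (hE : ∀ e ∈ E, M.IsTerminal e) (hC : C ⊆ Eᶜ) :
    Pr σ ((ev C)ᶜ ∩ (ev E)ᶜ) = Pr υ (ev {.inl .TN}) := by
  have h1 := measure_inter_add_sdiff (μ := Pr σ) (ev C)ᶜ (measurableSet_ev E)
  have h2 := measure_inter_add_sdiff (μ := Pr υ) (ev (M.canC C E))ᶜ
    (measurableSet_ev {.inl .FN})
  have h3 : Pr υ ((ev (M.canC C E))ᶜ ∩ ev {.inl .FN}) = Pr υ (ev {.inl .FN}) := by
    refine PrFrom_congr (h := .start (M.proj C E (.inl M.init))) fun ω hω => ?_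
    rw [Set.mem_inter_iff, Set.mem_compl_iff, hω.mem_ev_canC]
    refine ⟨fun h => h.2, fun h => ⟨?_, h⟩⟩
    rintro ⟨v, hv⟩
    exact hω.not_mem_ev_of_ne hv (by cases v <;> simp [Verdict.outcome]) h
  have h4 : Pr υ ((ev (M.canC C E))ᶜ \ ev {.inl .FN}) = Pr υ (ev {.inl .TN}) := by
    have hter := (mem_ae_iff_prob_eq_one (measurableSet_ev _)).2 H₂.prob_terminal
    refine measure_congr ?_
    filter_upwards [ae_isRun υ (.start (M.proj C E (.inl M.init))), hter] with ω hω ht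
    refine propext ?_
    change ω ∈ (ev (M.canC C E))ᶜ \ ev {.inl .FN} ↔ ω ∈ ev {.inl .TN}
    rw [Set.mem_sdiff, Set.mem_compl_iff, hω.mem_ev_canC]
    constructor
    · rintro ⟨hv, hFN⟩
      obtain ⟨n, o, ho⟩ := mem_ev.1 ht
      have h : ω ∈ ev {.inl o} := mem_ev.2 ⟨n, ho.symm⟩
      cases o with
      | TP => exact absurd ⟨.TP, h⟩ hv
      | FP => exact absurd ⟨.FP, h⟩ hv
      | FN => exact absurd h hFN
      | TN => exact h
    · refine fun h => ⟨?_, hω.not_mem_ev_of_ne h (by simp)⟩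
      rintro ⟨v, hv⟩
      exact hω.not_mem_ev_of_ne hv (by cases v <;> simp [Verdict.outcome]) h
  have h5 : Pr σ (ev C)ᶜ = Pr υ (ev (M.canC C E))ᶜ := by
    rw [prob_compl_eq_one_sub (measurableSet_ev _), prob_compl_eq_one_sub (measurableSet_ev _),
      prob_visit_C_eq H₁ H₂]
  rw [h3, h4, ← h5, ← prob_FN_eq H₁ H₂ hE hC, ← h1] at h2
  exact ((ENNReal.add_right_inj (measure_ne_top _ _)).1 h2).symm

theorem prob_E_eq (H₁ : M.CorrMinmax C E σ θ) (H₂ : M.CorrQuotient C E θ υ)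
    (hE : ∀ e ∈ E, M.IsTerminal e) (hC : C ⊆ Eᶜ) :
    Pr σ (ev E) = Pr υ (ev (M.canE C E)) := by
  have h1 := measure_inter_add_sdiff (μ := Pr σ) (ev E) (measurableSet_ev C)
  have h2 := measure_inter_add_sdiff (μ := Pr υ) (ev (M.canE C E)) (measurableSet_ev {.inl .TP})
  have h3 : (ev (M.canE C E) ∩ ev {.inl .TP} : Set (ℕ → Hist _ (CanAct S A))) =
      ev {.inl .TP} := by
    ext ω
    rw [Set.mem_inter_iff, mem_ev_canE]
    tauto
  have h4 : Pr υ (ev (M.canE C E) \ ev {.inl .TP}) = Pr υ (ev {.inl .FN}) := by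
    refine PrFrom_congr (h := .start (M.proj C E (.inl M.init))) fun ω hω => ?_
    rw [Set.mem_sdiff, mem_ev_canE]
    exact ⟨fun h => h.1.resolve_left h.2, fun h =>
      ⟨.inr h, hω.not_mem_ev_of_ne h (by simp)⟩⟩
  rw [← h1, ← h2, h3, h4, ← prob_TP_eq H₁ H₂ hE, ← prob_FN_eq H₁ H₂ hE hC, Set.inter_comm (ev E),
    Set.sdiff_eq_compl_inter]

theorem prob_first_inter_canE (H₁ : M.CorrMinmax C E σ θ) (H₂ : M.CorrQuotient C E θ υ)
    (hE : ∀ e ∈ E, M.IsTerminal e) {c : S} (hc : c ∈ C) : Pr σ (untilEv Cᶜ {c} ∩ ev E) =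
      Pr υ (untilEv (M.canC C E)ᶜ {M.proj C E (.inl c)} ∩ ev (M.canE C E)) := by
  rw [prob_first_inter_eq H₁ H₂ hE hc]
  refine PrFrom_congr (h := .start (M.proj C E (.inl M.init))) fun ω hω => ?_
  rw [Set.mem_inter_iff, Set.mem_inter_iff, mem_ev_canE]
  refine and_congr_right fun h => ⟨.inl, fun h' => h'.resolve_right fun hFN => ?_⟩
  obtain ⟨n, hn⟩ := (hω.mem_untilEv_canC hc).1 h
  obtain ⟨v, hv⟩ := hω.mem_ev_canC.1 (mem_ev.2 ⟨n, c, hc, hn.symm⟩)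
  exact hω.not_mem_ev_of_ne hv (by cases v <;> simp [Verdict.outcome]) hFN

/-- For each `c` all three probabilities in the condition transfer unchanged. -/
theorem strictPR_iff (H₁ : M.CorrMinmax C E σ θ) (H₂ : M.CorrQuotient C E θ υ)
    (hE : ∀ e ∈ E, M.IsTerminal e) (hC : C ⊆ Eᶜ) :
    M.StrictPR C E σ ↔ (M.canonical C E).StrictPR (M.canC C E) (M.canE C E) υ := by
  refine Iff.trans (forall₂_congr fun c hc => ?_) Set.forall_mem_image.symm
  rw [cond_apply (measurableSet_untilEv _ _), cond_apply (measurableSet_untilEv _ _),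
    prob_first_inter_canE H₁ H₂ hE hc, prob_first_eq H₁ H₂ hc, prob_E_eq H₁ H₂ hE hC]

theorem globalPR_iff (H₁ : M.CorrMinmax C E σ θ) (H₂ : M.CorrQuotient C E θ υ)
    (hE : ∀ e ∈ E, M.IsTerminal e) (hC : C ⊆ Eᶜ) :
    M.GlobalPR C E σ ↔ (M.canonical C E).GlobalPR (M.canC C E) (M.canE C E) υ := by
  have h : Pr υ (ev (M.canC C E) ∩ ev (M.canE C E)) = Pr υ (ev {.inl .TP}) := by
    refine PrFrom_congr (h := .start (M.proj C E (.inl M.init))) fun ω hω => ?_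
    rw [Set.mem_inter_iff, mem_ev_canE]
    refine ⟨fun h => h.2.resolve_right fun hFN => ?_,
      fun h => ⟨hω.mem_ev_canC.2 ⟨.TP, h⟩, .inl h⟩⟩
    obtain ⟨v, hv⟩ := hω.mem_ev_canC.1 h.1
    exact hω.not_mem_ev_of_ne hv (by cases v <;> simp [Verdict.outcome]) hFN
  unfold GlobalPR
  rw [cond_apply (measurableSet_ev _), cond_apply (measurableSet_ev _), h,
    prob_E_eq H₁ H₂ hE hC, prob_visit_C_eq H₁ H₂, prob_TP_eq H₁ H₂ hE]

end Corresponding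

end MDP

theorem corollary14 {S A : Type*} [Fintype S] [Fintype A] (M : MDP S A) (C E : Set S)
    (hE : ∀ e ∈ E, M.IsTerminal e) (hC : C ⊆ Eᶜ) :
    (∀ σ : M.Policy, ∃ υ : (M.canonical C E).Policy, M.Corresponds C E σ υ) ∧
    (∀ υ : (M.canonical C E).Policy, ∃ σ : M.Policy, M.Corresponds C E σ υ) ∧
    ∀ (σ : M.Policy) (υ : (M.canonical C E).Policy), M.Corresponds C E σ υ →
      (MDP.Pr σ (MDP.ev C ∩ MDP.ev E) = MDP.Pr υ (MDP.ev {Sum.inl MDP.Outcome.TP}) ∧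
        MDP.Pr σ (MDP.ev C ∩ (MDP.ev E)ᶜ) = MDP.Pr υ (MDP.ev {Sum.inl MDP.Outcome.FP}) ∧
        MDP.Pr σ ((MDP.ev C)ᶜ ∩ MDP.ev E) = MDP.Pr υ (MDP.ev {Sum.inl MDP.Outcome.FN}) ∧
        MDP.Pr σ ((MDP.ev C)ᶜ ∩ (MDP.ev E)ᶜ) = MDP.Pr υ (MDP.ev {Sum.inl MDP.Outcome.TN})) ∧
      (M.StrictPR C E σ ↔ (M.canonical C E).StrictPR (M.canC C E) (M.canE C E) υ) ∧
      (M.GlobalPR C E σ ↔ (M.canonical C E).GlobalPR (M.canC C E) (M.canE C E) υ) := by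
  refine ⟨fun σ => ?_, fun υ => ?_, ?_⟩
  · obtain ⟨θ, hθ⟩ := MDP.exists_corrMinmax_of_policy (C := C) hE σ
    obtain ⟨υ, hυ⟩ := MDP.exists_corrQuotient_of_policy θ
    exact ⟨υ, θ, hθ, hυ⟩
  · obtain ⟨θ, hθ⟩ := MDP.exists_policy_of_corrQuotient υ
    obtain ⟨σ, hσ⟩ := MDP.exists_policy_of_corrMinmax hE θ
    exact ⟨σ, θ, hσ, hθ⟩
  · rintro σ υ ⟨θ, H₁, H₂⟩
    exact ⟨⟨MDP.prob_TP_eq H₁ H₂ hE, MDP.prob_FP_eq H₁ H₂ hE, MDP.prob_FN_eq H₁ H₂ hE hC,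
      MDP.prob_TN_eq H₁ H₂ hE hC⟩, MDP.strictPR_iff H₁ H₂ hE hC, MDP.globalPR_iff H₁ H₂ hE hC⟩
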